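/- Let $\psi\in L^2(\mathbb R^3)$ be the positive rotation invariant minimizer of the Pekar functional $$\mathcal E(u)=\int|\nabla u|^2\,dx-\frac1{4\pi}\iint\frac{|u(x)|^2|u(y)|^2}{|x-y|}\,dx\,dy$$ over all $u\in H^1(\mathbb R^3)$ with $\|u\|_{L^2}=1$. Set $h_x(y)=-\frac{1}{2\pi^2|x-y|^2}$, $\varphi(z)=\int\frac{|\psi(y)|^2}{2\pi^2|z-y|^2}\,dy$, $V^\varphi(x)=2\int\varphi(y)h_x(y)\,dy$, $\lambda^{\rm Pek}=\inf\sigma(-\Delta+V^\varphi)$, $h^{\rm Pek}=-\Delta+V^\varphi-\lambda^{\rm Pek}$, and let $R=Q_\psi(h^{\rm Pek})^{-1}Q_\psi$ with $Q_\psi=1-|\psi\rangle\langle\psi|$ be the reduced resolvent. Let $H^{\rm Pek}$ be the operator on $L^2(\mathbb R^3)$ with integral kernel $\delta(y-z)-4\langle\psi|h_\cdot(y)Rh_\cdot(z)\psi\rangle_{L^2}$, and let $\Pi_0$ and $\Pi_1=1-\Pi_0$ be the orthogonal projections onto $\operatorname{Ker}H^{\rm Pek}$ and $(\operatorname{Ker}H^{\rm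 Pek})^\perp$. For $K\in(0,\infty]$ let $$h_{K,x}(y)=\frac1{(2\pi)^3}\int_{|k|\le K}\frac{e^{ik\cdot(x-y)}}{|k|}\,dk ,\qquad h^1_{K,x}=\Pi_1h_{K,x}$$ (for $K=\infty$, $h_{\infty,x}(y)=\frac1{2\pi^2|x-y|^2}$), let $T_K$ be the operator with integral kernel $\langle\psi|h^1_{K,\cdot}(y)Rh^1_{K,\cdot}(z)\psi\rangle_{L^2}$, and define the cutoff Hessian $H_K^{\rm Pek}:L^2(\mathbb R^3)\to L^2(\mathbb R^3)$ by $$H_K^{\rm Pek}\restriction\operatorname{Ran}\Pi_0=0,\qquad H_K^{\rm Pek}\restriction\operatorname{Ran}\Pi_1=\Pi_1-4T_K .$$ (The kernels with $h_x$ or $K=\infty$ are understood as the sesquilinear forms they define.) There exist constants $K_0>0$ and $C>0$ such that for all $K\in[K_0,\infty]$: (v) The set $\sigma_{\rm disc}(H_K^{\rm Pek})\cap[0,1)$ is infinite, and $1$ is its one and only accumulation point. The eigenvalues of $H_K^{\rm Pek}$ in $(0,1)$, numbered increasingly and counting multiplicity, form an infinite sequence $(\lambda_K^{(n)})_{n\in\mathbb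 N}$ with $\lambda_K^{(n)}\to1$ as $n\to\infty$. (vi) $|\lambda_K^{(n)}-\lambda_\infty^{(n)}|\le CK^{-1/2}$ for all $n\in\mathbb N$. (vii) For all $n\in\mathbb N$, every normalized eigenfunction $\mathfrak u_K^{(n)}$ of $H_K^{\rm Pek}$ with eigenvalue $\lambda_K^{(n)}$ lies in $\operatorname{Ran}\Pi_1$ and satisfies $\|\nabla\mathfrak u_K^{(n)}\|_{L^2}\le C\sqrt K\,(1-\lambda_K^{(n)})^{-1/2}$. The constants $K_0$ and $C$ do not depend on $K$ and $n$. For $K=\infty$ the bound (vii) is void (its right side is $\infty$), and (vi) is trivial. -/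

import Mathlib

open MeasureTheory Filter Topology
open scoped ENNReal SchwartzMap LineDeriv Laplacian

noncomputable section

namespace Polaron

/-- Physical space `ℝ³` with the Euclidean norm. -/
abbrev E3 : Type := EuclideanSpace ℝ (Fin 3)

/-- The complex Hilbert space `L²(ℝ³)`. -/
abbrev L2 : Type := Lp (α := E3) ℂ 2 (volume : Measure E3)

/-- A function on `ℝ³` as an element of `L²(ℝ³)` (and `0` if it is not square integrable). -/
def toL2 (f : E3 → ℂ) : L2 :=
  open Classical in if h : MemLp f 2 (volume : Measure E3) then h.toLp f else 0

/-- `u ∈ H¹(ℝ³)`. -/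
def MemH1 (u : L2) : Prop :=
  TemperedDistribution.MemSobolev 1 2 (u : 𝓢'(E3, ℂ))

/-- `u ∈ H²(ℝ³)`. -/
def MemH2 (u : L2) : Prop :=
  TemperedDistribution.MemSobolev 2 2 (u : 𝓢'(E3, ℂ))

/-- The square-integrable function `g` is the `i`-th weak (distributional) derivative of `u`. -/
def IsWeakPartial (i : Fin 3) (u g : L2) : Prop :=
  ∂_{(EuclideanSpace.single i 1 : E3)} (u : 𝓢'(E3, ℂ)) = (g : 𝓢'(E3, ℂ))

/-- `‖∇u‖²` as an extended nonnegative number. A weak derivative is unique if it exists, and the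
infimum over the empty set is `∞`; so this is `∑ i, ‖∂ᵢu‖²` if all weak partial derivatives of `u`
exist in `L²(ℝ³)`, and `∞` otherwise. -/
def gradNormSq (u : L2) : ℝ≥0∞ :=
  ∑ i : Fin 3, ⨅ (g : L2) (_ : IsWeakPartial i u g), ‖g‖ₑ ^ 2

/-- `‖∇u‖`, with the value `∞` if the weak gradient of `u` is not square integrable. -/
def gradNorm (u : L2) : ℝ≥0∞ :=
  gradNormSq u ^ (1 / 2 : ℝ)

/-- The Pekar functional
`∫ |∇u|² - (1 / 4π) ∬ |u(x)|² |u(y)|² / |x - y| dx dy` of the electron, for `u ∈ H¹(ℝ³)`. -/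
def pekarFunctional (u : L2) : ℝ :=
  (gradNormSq u).toReal -
    (4 * Real.pi)⁻¹ * ∫ x : E3, ∫ y : E3, ‖u x‖ ^ 2 * ‖u y‖ ^ 2 / ‖x - y‖

/-- `ψ` is a positive rotation invariant minimizer of the Pekar functional over the
`L²`-normalized functions in `H¹(ℝ³)`. -/
structure IsPekarMinimizer (ψ : L2) : Prop where
  memH1 : MemH1 ψ
  norm_eq_one : ‖ψ‖ = 1
  isMin : ∀ u : L2, MemH1 u → ‖u‖ = 1 → pekarFunctional ψ ≤ pekarFunctional u
  pos : ∀ᵐ x : E3, 0 < (ψ x).re ∧ (ψ x).im = 0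
  rotationInvariant : ∀ A : E3 ≃ₗᵢ[ℝ] E3, ∀ᵐ x : E3, ψ (A x) = ψ x

/-- The form factor `h_x(y) = -1 / (2 π² |x - y|²)`. -/
def formFactor (x y : E3) : ℝ :=
  -(1 / (2 * Real.pi ^ 2 * ‖x - y‖ ^ 2))

/-- The classical field `φ(z) = -⟨ψ, h_·(z) ψ⟩ = ∫ |ψ(y)|² / (2 π² |z - y|²) dy`. -/
def classicalField (ψ : L2) (z : E3) : ℝ :=
  -∫ y : E3, formFactor y z * ‖ψ y‖ ^ 2

/-- The polarization potential `V^v(x) = 2 Re ⟨v, h_x⟩` of a real-valued field `v`. -/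
def polarizationPotential (v : E3 → ℝ) (x : E3) : ℝ :=
  2 * ∫ y : E3, v y * formFactor x y

/-- `u` lies in the domain of the Schrödinger operator `-Δ + V`, that is `u ∈ H²(ℝ³)` and
`V u ∈ L²(ℝ³)`, and `(-Δ + V) u = f`. -/
def IsSchrodingerImage (V : E3 → ℝ) (u f : L2) : Prop :=
  MemH2 u ∧ ∃ w : L2, (∀ᵐ x : E3, w x = (V x : ℂ) * u x) ∧
    -Δ (u : 𝓢'(E3, ℂ)) + (w : 𝓢'(E3, ℂ)) = (f : 𝓢'(E3, ℂ))

/-- The spectrum of `-Δ + V` on `L²(ℝ³)`: all `z` for which `-Δ + V - z` has no bounded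
everywhere defined two-sided inverse `S`. -/
def schrodingerSpectrum (V : E3 → ℝ) : Set ℂ :=
  {z | ¬ ∃ S : L2 →L[ℂ] L2, ∀ u g : L2, IsSchrodingerImage V u (g + z • u) ↔ u = S g}

/-- The potential `V^φ`. -/
def pekarPotential (ψ : L2) : E3 → ℝ :=
  polarizationPotential (classicalField ψ)

/-- `λ^Pek = inf σ(-Δ + V^φ)`. -/
def pekarLambda (ψ : L2) : ℝ :=
  sInf {t : ℝ | (t : ℂ) ∈ schrodingerSpectrum (pekarPotential ψ)}

/-- `h^Pek u = f`, where `h^Pek = -Δ + V^φ - λ^Pek`. -/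
def IsPekarImage (ψ u f : L2) : Prop :=
  IsSchrodingerImage (pekarPotential ψ) u (f + (pekarLambda ψ : ℂ) • u)

/-- `R = Q (h^Pek)⁻¹ Q` with `Q = 1 - |ψ⟩⟨ψ|`: for every `f`, `R f` is the unique element `u` of
`{ψ}^⊥` in the domain of `h^Pek` with `h^Pek u = Q f = f - ⟨ψ, f⟩ ψ`. -/
def IsReducedResolvent (ψ : L2) (R : L2 →L[ℂ] L2) : Prop :=
  ∀ f u : L2, u = R f ↔ inner ℂ ψ u = 0 ∧ IsPekarImage ψ u (f - inner ℂ ψ f • ψ)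

/-- The reduced resolvent `R` of `h^Pek`. -/
def reducedResolvent (ψ : L2) : L2 →L[ℂ] L2 :=
  open Classical in if h : ∃ R, IsReducedResolvent ψ R then h.choose else 0

/-- There is at most one reduced resolvent. -/
theorem IsReducedResolvent.unique {ψ : L2} {R S : L2 →L[ℂ] L2}
    (hR : IsReducedResolvent ψ R) (hS : IsReducedResolvent ψ S) : R = S := by
  ext1 f
  exact (hS f (R f)).2 ((hR f (R f)).1 rfl)

/-- The bounded operator `T` on `L²(ℝ³)` with `⟨v, T w⟩ = b v w` for all `v`, `w`
(and `0` if there is none). -/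
def opOfForm (b : L2 → L2 → ℂ) : L2 →L[ℂ] L2 :=
  open Classical in
  if h : ∃ T : L2 →L[ℂ] L2, ∀ v w : L2, inner ℂ v (T w) = b v w then h.choose else 0

/-- There is at most one bounded operator with a given sesquilinear form. -/
theorem opOfForm_eq {b : L2 → L2 → ℂ} {T : L2 →L[ℂ] L2}
    (hT : ∀ v w : L2, inner ℂ v (T w) = b v w) : opOfForm b = T := by
  have h : ∃ T : L2 →L[ℂ] L2, ∀ v w : L2, inner ℂ v (T w) = b v w := ⟨T, hT⟩
  have h1 : opOfForm b = h.choose := by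
    unfold opOfForm
    exact dif_pos h
  rw [h1]
  ext1 w
  exact ext_inner_left ℂ fun v => (h.choose_spec v w).trans (hT v w).symm

/-- For a kernel `h_x(y)` and a function `v`, the function
`x ↦ (∫ h_x(y) v(y) dy) ψ(x)`. -/
def smear (ψ : L2) (h : E3 → E3 → ℂ) (v : L2) : L2 :=
  toL2 fun x => (∫ y : E3, h x y * v y) * ψ x

/-- The Hessian `H^Pek`, with integral kernel `δ(y - z) - 4 ⟨ψ, h_·(y) R h_·(z) ψ⟩`. The second
term is understood through its form
`⟨v, T w⟩ = ∬ conj(v(y)) ⟨ψ, h_·(y) R h_·(z) ψ⟩ w(z) dy dz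
  = ⟨(∫ h_·(y) v(y) dy) ψ, R (∫ h_·(z) w(z) dz) ψ⟩`, where `h` is real-valued. -/
def pekarHessian (ψ : L2) : L2 →L[ℂ] L2 :=
  ContinuousLinearMap.id ℂ L2 - (4 : ℂ) • opOfForm fun v w =>
    inner ℂ (smear ψ (fun x y => (formFactor x y : ℂ)) v)
      (reducedResolvent ψ (smear ψ (fun x y => (formFactor x y : ℂ)) w))

/-- The closed subspace `Ran Π₁ = (Ker H^Pek)^⊥`. -/
def ranPiOne (ψ : L2) : Submodule ℂ L2 :=
  (LinearMap.ker (pekarHessian ψ).toLinearMap)ᗮ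

/-- `Ran Π₁` is closed in `L²(ℝ³)`. -/
instance (ψ : L2) : CompleteSpace (ranPiOne ψ) := by
  unfold ranPiOne
  infer_instance

/-- The orthogonal projection `Π₁` onto `(Ker H^Pek)^⊥`. -/
def piOne (ψ : L2) : L2 →L[ℂ] L2 :=
  (ranPiOne ψ).starProjection

/-- The form factor with momentum cutoff `K ∈ (0, ∞]`,
`h_{K,x}(y) = (2π)⁻³ ∫_{|k| ≤ K} exp(i k (x - y)) / |k| dk`, which for `K = ∞` is the Fourier
representation of `1 / (2 π² |x - y|²)`. -/
def cutoffFormFactor (K : ℝ≥0∞) (x y : E3) : ℂ :=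
  open Classical in
  if K = ∞ then ((1 / (2 * Real.pi ^ 2 * ‖x - y‖ ^ 2) : ℝ) : ℂ)
  else ((2 * Real.pi : ℂ) ^ 3)⁻¹ *
    ∫ k in {k : E3 | ‖k‖ ≤ K.toReal},
      Complex.exp (Complex.I * ((inner ℝ k (x - y) : ℝ) : ℂ)) / (‖k‖ : ℂ)

/-- The operator `T_K` with integral kernel `⟨ψ, h¹_{K,·}(y) R h¹_{K,·}(z) ψ⟩`, where
`h¹_{K,x} = Π₁ h_{K,x}`, so that `∫ h¹_{K,x}(z) w(z) dz = ∫ h_{K,x}(z) (Π₁ w)(z) dz`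
(the projection `Π₁` has a real symmetric kernel). -/
def cutoffT (ψ : L2) (K : ℝ≥0∞) : L2 →L[ℂ] L2 :=
  opOfForm fun v w =>
    inner ℂ (smear ψ (cutoffFormFactor K) (piOne ψ v))
      (reducedResolvent ψ (smear ψ (cutoffFormFactor K) (piOne ψ w)))

/-- The Hessian with cutoff, `H_K^Pek`: it vanishes on `Ran Π₀ = Ker H^Pek`
and equals `Π₁ - 4 T_K` on `Ran Π₁`. -/
def cutoffHessian (ψ : L2) (K : ℝ≥0∞) : L2 →L[ℂ] L2 :=
  (piOne ψ - (4 : ℂ) • cutoffT ψ K) ∘L piOne ψ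

/-- The eigenspace of `T` for the real number `μ`. -/
def eigenspaceAt (T : L2 →L[ℂ] L2) (μ : ℝ) : Submodule ℂ L2 :=
  Module.End.eigenspace T.toLinearMap (μ : ℂ)

/-- The real points of the discrete spectrum of `T`: the eigenvalues of finite multiplicity that
are isolated points of the spectrum. -/
def discreteSpectrum (T : L2 →L[ℂ] L2) : Set ℝ :=
  {μ | eigenspaceAt T μ ≠ ⊥ ∧ FiniteDimensional ℂ (eigenspaceAt T μ) ∧
    ¬ AccPt (μ : ℂ) (𝓟 (spectrum ℂ T))}

/-- `lam 0 ≤ lam 1 ≤ lam 2 ≤ …` is the list of all eigenvalues of `T` in `(0, 1)`, each repeated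
as often as its multiplicity says. -/
structure IsEigenvalueEnumeration (T : L2 →L[ℂ] L2) (lam : ℕ → ℝ) : Prop where
  monotone : Monotone lam
  mem : ∀ n, lam n ∈ Set.Ioo (0 : ℝ) 1
  multiplicity : ∀ μ ∈ Set.Ioo (0 : ℝ) 1,
    {n | lam n = μ}.encard = Cardinal.toENat (Module.rank ℂ (eigenspaceAt T μ))

end Polaron

end

noncomputable section

namespace Polaron

open scoped FourierTransform ComplexConjugate

/-! ### Compact symmetric operators: enumeration of eigenvalues and Weyl's comparison -/

section Abstract

/-! Let `S_K v = ψ · (h_K * v)`. Its adjoint is `A_K f = 𝓕⁻¹ m_K 𝓕(ψ f)`, where `m_K(ξ) = 1/(2π|ξ|)`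
for `2π|ξ| ≤ K` and `0` otherwise. Then `T_K = Π₁ A_K R S_K Π₁` and `1 - H_K = Π₀ + 4 T_K`. The
theorem is a statement about this operator, which is compact, symmetric and nonnegative. An
eigenvalue `λ` of `H_K` in `(0, 1)` is an eigenvalue `1 - λ` of it in `(0, 1)`, so accumulation at
one becomes accumulation at zero.

Properties of `ψ` and `R`. The Riesz kernel `1/(2π²|x|²)` composed with itself is the Newton kernel
(`lintegral_riesz_mul_riesz`), so the Coulomb energy is a positive form. Minimality for the quartic
Pekar functional therefore implies that `ψ` minimizes the quadratic form of `-Δ + V^φ`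
(`pekarMu_le_of_norm_eq_one`), with a negative minimum, which is `λ^Pek`. With `B = (-Δ -
λ^Pek)^{-1/2} |V^φ| (-Δ - λ^Pek)^{-1/2}` this says `1 - B ≥ 0`, and `B` is compact. The null space
of `1 - B` is one dimensional because the heat kernel is strictly positive
(`eq_zero_of_inner_ground_state_eq_zero`). The Fredholm alternative then yields `R`
(`exists_isReducedResolvent`), which is symmetric, nonnegative, and has kernel spanned by `ψ`.
Moreover `ψ` is bounded, since the resolvent maps `L²` into `L^∞`.

Compactness and infinitude. `A_K` is Hilbert-Schmidt for finite `K`, and `‖A_∞ - A_K‖ ≤ ‖ψ‖_∞ / K`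
because `m_∞ - m_K ≤ 1/K`; hence `A_∞` is compact too. On `Ker H^Pek` the operator `4 T` without
cutoff is the identity, so `Π₀` is compact. If `1 - H_K` had only finitely many eigenvalues in `(0,
1)`, it would vanish on the complement of a finite dimensional space. There `R S_K x = 0` would
follow, so `S_K x` would be a multiple of `ψ`, contradicting the infinite rank of `S_K`
(`exists_linearIndependent_smearOp`).

Comparison of eigenvalues. `‖H_K - H_∞‖ = O(1/K)`, which is more than the rate asked for. Weyl's
principle (`finrank_spectralSum_le`) compares the numbers of eigenvalues of `1 - H_K` and `1 - H_∞`
above a level, but these counts include the eigenvalues `≥ 1`, which the enumerations omit. Their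
numbers agree for large `K` (`finrank_spectralSum_one_le`): both operators are the identity on `Ran
Π₀`, and on `Ran Π₁` the operator `H_∞` is bounded away from zero (`exists_gap`).

Gradient bound. If `H_K u = λ u`, then `(1 - λ) u = 4 Π₁ A_K f` with `f = R S_K u`. Positivity of
`R` gives `‖f‖² ≤ ‖R‖ (1 - λ)/4`, and `2π|ξ| m_K ≤ 1` gives `‖∇ A_K f‖ ≤ ‖ψ‖_∞ ‖f‖`. The part
removed by `Π₁` lies in `Ker H^Pek`, hence in the range of `A_∞`, and obeys the same kind of bound.
The result is uniform in `K`; the factor `√K` is only an upper bound for `1`. -/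

/-- Finite initial segments make the order locally finite with a least element, and infinitude
excludes a greatest one; these properties characterize `ℕ`. -/
theorem exists_orderIso_nat (ι : Type*) [LinearOrder ι] [Infinite ι]
    (h : ∀ i : ι, (Set.Iic i).Finite) : Nonempty (ι ≃o ℕ) := by
  let : LocallyFiniteOrder ι :=
    LocallyFiniteOrder.ofFiniteIcc fun a b => (h b).subset fun x hx => hx.2
  let := LinearLocallyFiniteOrder.succOrder ι
  let := LinearLocallyFiniteOrder.predOrder ι
  obtain ⟨i₀⟩ : Nonempty ι := inferInstance
  obtain ⟨m, hm, hmin⟩ := (h i₀).exists_minimal ⟨i₀, le_refl i₀⟩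
  let : OrderBot ι :=
    { bot := m
      bot_le := fun a => by
        rcases le_total a m with ha | ha
        · exact hmin (ha.trans hm) ha
        · exact ha }
  have : NoMaxOrder ι := ⟨fun a => by
    by_contra! hcon
    exact Set.infinite_univ ((h a).subset fun x _ => hcon x)⟩
  exact ⟨orderIsoNatOfLinearSuccPredArch⟩

theorem exists_monotone_enumeration {S : Set ℝ} (hinf : S.Infinite) (hS : S ⊆ Set.Iio 1)
    (hfin : ∀ x < (1 : ℝ), (S ∩ Set.Iic x).Finite) (d : ℝ → ℕ) (hd : ∀ μ, μ ∈ S ↔ d μ ≠ 0) :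
    ∃ lam : ℕ → ℝ, Monotone lam ∧ (∀ n, lam n ∈ S) ∧
      (∀ μ, {n | lam n = μ}.encard = d μ) ∧ Tendsto lam atTop (𝓝 1) := by
  classical
  have : Infinite S := hinf.to_subtype
  -- Every value appears with `d μ` labels, ordered lexicographically; the enumeration is the first
  -- component of the order isomorphism of this index set with `ℕ`.
  let ι := Σₗ μ : S, Fin (d μ)
  have hpos : ∀ μ : S, 0 < d μ := fun μ => Nat.pos_of_ne_zero ((hd μ).1 μ.2)
  have : Infinite ι := by
    apply Infinite.of_injective (fun μ : S => (toLex ⟨μ, ⟨0, hpos μ⟩⟩ : ι))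
    intro a b hab
    exact congrArg (fun z : ι => (ofLex z).1) hab
  have hfst : ∀ i j : ι, i ≤ j → (ofLex i).1 ≤ (ofLex j).1 := by
    intro i j hij
    rcases Sigma.lex_iff.1 (show Sigma.Lex _ _ (ofLex i) (ofLex j) from hij) with h | ⟨h, -⟩
    · exact h.le
    · exact h.le
  have hIic : ∀ i : ι, (Set.Iic i).Finite := by
    intro i
    have h1 : {μ : S | μ ≤ (ofLex i).1}.Finite := by
      have := hfin ((ofLex i).1 : ℝ) (hS (ofLex i).1.2)
      refine Set.Finite.of_finite_image (f := Subtype.val) (this.subset ?_)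
        Subtype.val_injective.injOn
      rintro _ ⟨μ, hμ, rfl⟩
      exact ⟨μ.2, hμ⟩
    have h2 : (⋃ μ ∈ {μ : S | μ ≤ (ofLex i).1},
        Set.range fun k : Fin (d μ) => (toLex ⟨μ, k⟩ : ι)).Finite :=
      h1.biUnion fun μ _ => Set.finite_range _
    refine h2.subset fun j hj => ?_
    simp only [Set.mem_iUnion]
    exact ⟨(ofLex j).1, hfst j i hj, (ofLex j).2, rfl⟩
  obtain ⟨e⟩ := exists_orderIso_nat ι hIic
  let lam : ℕ → ℝ := fun n => ((ofLex (e.symm n)).1 : ℝ)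
  have hmem : ∀ n, lam n ∈ S := fun n => (ofLex (e.symm n)).1.2
  have hmono : Monotone lam := fun a b hab => hfst _ _ (e.symm.monotone hab)
  have hcard : ∀ μ, {n | lam n = μ}.encard = d μ := by
    intro μ
    by_cases hμ : μ ∈ S
    · have : {n | lam n = μ} = Set.range fun k : Fin (d μ) => e (toLex ⟨⟨μ, hμ⟩, k⟩) := by
        ext n
        constructor
        · intro hn
          obtain ⟨j, rfl⟩ := e.surjective n
          have hj : (ofLex j).1 = ⟨μ, hμ⟩ := Subtype.ext (by simpa [lam] using hn)
          obtain ⟨a, b⟩ := j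
          subst hj
          exact ⟨b, rfl⟩
        · rintro ⟨k, rfl⟩
          simp [lam]
      rw [this, ← Set.image_univ, Function.Injective.encard_image]
      · simp
      · intro a b hab
        simpa using hab
    · have h0 : d μ = 0 := by
        by_contra h
        exact hμ ((hd μ).2 h)
      rw [h0, Nat.cast_zero, Set.encard_eq_zero]
      ext n
      simp only [Set.mem_ofPred_eq, Set.mem_empty_iff_false, iff_false]
      rintro rfl
      exact hμ (hmem n)
  refine ⟨lam, hmono, hmem, hcard, ?_⟩
  rw [Metric.tendsto_atTop]
  intro ε hε
  have hx : (1 : ℝ) - ε < 1 := by linarith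
  have hf : {n | lam n ≤ 1 - ε}.Finite := by
    have : {n | lam n ≤ 1 - ε} ⊆ ⋃ μ ∈ S ∩ Set.Iic (1 - ε), {n | lam n = μ} := by
      intro n hn
      simp only [Set.mem_iUnion]
      exact ⟨lam n, ⟨hmem n, hn⟩, rfl⟩
    refine Set.Finite.subset ((hfin _ hx).biUnion fun μ _ => ?_) this
    apply Set.finite_of_encard_eq_coe (hcard μ)
  obtain ⟨N, hN⟩ := hf.bddAbove
  refine ⟨N + 1, fun n hn => ?_⟩
  have h1 : ¬ lam n ≤ 1 - ε := fun h => by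
    have := hN h
    omega
  have h2 : lam n < 1 := hS (hmem n)
  rw [Real.dist_eq, abs_lt]
  constructor <;> linarith

variable {H : Type*} [NormedAddCommGroup H] [InnerProductSpace ℂ H] [CompleteSpace H]

/-- The sum of the eigenspaces of `C` to the eigenvalues in `s`. -/
def spectralSum (C : H →L[ℂ] H) (s : Set ℝ) : Submodule ℂ H :=
  ⨆ τ ∈ s, Module.End.eigenspace C.toLinearMap (τ : ℂ)

theorem eigenspace_le_spectralSum {C : H →L[ℂ] H} {s : Set ℝ} {τ : ℝ} (h : τ ∈ s) :
    Module.End.eigenspace C.toLinearMap (τ : ℂ) ≤ spectralSum C s :=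
  le_iSup₂_of_le τ h le_rfl

theorem spectralSum_union (C : H →L[ℂ] H) (s t : Set ℝ) :
    spectralSum C (s ∪ t) = spectralSum C s ⊔ spectralSum C t := by
  unfold spectralSum
  rw [iSup_union]

theorem spectralSum_mono {C : H →L[ℂ] H} {s t : Set ℝ}
    (h : ∀ τ ∈ s, Module.End.eigenspace C.toLinearMap (τ : ℂ) ≠ ⊥ → τ ∈ t) :
    spectralSum C s ≤ spectralSum C t := by
  refine iSup₂_le fun τ hτ => ?_
  by_cases h0 : Module.End.eigenspace C.toLinearMap (τ : ℂ) = ⊥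
  · rw [h0]; exact bot_le
  · exact eigenspace_le_spectralSum (h τ hτ h0)

theorem spectralSum_congr {C : H →L[ℂ] H} {s t : Set ℝ}
    (h : ∀ τ : ℝ, Module.End.eigenspace C.toLinearMap (τ : ℂ) ≠ ⊥ → (τ ∈ s ↔ τ ∈ t)) :
    spectralSum C s = spectralSum C t :=
  le_antisymm (spectralSum_mono fun τ h1 h2 => (h τ h2).1 h1)
    (spectralSum_mono fun τ h1 h2 => (h τ h2).2 h1)

theorem spectralSum_isOrtho {C : H →L[ℂ] H} (hs : (C : H →ₗ[ℂ] H).IsSymmetric) {s t : Set ℝ}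
    (hst : Disjoint s t) : spectralSum C s ⟂ spectralSum C t := by
  unfold spectralSum
  simp only [Submodule.isOrtho_iSup_left, Submodule.isOrtho_iSup_right]
  intro τ hτ σ hσ
  have hne : (τ : ℂ) ≠ (σ : ℂ) := by
    intro h
    exact Set.disjoint_left.1 hst hσ (by rwa [← Complex.ofReal_inj.1 h])
  exact hs.orthogonalFamily_eigenspaces.isOrtho hne.symm

/-- Unit eigenvectors to distinct eigenvalues are orthogonal, so their images under `C` have mutual
distance at least `ε`. Infinitely many of them would contradict compactness. -/
theorem finite_eigenvalues {C : H →L[ℂ] H} (hc : IsCompactOperator C)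
    (hs : (C : H →ₗ[ℂ] H).IsSymmetric) {ε : ℝ} (hε : 0 < ε) :
    {τ : ℝ | ε ≤ |τ| ∧ Module.End.eigenspace C.toLinearMap (τ : ℂ) ≠ ⊥}.Finite := by
  by_contra hinf
  set S := {τ : ℝ | ε ≤ |τ| ∧ Module.End.eigenspace C.toLinearMap (τ : ℂ) ≠ ⊥}
  have hinf : S.Infinite := hinf
  let f := hinf.natEmbedding
  have hv : ∀ n, ∃ v : H, C v = ((f n : ℝ) : ℂ) • v ∧ ‖v‖ = 1 := by
    intro n
    obtain ⟨v, hv, hv0⟩ := Submodule.exists_mem_ne_zero_of_ne_bot (f n).2.2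
    refine ⟨((‖v‖⁻¹ : ℝ) : ℂ) • v, ?_, ?_⟩
    · have := Module.End.mem_eigenspace_iff.1 hv
      simp only [ContinuousLinearMap.coe_coe] at this
      rw [map_smul, this, smul_comm]
    · rw [norm_smul, Complex.norm_real, norm_inv, norm_norm,
        inv_mul_cancel₀ (norm_ne_zero_iff.2 hv0)]
  choose v hv hv1 using hv
  have hcpt : IsCompact (closure (C '' Metric.closedBall 0 1)) :=
    hc.isCompact_closure_image_closedBall (f := (C : H →ₗ[ℂ] H)) 1
  obtain ⟨a, -, φ, hφ, hlim⟩ := hcpt.tendsto_subseq (x := fun n => C (v n))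
    (fun n => subset_closure ⟨v n, by simp [hv1], rfl⟩)
  have hcau := hlim.cauchySeq
  obtain ⟨N, hN⟩ := Metric.cauchySeq_iff.1 hcau ε hε
  have h1 := hN (N + 1) (by simp) N le_rfl
  have hne : φ (N + 1) ≠ φ N := (hφ (Nat.lt_succ_self N)).ne'
  have horth : inner ℂ (v (φ (N + 1))) (v (φ N)) = 0 := by
    have hne' : (((f (φ (N + 1)) : ℝ)) : ℂ) ≠ (((f (φ N)) : ℝ) : ℂ) := by
      intro h
      exact hne (f.injective (Subtype.ext (Complex.ofReal_inj.1 h)))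
    exact (hs.orthogonalFamily_eigenspaces.isOrtho hne').inner_eq
      (Module.End.mem_eigenspace_iff.2 (hv _)) (Module.End.mem_eigenspace_iff.2 (hv _))
  rw [dist_eq_norm] at h1
  simp only [Function.comp] at h1
  have h2 : ‖C (v (φ (N + 1))) - C (v (φ N))‖ ^ 2
      = ‖C (v (φ (N + 1)))‖ ^ 2 + ‖C (v (φ N))‖ ^ 2 := by
    rw [hv, hv, @norm_sub_sq ℂ, inner_smul_left, inner_smul_right, horth]
    simp
  have h3 : ε ≤ ‖C (v (φ (N + 1)))‖ := by
    rw [hv, norm_smul, hv1, mul_one, Complex.norm_real]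
    exact (f (φ (N + 1))).2.1
  nlinarith [norm_nonneg (C (v (φ (N + 1))) - C (v (φ N))), sq_nonneg ‖C (v (φ N))‖]

theorem finiteDimensional_spectralSum {C : H →L[ℂ] H} (hc : IsCompactOperator C)
    (hs : (C : H →ₗ[ℂ] H).IsSymmetric) {ε : ℝ} (hε : 0 < ε) {s : Set ℝ}
    (h : s ⊆ Set.Ici ε) : FiniteDimensional ℂ (spectralSum C s) := by
  have hfin := finite_eigenvalues hc hs hε
  set S := {τ : ℝ | ε ≤ |τ| ∧ Module.End.eigenspace C.toLinearMap (τ : ℂ) ≠ ⊥}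
  have h1 : spectralSum C s ≤ ⨆ τ : S, Module.End.eigenspace C.toLinearMap ((τ : ℝ) : ℂ) := by
    refine (spectralSum_mono (t := S) fun τ hτ h0 => ⟨(h hτ).trans (le_abs_self τ), h0⟩).trans ?_
    unfold spectralSum
    rw [iSup_subtype']
  have : Finite S := hfin
  have : ∀ τ : S, FiniteDimensional ℂ (Module.End.eigenspace C.toLinearMap ((τ : ℝ) : ℂ)) := by
    intro τ
    refine C.finite_dimensional_eigenspace hc _ ?_
    have := τ.2.1
    intro h0
    rw [Complex.ofReal_eq_zero.1 h0, abs_zero] at this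
    linarith
  exact Submodule.finiteDimensional_of_le h1

theorem finrank_spectralSum_union {C : H →L[ℂ] H} (hc : IsCompactOperator C)
    (hs : (C : H →ₗ[ℂ] H).IsSymmetric) {ε : ℝ} (hε : 0 < ε) {s t : Set ℝ}
    (h : s ⊆ Set.Ici ε) (h' : t ⊆ Set.Ici ε) (hst : Disjoint s t) :
    Module.finrank ℂ (spectralSum C (s ∪ t)) =
      Module.finrank ℂ (spectralSum C s) + Module.finrank ℂ (spectralSum C t) := by
  have := finiteDimensional_spectralSum hc hs hε h
  have := finiteDimensional_spectralSum hc hs hε h'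
  have := Submodule.finrank_sup_add_finrank_inf_eq (spectralSum C s) (spectralSum C t)
  rw [(spectralSum_isOrtho hs hst).disjoint.eq_bot, finrank_bot, add_zero] at this
  rw [spectralSum_union, this]

theorem le_re_inner_of_mem_spectralSum {C : H →L[ℂ] H}
    (hs : (C : H →ₗ[ℂ] H).IsSymmetric) {t : ℝ} {x : H} (hx : x ∈ spectralSum C (Set.Ici t)) :
    t * ‖x‖ ^ 2 ≤ (inner ℂ x (C x)).re := by
  classical
  unfold spectralSum at hx
  rw [iSup_subtype', Submodule.mem_iSup_iff_exists_dfinsupp'] at hx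
  obtain ⟨f, rfl⟩ := hx
  have horth : ∀ i j : Set.Ici t, i ≠ j → ∀ a ∈ Module.End.eigenspace C.toLinearMap ((i : ℝ) : ℂ),
      ∀ b ∈ Module.End.eigenspace C.toLinearMap ((j : ℝ) : ℂ), inner ℂ a b = 0 := by
    intro i j hij a ha b hb
    refine (hs.orthogonalFamily_eigenspaces.isOrtho ?_).inner_eq ha hb
    intro h
    exact hij (Subtype.ext (Complex.ofReal_inj.1 h))
  have hC : ∀ i, C (f i : H) = ((i : ℝ) : ℂ) • (f i : H) := fun i =>
    Module.End.mem_eigenspace_iff.1 (f i).2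
  have e1 : inner ℂ (f.sum fun i xi => (xi : H)) (C (f.sum fun i xi => (xi : H)))
      = ∑ i ∈ f.support, ((i : ℝ) : ℂ) * ((‖(f i : H)‖ ^ 2 : ℝ) : ℂ) := by
    rw [DFinsupp.sum, map_sum, sum_inner]
    refine Finset.sum_congr rfl fun i hi => ?_
    rw [inner_sum, Finset.sum_eq_single i]
    · rw [hC, inner_smul_right, inner_self_eq_norm_sq_to_K]; push_cast; rfl
    · intro j _ hji
      rw [hC, inner_smul_right, horth i j hji.symm _ (f i).2 _ (f j).2, mul_zero]
    · intro h; exact absurd hi h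
  have e2 : ((‖f.sum fun i xi => (xi : H)‖ ^ 2 : ℝ) : ℂ)
      = ∑ i ∈ f.support, ((‖(f i : H)‖ ^ 2 : ℝ) : ℂ) := by
    have : ((‖f.sum fun i xi => (xi : H)‖ ^ 2 : ℝ) : ℂ)
      = inner ℂ (f.sum fun i xi => (xi : H)) (f.sum fun i xi => (xi : H)) := by
      rw [inner_self_eq_norm_sq_to_K]; norm_cast
    rw [this, DFinsupp.sum, sum_inner]
    refine Finset.sum_congr rfl fun i hi => ?_
    rw [inner_sum, Finset.sum_eq_single i]
    · rw [inner_self_eq_norm_sq_to_K]; norm_cast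
    · intro j _ hji
      exact horth i j hji.symm _ (f i).2 _ (f j).2
    · intro h; exact absurd hi h
  rw [e1]
  have e3 : ‖f.sum fun i xi => (xi : H)‖ ^ 2 = ∑ i ∈ f.support, ‖(f i : H)‖ ^ 2 := by
    exact_mod_cast e2
  rw [e3, Complex.re_sum, Finset.mul_sum]
  refine Finset.sum_le_sum fun i _ => ?_
  rw [← Complex.ofReal_mul, Complex.ofReal_re]
  exact mul_le_mul_of_nonneg_right i.2 (by positivity)

/-- The nonzero spectrum of a compact operator consists of eigenvalues, so the real spectrum lies
below `t`; the functional calculus turns this into the operator inequality `S ≤ t`. -/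
theorem re_inner_le_of_no_large_eigenvalue {S : H →L[ℂ] H} (hSc : IsCompactOperator S)
    (hSs : (S : H →ₗ[ℂ] H).IsSymmetric) {t : ℝ} (ht : 0 < t)
    (hno : ∀ r : ℝ, t < r → ¬ Module.End.HasEigenvalue S.toLinearMap (r : ℂ)) (x : H) :
    (inner ℂ x (S x)).re ≤ t * ‖x‖ ^ 2 := by
  have hSa : IsSelfAdjoint S := hSs.isSelfAdjoint
  have hle : S ≤ algebraMap ℝ (H →L[ℂ] H) t := by
    refine le_algebraMap_of_spectrum_le (fun r hr => ?_) hSa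
    by_contra! hlt
    have hr' : (r : ℂ) ∈ spectrum ℂ S := spectrum.algebraMap_mem (R := ℝ) ℂ (a := S) hr
    have hr0 : (r : ℂ) ≠ 0 := by
      intro h
      rw [Complex.ofReal_eq_zero.1 h] at hlt
      linarith
    exact hno r hlt ((hSc.hasEigenvalue_iff_mem_spectrum hr0).2 hr')
  have hpos := (ContinuousLinearMap.le_def _ _).1 hle
  have := hpos.re_inner_nonneg_right x
  rw [sub_apply, inner_sub_right, map_sub, Algebra.algebraMap_eq_smul_one] at this
  have e1 : (t • (1 : H →L[ℂ] H)) x = (t : ℂ) • x := rfl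
  rw [e1, inner_smul_right, inner_self_eq_norm_sq_to_K] at this
  have e4 : RCLike.re ((t : ℂ) * ((‖x‖ : ℝ) : ℂ) ^ 2) = t * ‖x‖ ^ 2 := by
    rw [← Complex.ofReal_pow, ← Complex.ofReal_mul]; exact Complex.ofReal_re _
  erw [e4] at this
  have e6 : RCLike.re (inner ℂ x (S x)) = (inner ℂ x (S x)).re := rfl
  rw [e6] at this
  linarith

/-- `C` leaves the orthogonal complement of the spectral sum invariant, and its restriction has no
eigenvalue above `t`: an eigenvector for one would also lie in the spectral sum. -/
theorem re_inner_le_of_orthogonal_spectralSum {C : H →L[ℂ] H} (hc : IsCompactOperator C)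
    (hs : (C : H →ₗ[ℂ] H).IsSymmetric) {t : ℝ} (ht : 0 < t) {x : H}
    (hx : x ∈ (spectralSum C (Set.Ici t))ᗮ) : (inner ℂ x (C x)).re ≤ t * ‖x‖ ^ 2 := by
  set F := spectralSum C (Set.Ici t) with hF
  have : FiniteDimensional ℂ F := finiteDimensional_spectralSum hc hs ht subset_rfl
  have hinvF : ∀ y ∈ F, C y ∈ F := by
    intro y hy
    have : F ≤ F.comap (C : H →ₗ[ℂ] H) := by
      refine iSup₂_le fun τ hτ z hz => ?_
      have hz' := Module.End.mem_eigenspace_iff.1 hz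
      simp only [Submodule.mem_comap]
      rw [show (C : H →ₗ[ℂ] H) z = (τ : ℂ) • z from hz']
      exact F.smul_mem _ (eigenspace_le_spectralSum hτ hz)
    exact this hy
  have hinv : ∀ y ∈ Fᗮ, C y ∈ Fᗮ := by
    intro y hy z hz
    have := hs z y
    simp only [ContinuousLinearMap.coe_coe] at this
    rw [← this]
    exact hy _ (hinvF z hz)
  let S : Fᗮ →L[ℂ] Fᗮ := C.restrict hinv
  have hSc : IsCompactOperator S := hc.restrict' hinv
  have hSs : (S : Fᗮ →ₗ[ℂ] Fᗮ).IsSymmetric := hs.restrict_invariant hinv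
  have h5 := re_inner_le_of_no_large_eigenvalue hSc hSs ht (fun r hlt hev => by
    obtain ⟨v, hv, hv0⟩ := hev.exists_hasEigenvector
    have hv' : S v = (r : ℂ) • v := Module.End.mem_eigenspace_iff.1 hv
    have hv'' : C (v : H) = (r : ℂ) • (v : H) := congrArg Subtype.val hv'
    have hvF : (v : H) ∈ F :=
      eigenspace_le_spectralSum (s := Set.Ici t) hlt.le (Module.End.mem_eigenspace_iff.2 hv'')
    have := v.2 _ hvF
    rw [inner_self_eq_zero] at this
    exact hv0 (Subtype.ext this)) ⟨x, hx⟩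
  exact h5

/-- Weyl's comparison of the numbers of large eigenvalues of two compact operators. -/
theorem finrank_spectralSum_le {C C' : H →L[ℂ] H} (hc : IsCompactOperator C)
    (hs : (C : H →ₗ[ℂ] H).IsSymmetric) (hc' : IsCompactOperator C')
    (hs' : (C' : H →ₗ[ℂ] H).IsSymmetric) {δ τ τ' : ℝ} (hδ : ‖C - C'‖ ≤ δ) (hτ' : 0 < τ')
    (hlt : τ' < τ - δ) :
    Module.finrank ℂ (spectralSum C (Set.Ici τ)) ≤
      Module.finrank ℂ (spectralSum C' (Set.Ici τ')) := by
  have hδ0 : 0 ≤ δ := (norm_nonneg _).trans hδ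
  set F := spectralSum C (Set.Ici τ)
  set F' := spectralSum C' (Set.Ici τ')
  have : FiniteDimensional ℂ F := finiteDimensional_spectralSum hc hs
    (by linarith : 0 < τ) subset_rfl
  have : FiniteDimensional ℂ F' := finiteDimensional_spectralSum hc' hs' hτ' subset_rfl
  -- The projection of `F` to `F'` is injective: for `x` in its kernel `τ‖x‖² ≤ ⟨x, C x⟩ ≤ ⟨x, C' x⟩
  -- + δ‖x‖² ≤ (τ' + δ)‖x‖²`, while `τ' + δ < τ`.
  let g : F →ₗ[ℂ] F' := F'.orthogonalProjectionOnto.toLinearMap ∘ₗ F.subtype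
  refine LinearMap.finrank_le_finrank_of_injective (f := g) ?_
  rw [injective_iff_map_eq_zero]
  intro x hx
  have hx' : (x : H) ∈ F'ᗮ := by
    have : F'.orthogonalProjectionOnto (x : H) = 0 := hx
    rwa [Submodule.orthogonalProjectionOnto_eq_zero_iff] at this
  have h1 := le_re_inner_of_mem_spectralSum hs x.2
  have h2 := re_inner_le_of_orthogonal_spectralSum hc' hs' hτ' hx'
  have h3 : (inner ℂ (x : H) (C x)).re - (inner ℂ (x : H) (C' x)).re ≤ δ * ‖(x : H)‖ ^ 2 := by
    rw [← Complex.sub_re, ← inner_sub_right, ← sub_apply]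
    calc (inner ℂ (x : H) ((C - C') x)).re ≤ ‖inner ℂ (x : H) ((C - C') x)‖ :=
          Complex.re_le_norm _
      _ ≤ ‖(x : H)‖ * ‖(C - C') x‖ := norm_inner_le_norm _ _
      _ ≤ ‖(x : H)‖ * (δ * ‖(x : H)‖) := by
          gcongr
          exact ((C - C').le_opNorm _).trans (by gcongr)
      _ = _ := by ring
  have h4 : (τ - δ - τ') * ‖(x : H)‖ ^ 2 ≤ 0 := by nlinarith
  have h5 : ‖(x : H)‖ ^ 2 ≤ 0 := by
    by_contra! h
    nlinarith
  have h6 : ‖(x : H)‖ = 0 := by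
    have := sq_nonneg ‖(x : H)‖
    exact pow_eq_zero_iff (two_ne_zero) |>.1 (le_antisymm h5 this)
  exact Subtype.ext (norm_eq_zero.1 h6)

/-- With finitely many eigenvalues in `(0, 1)`, all positive eigenvalues would exceed a fixed
positive number and their spectral sum `F` would be finite dimensional. On `Fᗮ` the form of `C`
would be at most `t‖x‖²` for every `t > 0`, so the nonnegative operator `C` would vanish there. -/
theorem infinite_eigenvalues {C : H →L[ℂ] H} (hc : IsCompactOperator C)
    (hs : (C : H →ₗ[ℂ] H).IsSymmetric) (hpos : ∀ x, 0 ≤ (inner ℂ x (C x)).re)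
    (hinf : ∀ F : Submodule ℂ H, FiniteDimensional ℂ F → ∃ x ∈ Fᗮ, C x ≠ 0) :
    {τ : ℝ | τ ∈ Set.Ioo 0 1 ∧ Module.End.eigenspace C.toLinearMap (τ : ℂ) ≠ ⊥}.Infinite := by
  intro hfin
  have hfin1 := finite_eigenvalues hc hs (zero_lt_one)
  set A := {τ : ℝ | τ ∈ Set.Ioo 0 1 ∧ Module.End.eigenspace C.toLinearMap (τ : ℂ) ≠ ⊥} with hA
  set A1 := {τ : ℝ | 1 ≤ |τ| ∧ Module.End.eigenspace C.toLinearMap (τ : ℂ) ≠ ⊥} with hA1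
  obtain ⟨ε, hε, hεA⟩ : ∃ ε : ℝ, 0 < ε ∧ ∀ τ ∈ A, ε ≤ τ := by
    rcases A.eq_empty_or_nonempty with h | h
    · exact ⟨1, one_pos, by simp [h]⟩
    · obtain ⟨m, hm, hmin⟩ := Set.exists_min_image A id hfin h
      exact ⟨m, hm.1.1, hmin⟩
  have hε' : 0 < min ε 1 := lt_min hε one_pos
  set F := spectralSum C (Set.Ici (min ε 1)) with hF
  have : FiniteDimensional ℂ F := finiteDimensional_spectralSum hc hs hε' subset_rfl
  obtain ⟨x, hx, hx0⟩ := hinf F inferInstance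
  have hbound : ∀ t : ℝ, 0 < t → (inner ℂ x (C x)).re ≤ t * ‖x‖ ^ 2 := by
    intro t ht
    have hsub : spectralSum C (Set.Ici t) ≤ F := by
      refine spectralSum_mono fun τ hτ h0 => ?_
      have hτ : t ≤ τ := hτ
      rcases lt_or_ge τ 1 with h1 | h1
      · exact (min_le_left _ _).trans (hεA τ ⟨⟨by linarith, h1⟩, h0⟩)
      · exact (min_le_right _ _).trans h1
    exact re_inner_le_of_orthogonal_spectralSum hc hs ht (Submodule.orthogonal_le hsub hx)
  have hzero : (inner ℂ x (C x)).re ≤ 0 := by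
    by_contra! h
    have hn : 0 < ‖x‖ ^ 2 := by
      have : x ≠ 0 := by rintro rfl; simp at hx0
      positivity
    have := hbound ((inner ℂ x (C x)).re / (2 * ‖x‖ ^ 2)) (by positivity)
    have e : (inner ℂ x (C x)).re / (2 * ‖x‖ ^ 2) * ‖x‖ ^ 2 = (inner ℂ x (C x)).re / 2 := by
      have := hn.ne'
      generalize ‖x‖ ^ 2 = z at this
      field_simp
    linarith
  have hCp : C.IsPositive := by
    refine ⟨hs, fun y => ?_⟩
    have e : RCLike.re (inner ℂ (C y) y) = (inner ℂ y (C y)).re := by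
      rw [← inner_conj_symm]; exact Complex.conj_re _
    have := hpos y
    rw [← e] at this
    exact this
  apply hx0
  -- With `C = q* q` the vanishing of `⟨x, C x⟩ = ‖q x‖²` implies `C x = 0`.
  obtain ⟨q, hq⟩ := CStarAlgebra.nonneg_iff_eq_star_mul_self.1
    ((ContinuousLinearMap.nonneg_iff_isPositive C).2 hCp)
  have h1 : inner ℂ x (C x) = inner ℂ (q x) (q x) := by
    rw [hq, mul_apply_eq_comp, ContinuousLinearMap.star_eq_adjoint,
      ContinuousLinearMap.adjoint_inner_right]
  rw [h1] at hzero
  have h2 : ‖q x‖ ^ 2 ≤ 0 := by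
    rw [inner_self_eq_norm_sq_to_K] at hzero
    exact_mod_cast hzero
  have h3 : q x = 0 := by
    rw [← norm_eq_zero]
    exact pow_eq_zero_iff two_ne_zero |>.1 (le_antisymm h2 (sq_nonneg _))
  rw [hq, mul_apply_eq_comp, h3, map_zero]

end Abstract

/-! ### The eigenvalue sequence of `T` when `1 - T` is compact and symmetric -/

section Enumeration

theorem eigenspaceAt_eq (T : L2 →L[ℂ] L2) (μ : ℝ) :
    eigenspaceAt T μ = Module.End.eigenspace (1 - T).toLinearMap ((1 - μ : ℝ) : ℂ) := by
  ext v
  unfold eigenspaceAt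
  rw [Module.End.mem_eigenspace_iff, Module.End.mem_eigenspace_iff]
  simp only [ContinuousLinearMap.coe_coe, sub_apply, ContinuousLinearMap.one_apply,
    Complex.ofReal_sub, Complex.ofReal_one, sub_smul, one_smul, sub_right_inj]

variable {T : L2 →L[ℂ] L2}

theorem toENat_rank_eigenspaceAt (hc : IsCompactOperator (1 - T : L2 →L[ℂ] L2)) {μ : ℝ} (hμ : μ ≠ 1) :
    Cardinal.toENat (Module.rank ℂ (eigenspaceAt T μ))
      = (Module.finrank ℂ (eigenspaceAt T μ) : ℕ∞) := by
  have : FiniteDimensional ℂ (eigenspaceAt T μ) := by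
    rw [eigenspaceAt_eq]
    refine (1 - T).finite_dimensional_eigenspace hc _ ?_
    exact_mod_cast sub_ne_zero.2 hμ.symm
  rw [← Module.finrank_eq_rank, Cardinal.toENat_nat]

theorem finite_eigenvalues_le (hc : IsCompactOperator (1 - T : L2 →L[ℂ] L2))
    (hs : ((1 - T : L2 →L[ℂ] L2) : L2 →ₗ[ℂ] L2).IsSymmetric) {x : ℝ} (hx : x < 1) :
    {μ : ℝ | μ ≤ x ∧ eigenspaceAt T μ ≠ ⊥}.Finite := by
  have h := finite_eigenvalues hc hs (sub_pos.2 hx)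
  refine Set.Finite.of_finite_image (f := fun μ => 1 - μ) (h.subset ?_) ?_
  · rintro _ ⟨μ, ⟨h1, h2⟩, rfl⟩
    rw [eigenspaceAt_eq] at h2
    exact ⟨(by linarith : 1 - x ≤ 1 - μ).trans (le_abs_self _), h2⟩
  · intro a _ b _ hab
    simpa using hab

theorem infinite_eigenvalueSet
    (hinf : {τ : ℝ | τ ∈ Set.Ioo 0 1 ∧
      Module.End.eigenspace (1 - T).toLinearMap (τ : ℂ) ≠ ⊥}.Infinite) :
    {μ : ℝ | μ ∈ Set.Ioo 0 1 ∧ eigenspaceAt T μ ≠ ⊥}.Infinite := by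
  have : (fun τ : ℝ => 1 - τ) '' {τ : ℝ | τ ∈ Set.Ioo 0 1 ∧
      Module.End.eigenspace (1 - T).toLinearMap (τ : ℂ) ≠ ⊥} ⊆
      {μ : ℝ | μ ∈ Set.Ioo 0 1 ∧ eigenspaceAt T μ ≠ ⊥} := by
    rintro _ ⟨τ, ⟨h1, h2⟩, rfl⟩
    refine ⟨⟨by linarith [h1.2], by linarith [h1.1]⟩, ?_⟩
    rw [eigenspaceAt_eq]
    simpa using h2
  refine (hinf.image ?_).mono this
  intro a _ b _ hab
  simpa using hab

theorem exists_eigenvalueEnumeration (hc : IsCompactOperator (1 - T : L2 →L[ℂ] L2))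
    (hs : ((1 - T : L2 →L[ℂ] L2) : L2 →ₗ[ℂ] L2).IsSymmetric)
    (hinf : {μ : ℝ | μ ∈ Set.Ioo 0 1 ∧ eigenspaceAt T μ ≠ ⊥}.Infinite) :
    ∃ lam : ℕ → ℝ, IsEigenvalueEnumeration T lam ∧ Tendsto lam atTop (𝓝 1) := by
  classical
  set S := {μ : ℝ | μ ∈ Set.Ioo 0 1 ∧ eigenspaceAt T μ ≠ ⊥} with hS
  obtain ⟨lam, hm, hmem, hcard, hlim⟩ := exists_monotone_enumeration hinf
    (fun μ hμ => hμ.1.2)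
    (fun x hx => (finite_eigenvalues_le hc hs hx).subset fun μ hμ => ⟨hμ.2, hμ.1.2⟩)
    (fun μ => if μ ∈ Set.Ioo (0 : ℝ) 1 then Module.finrank ℂ (eigenspaceAt T μ) else 0)
    (fun μ => by
      by_cases h : μ ∈ Set.Ioo (0 : ℝ) 1
      · have hfd : FiniteDimensional ℂ (eigenspaceAt T μ) := by
          rw [eigenspaceAt_eq]
          refine (1 - T).finite_dimensional_eigenspace hc _ ?_
          exact_mod_cast sub_ne_zero.2 h.2.ne'
        simp only [h, if_true, hS, Set.mem_ofPred_eq, true_and]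
        rw [Ne, Ne, Submodule.finrank_eq_zero]
      · simp only [h, if_false, hS, Set.mem_ofPred_eq, false_and, ne_eq, not_true_eq_false])
  refine ⟨lam, ⟨hm, fun n => (hmem n).1, fun μ hμ => ?_⟩, hlim⟩
  rw [hcard, if_pos hμ, toENat_rank_eigenspaceAt hc hμ.2.ne]

/-- Every eigenvalue below one is automatically isolated and of finite multiplicity, because away
from zero the spectrum of the compact operator `1 - T` is discrete. -/
theorem discreteSpectrum_inter_Ico (hc : IsCompactOperator (1 - T : L2 →L[ℂ] L2))
    (hs : ((1 - T : L2 →L[ℂ] L2) : L2 →ₗ[ℂ] L2).IsSymmetric) :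
    discreteSpectrum T ∩ Set.Ico 0 1 = {μ | μ ∈ Set.Ico 0 1 ∧ eigenspaceAt T μ ≠ ⊥} := by
  ext μ
  constructor
  · rintro ⟨h1, h2⟩
    exact ⟨h2, h1.1⟩
  · rintro ⟨h2, h1⟩
    refine ⟨⟨h1, ?_, ?_⟩, h2⟩
    · rw [eigenspaceAt_eq]
      refine (1 - T).finite_dimensional_eigenspace hc _ ?_
      exact_mod_cast sub_ne_zero.2 h2.2.ne'
    -- At distance less than `r` from `μ` one has `|1 - z| > r`. So `1 - z` is a real eigenvalue of
    -- `1 - T` bounded away from zero, and only finitely many such `z` exist.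
    · set r := (1 - μ) / 2 with hr
      have hr0 : 0 < r := by have := h2.2; simp only [hr]; linarith
      have hfin := finite_eigenvalues hc hs hr0
      set F := {τ : ℝ | r ≤ |τ| ∧ Module.End.eigenspace (1 - T).toLinearMap (τ : ℂ) ≠ ⊥}
      have hsub : spectrum ℂ T ∩ Metric.ball (μ : ℂ) r ⊆ (fun τ : ℝ => (1 - τ : ℂ)) '' F := by
        rintro z ⟨hz, hzb⟩
        have hz1 : (1 - z) ∈ spectrum ℂ (1 - T) := by
          have := spectrum.sub_singleton_eq (R := ℂ) T (1 : ℂ)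
          have h3 := spectrum.singleton_sub_eq (R := ℂ) T (1 : ℂ)
          rw [map_one] at h3
          rw [← h3]
          exact Set.sub_mem_sub rfl hz
        have hn : r < ‖1 - z‖ := by
          have h4 : ‖z - μ‖ < r := by simpa [dist_eq_norm] using hzb
          have h5 : ‖(1 : ℂ) - μ‖ = 1 - μ := by
            rw [← Complex.ofReal_one, ← Complex.ofReal_sub, Complex.norm_real, Real.norm_eq_abs,
              abs_of_pos]
            linarith [h2.2]
          have h6 : ‖(1 : ℂ) - μ‖ ≤ ‖1 - z‖ + ‖z - μ‖ := by
            have := norm_add_le (1 - z) (z - μ)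
            simpa using this
          linarith
        have hne : 1 - z ≠ 0 := by
          intro h; rw [h, norm_zero] at hn; linarith
        have hev := (hc.hasEigenvalue_iff_mem_spectrum hne).2 hz1
        have hreal := hs.conj_eigenvalue_eq_self hev
        have hre : ((1 - z).re : ℂ) = 1 - z := Complex.conj_eq_iff_re.1 hreal
        refine ⟨(1 - z).re, ⟨?_, ?_⟩, ?_⟩
        · rw [← Real.norm_eq_abs, ← Complex.norm_real, hre]; exact hn.le
        · rw [hre]
          exact hev
        · simp only [hre]; ring
      intro hacc
      rw [accPt_iff_nhds] at hacc
      have hfin2 : (spectrum ℂ T ∩ Metric.ball (μ : ℂ) r).Finite := (hfin.image _).subset hsub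
      have hclosed : IsClosed ((spectrum ℂ T ∩ Metric.ball (μ : ℂ) r) \ {(μ : ℂ)}) :=
        (hfin2.subset Set.diff_subset).isClosed
      obtain ⟨y, ⟨⟨hy1, hy2⟩, hy3⟩, hy4⟩ := hacc
        (Metric.ball (μ : ℂ) r ∩ ((spectrum ℂ T ∩ Metric.ball (μ : ℂ) r) \ {(μ : ℂ)})ᶜ)
        (inter_mem (Metric.ball_mem_nhds _ hr0) (hclosed.isOpen_compl.mem_nhds (by simp)))
      exact hy2 ⟨⟨hy3, hy1⟩, hy4⟩

theorem accPt_discreteSpectrum_iff (hc : IsCompactOperator (1 - T : L2 →L[ℂ] L2))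
    (hs : ((1 - T : L2 →L[ℂ] L2) : L2 →ₗ[ℂ] L2).IsSymmetric)
    (hinf : (discreteSpectrum T ∩ Set.Ico 0 1).Infinite) (t : ℝ) :
    AccPt t (𝓟 (discreteSpectrum T ∩ Set.Ico 0 1)) ↔ t = 1 := by
  rw [discreteSpectrum_inter_Ico hc hs] at hinf ⊢
  set S := {μ : ℝ | μ ∈ Set.Ico 0 1 ∧ eigenspaceAt T μ ≠ ⊥} with hS
  constructor
  · intro hacc
    by_contra hne
    rw [accPt_iff_nhds] at hacc
    rcases lt_or_gt_of_ne hne with h | h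
    · set x := (t + 1) / 2 with hx
      have hx1 : x < 1 := by simp only [hx]; linarith
      have htx : t < x := by simp only [hx]; linarith
      have hfin : (S ∩ Set.Iio x).Finite :=
        (finite_eigenvalues_le hc hs hx1).subset fun μ hμ => ⟨le_of_lt hμ.2, hμ.1.2⟩
      have hclosed : IsClosed ((S ∩ Set.Iio x) \ {t}) := (hfin.subset Set.diff_subset).isClosed
      obtain ⟨y, ⟨⟨hy1, hy2⟩, hy3⟩, hy4⟩ := hacc (Set.Iio x ∩ ((S ∩ Set.Iio x) \ {t})ᶜ)
        (inter_mem (Iio_mem_nhds htx) (hclosed.isOpen_compl.mem_nhds (by simp)))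
      exact hy2 ⟨⟨hy3, hy1⟩, hy4⟩
    · obtain ⟨y, ⟨hy1, hy2⟩, -⟩ := hacc (Set.Ioi 1) (Ioi_mem_nhds h)
      have h1 : 1 < y := hy1
      linarith [hy2.1.2]
  · rintro rfl
    rw [accPt_iff_nhds]
    intro U hU
    obtain ⟨ε, hε, hεU⟩ := Metric.mem_nhds_iff.1 hU
    have hfin : (S ∩ Set.Iic (1 - ε)).Finite :=
      (finite_eigenvalues_le hc hs (by linarith)).subset fun μ hμ => ⟨hμ.2, hμ.1.2⟩
    obtain ⟨y, hy, hy2⟩ := (hinf.diff hfin).nonempty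
    refine ⟨y, ⟨hεU ?_, hy⟩, hy.1.2.ne⟩
    have h3 : 1 - ε < y := by
      by_contra! h
      exact hy2 ⟨hy, h⟩
    rw [Metric.mem_ball, Real.dist_eq, abs_lt]
    constructor <;> linarith [hy.1.2]

/-- This expresses the counting function of the enumeration as a dimension, the quantity that Weyl's
comparison controls. The interval is open at one since eigenvalue `1` of `1 - T` is eigenvalue `0`
of `T`, which is not enumerated. -/
theorem IsEigenvalueEnumeration.ncard_le_eq (hc : IsCompactOperator (1 - T : L2 →L[ℂ] L2))
    (hs : ((1 - T : L2 →L[ℂ] L2) : L2 →ₗ[ℂ] L2).IsSymmetric) {lam : ℕ → ℝ}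
    (h : IsEigenvalueEnumeration T lam) {x : ℝ} (hx : x < 1) :
    {n | lam n ≤ x}.Finite ∧
    {n | lam n ≤ x}.ncard = Module.finrank ℂ (spectralSum (1 - T) (Set.Ico (1 - x) 1)) := by
  classical
  have hmult : ∀ μ ∈ Set.Ioo (0 : ℝ) 1, {n | lam n = μ}.Finite ∧
      {n | lam n = μ}.ncard = Module.finrank ℂ (eigenspaceAt T μ) := by
    intro μ hμ
    have h1 := h.multiplicity μ hμ
    rw [toENat_rank_eigenspaceAt hc hμ.2.ne] at h1
    have hf : {n | lam n = μ}.Finite := Set.finite_of_encard_eq_coe h1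
    refine ⟨hf, ?_⟩
    rw [← hf.cast_ncard_eq] at h1
    exact_mod_cast h1
  -- Only finitely many eigenvalues are involved; the count is proved for finite sets of them by
  -- adding one at a time, the eigenspaces being orthogonal.
  have key : ∀ A : Finset ℝ, (∀ τ ∈ A, τ ∈ Set.Ico (1 - x) 1 ∧ τ ∈ Set.Ioo (0 : ℝ) 1) →
      {n | 1 - lam n ∈ A}.Finite ∧
      {n | 1 - lam n ∈ A}.ncard = Module.finrank ℂ (spectralSum (1 - T) (A : Set ℝ)) := by
    intro A
    induction A using Finset.induction_on with
    | empty =>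
      intro _
      have : spectralSum (1 - T) ((∅ : Finset ℝ) : Set ℝ) = ⊥ := by simp [spectralSum]
      rw [this]
      simp
    | insert a A ha ih =>
      intro hA
      obtain ⟨ih1, ih2⟩ := ih fun τ hτ => hA τ (Finset.mem_insert_of_mem hτ)
      have ha1 := (hA a (Finset.mem_insert_self a A)).2
      obtain ⟨hm1, hm2⟩ := hmult (1 - a) ⟨by linarith [ha1.2], by linarith [ha1.1]⟩
      have hset : {n | 1 - lam n ∈ insert a A} = {n | lam n = 1 - a} ∪ {n | 1 - lam n ∈ A} := by
        ext n
        simp only [Finset.mem_insert, Set.mem_ofPred_eq, Set.mem_union]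
        refine or_congr ⟨fun h => by linarith, fun h => by linarith⟩ Iff.rfl
      have hdisj : Disjoint {n | lam n = 1 - a} {n | 1 - lam n ∈ A} := by
        rw [Set.disjoint_left]
        intro n hn hn'
        have hn : lam n = 1 - a := hn
        have hn' : 1 - lam n ∈ A := hn'
        rw [hn] at hn'
        exact ha (by simpa using hn')
      refine ⟨by rw [hset]; exact hm1.union ih1, ?_⟩
      rw [hset, Set.ncard_union_eq hdisj hm1 ih1, hm2, ih2, Finset.coe_insert, Set.insert_eq,
        finrank_spectralSum_union hc hs (sub_pos.2 hx) (s := {a})]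
      · congr 1
        rw [eigenspaceAt_eq]
        have : spectralSum (1 - T) {a} = Module.End.eigenspace (1 - T).toLinearMap (a : ℂ) := by
          simp [spectralSum]
        rw [this, sub_sub_cancel]
      · rintro _ rfl
        exact (hA _ (Finset.mem_insert_self _ A)).1.1
      · intro τ hτ
        exact (hA τ (Finset.mem_insert_of_mem hτ)).1.1
      · rw [Set.disjoint_singleton_left]
        exact fun h => ha (by simpa using h)
  have hfin := finite_eigenvalues hc hs (sub_pos.2 hx)
  let A : Finset ℝ := hfin.toFinset.filter fun τ => τ ∈ Set.Ico (1 - x) 1 ∧ τ ∈ Set.Ioo (0 : ℝ) 1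
  have hA : ∀ τ, τ ∈ A ↔ (Module.End.eigenspace (1 - T).toLinearMap (τ : ℂ) ≠ ⊥ ∧
      τ ∈ Set.Ico (1 - x) 1) := by
    intro τ
    simp only [A, Finset.mem_filter, Set.Finite.mem_toFinset, Set.mem_ofPred_eq]
    constructor
    · rintro ⟨⟨-, h1⟩, h2, -⟩
      exact ⟨h1, h2⟩
    · rintro ⟨h1, h2⟩
      exact ⟨⟨h2.1.trans (le_abs_self _), h1⟩, h2, by linarith [h2.1], h2.2⟩
  obtain ⟨k1, k2⟩ := key A fun τ hτ => by
    obtain ⟨h1, h2⟩ := (hA τ).1 hτ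
    exact ⟨h2, by linarith [h2.1], h2.2⟩
  have hset : {n | lam n ≤ x} = {n | 1 - lam n ∈ A} := by
    ext n
    simp only [Set.mem_ofPred_eq, hA]
    constructor
    · intro hn
      refine ⟨?_, by linarith, by linarith [(h.mem n).1]⟩
      rw [← eigenspaceAt_eq]
      intro h0
      have h1 := h.multiplicity _ (h.mem n)
      rw [h0] at h1
      simp only [rank_bot, map_zero, Set.encard_eq_zero] at h1
      exact (Set.eq_empty_iff_forall_notMem.1 h1 n) rfl
    · rintro ⟨-, h2, -⟩
      linarith
  rw [hset]
  refine ⟨k1, ?_⟩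
  rw [k2]
  rw [spectralSum_congr (t := Set.Ico (1 - x) 1) fun τ h0 => ?_]
  rw [Finset.mem_coe, hA]
  exact ⟨fun h => h.2, fun h => ⟨h0, h⟩⟩

/-- Weyl's comparison counts all eigenvalues of `1 - T` above a level, including those `≥ 1`, which
correspond to eigenvalues `≤ 0` of `T`. Since `hN` makes these contributions equal, they cancel and
the comparison descends to the enumerated eigenvalues. -/
theorem IsEigenvalueEnumeration.le_add {T' : L2 →L[ℂ] L2} (hc : IsCompactOperator (1 - T : L2 →L[ℂ] L2))
    (hs : ((1 - T : L2 →L[ℂ] L2) : L2 →ₗ[ℂ] L2).IsSymmetric) (hc' : IsCompactOperator (1 - T' : L2 →L[ℂ] L2))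
    (hs' : ((1 - T' : L2 →L[ℂ] L2) : L2 →ₗ[ℂ] L2).IsSymmetric) {lam lam' : ℕ → ℝ}
    (h : IsEigenvalueEnumeration T lam) (h' : IsEigenvalueEnumeration T' lam') {δ : ℝ}
    (hδ : ‖T - T'‖ ≤ δ)
    (hN : Module.finrank ℂ (spectralSum (1 - T) (Set.Ici 1)) =
      Module.finrank ℂ (spectralSum (1 - T') (Set.Ici 1))) (n : ℕ) :
    lam n ≤ lam' n + δ := by
  -- The extra `ε` supplies the strict inequality between the levels in Weyl's comparison.
  refine le_of_forall_pos_le_add fun ε hε => ?_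
  have hδ0 : 0 ≤ δ := (norm_nonneg _).trans hδ
  by_contra! hlt
  set x := lam' n
  set y := x + δ + ε
  have hy1 : y < 1 := hlt.trans (h.mem n).2
  have hx1 : x < 1 := (h'.mem n).2
  obtain ⟨f1, c1⟩ := h.ncard_le_eq hc hs hy1
  obtain ⟨f2, c2⟩ := h'.ncard_le_eq hc' hs' hx1
  have split : ∀ {T : L2 →L[ℂ] L2}, IsCompactOperator (1 - T : L2 →L[ℂ] L2) →
      ((1 - T : L2 →L[ℂ] L2) : L2 →ₗ[ℂ] L2).IsSymmetric → ∀ z : ℝ, 0 < z → z < 1 →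
      Module.finrank ℂ (spectralSum (1 - T) (Set.Ici (1 - z))) =
      Module.finrank ℂ (spectralSum (1 - T) (Set.Ico (1 - z) 1)) +
      Module.finrank ℂ (spectralSum (1 - T) (Set.Ici 1)) := by
    intro T hc hs z hz0 hz
    rw [← finrank_spectralSum_union hc hs (sub_pos.2 hz) (s := Set.Ico (1 - z) 1)
      (t := Set.Ici 1) (fun τ hτ => hτ.1)
      (fun τ hτ => (by linarith : 1 - z ≤ 1).trans hτ), Set.Ico_union_Ici_eq_Ici (by linarith)]
    exact Set.disjoint_left.2 fun τ h1 h2 => absurd h1.2 (not_lt.2 h2)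
  have hx0 : 0 < x := (h'.mem n).1
  have hle := finrank_spectralSum_le hc' hs' hc hs (δ := δ) (τ := 1 - x) (τ' := 1 - y)
    (by
      have e : (1 - T' - (1 - T) : L2 →L[ℂ] L2) = T - T' := by abel
      rw [e]; exact hδ)
    (by linarith) (by simp only [y]; linarith)
  rw [split hc hs y (by positivity) hy1, split hc' hs' x hx0 hx1, hN] at hle
  have hle' : {n | lam' n ≤ x}.ncard ≤ {n | lam n ≤ y}.ncard := by
    rw [c1, c2]; omega
  -- Indices start at zero: `lam' 0, …, lam' n` are `n + 1` values at most `x`, whereas at most the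
  -- `n` values `lam 0, …, lam (n - 1)` are at most `y`.
  have h3 : n + 1 ≤ {k | lam' k ≤ x}.ncard := by
    have : ((Finset.range (n + 1) : Finset ℕ) : Set ℕ) ⊆ {k | lam' k ≤ x} := by
      intro k hk
      exact h'.monotone (by simpa [Nat.lt_succ_iff] using hk)
    have := Set.ncard_le_ncard this f2
    rwa [Set.ncard_coe_finset, Finset.card_range] at this
  have h4 : {k | lam k ≤ y}.ncard ≤ n := by
    have : {k | lam k ≤ y} ⊆ ((Finset.range n : Finset ℕ) : Set ℕ) := by
      intro k hk
      have hk : lam k ≤ y := hk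
      simp only [Finset.coe_range, Set.mem_Iio]
      by_contra! hnk
      have := h.monotone hnk
      linarith
    have := Set.ncard_le_ncard this (Finset.finite_toSet _)
    rwa [Set.ncard_coe_finset, Finset.card_range] at this
  omega

theorem IsEigenvalueEnumeration.abs_sub_le {T' : L2 →L[ℂ] L2} (hc : IsCompactOperator (1 - T : L2 →L[ℂ] L2))
    (hs : ((1 - T : L2 →L[ℂ] L2) : L2 →ₗ[ℂ] L2).IsSymmetric) (hc' : IsCompactOperator (1 - T' : L2 →L[ℂ] L2))
    (hs' : ((1 - T' : L2 →L[ℂ] L2) : L2 →ₗ[ℂ] L2).IsSymmetric) {lam lam' : ℕ → ℝ}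
    (h : IsEigenvalueEnumeration T lam) (h' : IsEigenvalueEnumeration T' lam') {δ : ℝ}
    (hδ : ‖T - T'‖ ≤ δ)
    (hN : Module.finrank ℂ (spectralSum (1 - T) (Set.Ici 1)) =
      Module.finrank ℂ (spectralSum (1 - T') (Set.Ici 1))) (n : ℕ) :
    |lam n - lam' n| ≤ δ := by
  have h1 := h.le_add hc hs hc' hs' h' hδ hN n
  have h2 := h'.le_add (δ := δ) hc' hs' hc hs h (by rw [norm_sub_rev]; exact hδ) hN.symm n
  rw [abs_le]
  constructor <;> linarith

end Enumeration

/-! ### Multiplication operators and Fourier multipliers on `L²` -/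

/-- The Fourier transform on `L²(ℝ³)`. -/
abbrev F2 : L2 ≃ₗᵢ[ℂ] L2 := Lp.fourierTransformₗᵢ E3 ℂ

/-- Multiplication by a bounded function. -/
def mulOp (m : E3 → ℂ) : L2 →L[ℂ] L2 :=
  open Classical in
  if h : MemLp m ∞ (volume : Measure E3) then
    (ContinuousLinearMap.mul ℂ ℂ).holderL volume ∞ 2 2 (h.toLp m)
  else 0

theorem coeFn_mulOp {m : E3 → ℂ} (h : MemLp m ∞ (volume : Measure E3)) (f : L2) :
    mulOp m f =ᵐ[volume] fun x => m x * f x := by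
  unfold mulOp
  rw [dif_pos h]
  have h1 := ContinuousLinearMap.coeFn_holder (r := 2) (ContinuousLinearMap.mul ℂ ℂ) (h.toLp m) f
  filter_upwards [h1, h.coeFn_toLp] with x hx hx'
  simp only [hx', ContinuousLinearMap.mul_apply'] at hx
  exact hx

theorem norm_toLp_le_of_bound {f g : L2} {C : ℝ} (hC : 0 ≤ C)
    (h : ∀ᵐ x, ‖f x‖ ≤ C * ‖g x‖) : ‖f‖ ≤ C * ‖g‖ := by
  exact Lp.norm_le_mul_norm_of_ae_le_mul h

theorem norm_mulOp_le {m : E3 → ℂ} (h : MemLp m ∞ (volume : Measure E3)) {C : ℝ} (hC : 0 ≤ C)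
    (hm : ∀ᵐ x, ‖m x‖ ≤ C) : ‖mulOp m‖ ≤ C := by
  refine ContinuousLinearMap.opNorm_le_bound _ hC fun f => ?_
  refine norm_toLp_le_of_bound hC ?_
  filter_upwards [coeFn_mulOp h f, hm] with x h1 h2
  rw [h1, norm_mul]
  gcongr

theorem inner_eq_integral (f g : L2) : inner ℂ f g = ∫ x, g x * conj (f x) := by
  rw [L2.inner_def]
  rfl

theorem integrable_inner (f g : L2) : Integrable (fun x => g x * conj (f x)) := by
  have := L2.integrable_inner (𝕜 := ℂ) f g
  exact this

theorem norm_sq_eq_integral (f : L2) : ‖f‖ ^ 2 = ∫ x, ‖f x‖ ^ 2 := by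
  have h := inner_self_eq_norm_sq_to_K (𝕜 := ℂ) f
  rw [inner_eq_integral] at h
  have e : ∀ x, f x * conj (f x) = ((‖f x‖ ^ 2 : ℝ) : ℂ) := fun x => by
    rw [Complex.mul_conj, Complex.normSq_eq_norm_sq]
  simp_rw [e] at h
  rw [integral_complex_ofReal] at h
  refine Complex.ofReal_injective ?_
  rw [Complex.ofReal_pow]
  exact h.symm

theorem integrable_norm_sq (f : L2) : Integrable (fun x => ‖f x‖ ^ 2) :=
  (memLp_two_iff_integrable_sq_norm (Lp.aestronglyMeasurable f)).1 (Lp.memLp f)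

theorem memLp_conj {m : E3 → ℂ} {p : ℝ≥0∞} (h : MemLp m p (volume : Measure E3)) :
    MemLp (fun x => conj (m x)) p (volume : Measure E3) := by
  refine h.of_le (Complex.continuous_conj.comp_aestronglyMeasurable h.1) ?_
  filter_upwards with x
  rw [RCLike.norm_conj]

theorem inner_mulOp_left {m : E3 → ℂ} (h : MemLp m ∞ (volume : Measure E3)) (f g : L2) :
    inner ℂ (mulOp m f) g = inner ℂ f (mulOp (fun x => conj (m x)) g) := by
  rw [inner_eq_integral, inner_eq_integral]
  refine integral_congr_ae ?_
  filter_upwards [coeFn_mulOp h f, coeFn_mulOp (memLp_conj h) g] with x h1 h2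
  rw [h1, h2, map_mul]
  ring

/-- The Fourier multiplier with a bounded symbol. -/
def fmul (m : E3 → ℂ) : L2 →L[ℂ] L2 :=
  (F2.symm.toContinuousLinearEquiv : L2 →L[ℂ] L2) ∘L mulOp m ∘L
    (F2.toContinuousLinearEquiv : L2 →L[ℂ] L2)

theorem F2_fmul (m : E3 → ℂ) (f : L2) : F2 (fmul m f) = mulOp m (F2 f) := by
  simp [fmul]

theorem inner_F2 (f g : L2) : inner ℂ (F2 f) (F2 g) = inner ℂ f g := F2.inner_map_map f g

theorem inner_fmul_left {m : E3 → ℂ} (h : MemLp m ∞ (volume : Measure E3)) (f g : L2) :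
    inner ℂ (fmul m f) g = inner ℂ f (fmul (fun x => conj (m x)) g) := by
  rw [← inner_F2, F2_fmul, inner_mulOp_left h, ← F2_fmul, inner_F2]

theorem norm_fmul_le {m : E3 → ℂ} (h : MemLp m ∞ (volume : Measure E3)) {C : ℝ} (hC : 0 ≤ C)
    (hm : ∀ᵐ x, ‖m x‖ ≤ C) : ‖fmul m‖ ≤ C := by
  refine ContinuousLinearMap.opNorm_le_bound _ hC fun f => ?_
  rw [← F2.norm_map, F2_fmul, ← F2.norm_map f]
  exact ((mulOp m).le_opNorm _).trans (by gcongr; exact norm_mulOp_le h hC hm)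

/-! ### Distributional identities as almost everywhere identities -/

theorem toTemperedDistribution_injective {f g : L2} (h : (f : 𝓢'(E3, ℂ)) = (g : 𝓢'(E3, ℂ))) :
    f = g := by
  have h1 := Lp.ker_toTemperedDistributionCLM_eq_bot (F := ℂ) (μ := (volume : Measure E3)) (p := 2)
  rw [LinearMap.ker_eq_bot] at h1
  exact h1 h

theorem integrable_schwartz_mul (φ : 𝓢(E3, ℂ)) (f : L2) :
    Integrable (fun x => φ x • f x) := by
  have := (Lp.memLp f).mul (φ.memLp 2 (volume : Measure E3)) (r := 1)
  rw [memLp_one_iff_integrable] at this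
  exact this

theorem locallyIntegrable_temperate_mul {m : E3 → ℂ} (hm : Continuous m) (f : L2) :
    LocallyIntegrable (fun x => m x * f x) volume := by
  have := (Lp.memLp f).locallyIntegrable (by norm_num)
  exact this.continuous_mul hm

theorem ae_eq_of_forall_schwartz {f g : E3 → ℂ} (hf : LocallyIntegrable f volume)
    (hg : LocallyIntegrable g volume)
    (hfi : ∀ φ : 𝓢(E3, ℂ), Integrable (fun x => φ x * f x))
    (hgi : ∀ φ : 𝓢(E3, ℂ), Integrable (fun x => φ x * g x))
    (h : ∀ φ : 𝓢(E3, ℂ), ∫ x, φ x * f x = ∫ x, φ x * g x) : f =ᵐ[volume] g := by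
  have := ae_eq_zero_of_integral_contDiff_smul_eq_zero (hf.sub hg) (fun φ hφ hc => by
    have hg₁ : HasCompactSupport (Complex.ofRealCLM ∘ φ) := hc.comp_left rfl
    have hg₂ : ContDiff ℝ ((⊤ : ℕ∞) : WithTop ℕ∞) (Complex.ofRealCLM ∘ φ) := by fun_prop
    have h1 := h (hg₁.toSchwartzMap hg₂)
    have h2 := integral_sub (hfi (hg₁.toSchwartzMap hg₂)) (hgi (hg₁.toSchwartzMap hg₂))
    rw [h1, sub_self] at h2
    rw [← h2]
    refine integral_congr_ae ?_
    filter_upwards with x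
    simp [mul_sub])
  filter_upwards [this] with x hx
  exact sub_eq_zero.1 hx

/-- The dictionary between distributions and functions: Sobolev regularity, weak derivatives and the
Laplacian are all reduced by it to pointwise statements about Fourier transforms. -/
theorem smulLeftCLM_eq_iff {m : E3 → ℂ} (hm : m.HasTemperateGrowth) (f g : L2) :
    TemperedDistribution.smulLeftCLM ℂ m (f : 𝓢'(E3, ℂ)) = (g : 𝓢'(E3, ℂ)) ↔
      (fun x => m x * f x) =ᵐ[volume] g := by
  have key : ∀ φ : 𝓢(E3, ℂ), TemperedDistribution.smulLeftCLM ℂ m (f : 𝓢'(E3, ℂ)) φ =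
      ∫ x, φ x * (m x * f x) := by
    intro φ
    rw [TemperedDistribution.smulLeftCLM_apply_apply, Lp.toTemperedDistribution_apply]
    refine integral_congr_ae ?_
    filter_upwards with x
    rw [SchwartzMap.smulLeftCLM_apply_apply hm]
    simp only [smul_eq_mul]
    ring
  constructor
  · intro h
    refine ae_eq_of_forall_schwartz (locallyIntegrable_temperate_mul hm.1.continuous f)
      ((Lp.memLp g).locallyIntegrable (by norm_num)) (fun φ => ?_)
      (fun φ => integrable_schwartz_mul φ g) (fun φ => ?_)
    · have := integrable_schwartz_mul (SchwartzMap.smulLeftCLM ℂ m φ) f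
      refine this.congr ?_
      filter_upwards with x
      rw [SchwartzMap.smulLeftCLM_apply_apply hm]
      simp only [smul_eq_mul]
      ring
    · rw [← key, h, Lp.toTemperedDistribution_apply]
      rfl
  · intro h
    ext φ
    rw [key, Lp.toTemperedDistribution_apply]
    refine integral_congr_ae ?_
    filter_upwards [h] with x hx
    rw [hx]; rfl

/-- On `L¹ ∩ L²` the abstract unitary agrees with the Fourier integral, since both satisfy the same
duality `∫ φ f̂ = ∫ φ̂ f` against Schwartz functions. -/
theorem F2_ae_eq_fourier {f : L2} (hf : Integrable f) : F2 f =ᵐ[volume] 𝓕 (f : E3 → ℂ) := by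
  have hb : ∀ x, ‖𝓕 (f : E3 → ℂ) x‖ ≤ ∫ y, ‖f y‖ := fun x =>
    VectorFourier.norm_fourierIntegral_le_integral_norm _ _ _ _ x
  have hcont : Continuous (𝓕 (f : E3 → ℂ)) :=
    VectorFourier.fourierIntegral_continuous Real.continuous_fourierChar
      (by exact continuous_inner) hf
  have hint : ∀ φ : 𝓢(E3, ℂ), Integrable (fun x => φ x * 𝓕 (f : E3 → ℂ) x) := fun φ =>
    (φ.integrable).mul_bdd (c := ∫ y, ‖f y‖) hcont.aestronglyMeasurable
      (Eventually.of_forall hb)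
  refine ae_eq_of_forall_schwartz ((Lp.memLp (F2 f)).locallyIntegrable (by norm_num))
    hcont.locallyIntegrable (fun φ => integrable_schwartz_mul φ (F2 f)) hint (fun φ => ?_)
  have h1 : (F2 f : 𝓢'(E3, ℂ)) φ = (f : 𝓢'(E3, ℂ)) (𝓕 φ) := by
    have := Lp.fourier_toTemperedDistribution_eq f
    change ((𝓕 f : L2) : 𝓢'(E3, ℂ)) φ = _
    rw [← this, TemperedDistribution.fourier_apply]
  rw [Lp.toTemperedDistribution_apply, Lp.toTemperedDistribution_apply] at h1
  simp only [smul_eq_mul] at h1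
  rw [h1]
  have h2 := VectorFourier.integral_fourierIntegral_smul_eq_flip (L := innerₗ E3) (μ := volume)
    (ν := volume) Real.continuous_fourierChar (by exact continuous_inner) φ.integrable hf
  simp only [flip_innerₗ, smul_eq_mul] at h2
  exact h2

theorem F2_symm_ae_eq_fourierInv {f : L2} (hf : Integrable f) :
    F2.symm f =ᵐ[volume] 𝓕⁻ (f : E3 → ℂ) := by
  have hb : ∀ x, ‖𝓕⁻ (f : E3 → ℂ) x‖ ≤ ∫ y, ‖f y‖ := fun x =>
    VectorFourier.norm_fourierIntegral_le_integral_norm _ _ _ _ x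
  have hcont : Continuous (𝓕⁻ (f : E3 → ℂ)) :=
    VectorFourier.fourierIntegral_continuous Real.continuous_fourierChar
      (by exact (continuous_inner (𝕜 := ℝ) (E := E3)).neg) hf
  have hint : ∀ φ : 𝓢(E3, ℂ), Integrable (fun x => φ x * 𝓕⁻ (f : E3 → ℂ) x) := fun φ =>
    (φ.integrable).mul_bdd (c := ∫ y, ‖f y‖) hcont.aestronglyMeasurable
      (Eventually.of_forall hb)
  refine ae_eq_of_forall_schwartz ((Lp.memLp (F2.symm f)).locallyIntegrable (by norm_num))
    hcont.locallyIntegrable (fun φ => integrable_schwartz_mul φ (F2.symm f)) hint (fun φ => ?_)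
  have h1 : (F2.symm f : 𝓢'(E3, ℂ)) φ = (f : 𝓢'(E3, ℂ)) (𝓕⁻ φ) := by
    have := Lp.fourierInv_toTemperedDistribution_eq f
    change ((𝓕⁻ f : L2) : 𝓢'(E3, ℂ)) φ = _
    rw [← this, TemperedDistribution.fourierInv_apply]
  rw [Lp.toTemperedDistribution_apply, Lp.toTemperedDistribution_apply] at h1
  simp only [smul_eq_mul] at h1
  rw [h1]
  have h2 := VectorFourier.integral_fourierIntegral_smul_eq_flip (L := -innerₗ E3) (μ := volume)
    (ν := volume) Real.continuous_fourierChar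
    (by exact (continuous_inner (𝕜 := ℝ) (E := E3)).neg) φ.integrable hf
  have hfl : (-innerₗ E3).flip = -innerₗ E3 := by
    ext x y; simp [real_inner_comm]
  simp only [hfl, smul_eq_mul] at h2
  rw [SchwartzMap.fourierInv_coe]
  exact h2

theorem fourier_injective {f g : 𝓢'(E3, ℂ)} (h : 𝓕 f = 𝓕 g) : f = g := by
  have := congrArg (fun z : 𝓢'(E3, ℂ) => 𝓕⁻ z) h
  simpa using this

theorem fourier_coe_eq (u : L2) : 𝓕 (u : 𝓢'(E3, ℂ)) = (F2 u : 𝓢'(E3, ℂ)) :=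
  Lp.fourier_toTemperedDistribution_eq u

/-! ### Sobolev spaces, gradient norm and resolvent in terms of symbols -/

theorem memSobolev_iff_ae (s : ℝ) (u : L2) :
    TemperedDistribution.MemSobolev s 2 (u : 𝓢'(E3, ℂ)) ↔
      ∃ v : L2, (fun ξ => (((1 + ‖ξ‖ ^ 2) ^ (s / 2) : ℝ) : ℂ) * F2 u ξ) =ᵐ[volume] v := by
  rw [TemperedDistribution.memSobolev_iff_exists_smulLeftCLM_fourier, fourier_coe_eq]
  refine exists_congr fun v => ?_
  rw [← smulLeftCLM_eq_iff]
  fun_prop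

/-- The symbol `|2πξ|²` of `-Δ`. -/
def lsym (ξ : E3) : ℝ := (2 * Real.pi) ^ 2 * ‖ξ‖ ^ 2

theorem lsym_nonneg (ξ : E3) : 0 ≤ lsym ξ := by unfold lsym; positivity

theorem continuous_lsym : Continuous lsym := by unfold lsym; fun_prop

theorem memLp_top_of_continuous {m : E3 → ℂ} (hm : Continuous m) {C : ℝ} (h : ∀ x, ‖m x‖ ≤ C) :
    MemLp m ∞ (volume : Measure E3) :=
  memLp_top_of_bound hm.aestronglyMeasurable C (Eventually.of_forall h)

/-- The symbol of `(-Δ + c)^{-1/2}`. -/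
def rsym (c : ℝ) (ξ : E3) : ℝ := (Real.sqrt (lsym ξ + c))⁻¹

theorem rsym_pos {c : ℝ} (hc : 0 < c) (ξ : E3) : 0 < rsym c ξ := by
  have := lsym_nonneg ξ
  unfold rsym
  positivity

theorem rsym_sq {c : ℝ} (hc : 0 < c) (ξ : E3) : rsym c ξ ^ 2 = (lsym ξ + c)⁻¹ := by
  have := lsym_nonneg ξ
  unfold rsym
  rw [inv_pow, Real.sq_sqrt (by positivity)]

theorem continuous_rsym {c : ℝ} (hc : 0 < c) : Continuous (rsym c) := by
  unfold rsym
  refine Continuous.inv₀ (by have := continuous_lsym; fun_prop) fun ξ => ?_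
  have := lsym_nonneg ξ
  positivity

theorem rsym_le {c : ℝ} (hc : 0 < c) (ξ : E3) : rsym c ξ ≤ (Real.sqrt c)⁻¹ := by
  have := lsym_nonneg ξ
  unfold rsym
  gcongr
  linarith

theorem memLp_rsym {c : ℝ} (hc : 0 < c) :
    MemLp (fun ξ => (rsym c ξ : ℂ)) ∞ (volume : Measure E3) := by
  refine memLp_top_of_continuous (by have := continuous_rsym hc; fun_prop)
    (C := (Real.sqrt c)⁻¹) fun ξ => ?_
  rw [Complex.norm_real, Real.norm_eq_abs, abs_of_pos (rsym_pos hc ξ)]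
  exact rsym_le hc ξ

/-- `(-Δ + c)^{-1/2}`. -/
def gHalf (c : ℝ) : L2 →L[ℂ] L2 := fmul fun ξ => (rsym c ξ : ℂ)

/-- `(-Δ + c)^{-1}`. -/
def gRes (c : ℝ) : L2 →L[ℂ] L2 := gHalf c ∘L gHalf c

theorem F2_gHalf {c : ℝ} (hc : 0 < c) (w : L2) :
    F2 (gHalf c w) =ᵐ[volume] fun ξ => (rsym c ξ : ℂ) * F2 w ξ := by
  unfold gHalf
  rw [F2_fmul]
  exact coeFn_mulOp (memLp_rsym hc) _

theorem F2_gRes {c : ℝ} (hc : 0 < c) (w : L2) :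
    F2 (gRes c w) =ᵐ[volume] fun ξ => ((lsym ξ + c : ℝ) : ℂ)⁻¹ * F2 w ξ := by
  unfold gRes
  filter_upwards [F2_gHalf hc (gHalf c w), F2_gHalf hc w] with ξ h1 h2
  rw [ContinuousLinearMap.comp_apply, h1, h2, ← mul_assoc, ← Complex.ofReal_mul, ← sq, rsym_sq hc,
    Complex.ofReal_inv]

theorem eq_of_F2_ae {f g : L2} (h : F2 f =ᵐ[volume] F2 g) : f = g :=
  F2.injective (Lp.ext h)

theorem inner_gHalf_left {c : ℝ} (hc : 0 < c) (f g : L2) :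
    inner ℂ (gHalf c f) g = inner ℂ f (gHalf c g) := by
  unfold gHalf
  rw [inner_fmul_left (memLp_rsym hc)]
  simp

theorem inner_gRes_left {c : ℝ} (hc : 0 < c) (f g : L2) :
    inner ℂ (gRes c f) g = inner ℂ f (gRes c g) := by
  unfold gRes
  simp only [ContinuousLinearMap.comp_apply]
  rw [inner_gHalf_left hc, inner_gHalf_left hc]

theorem gHalf_injective {c : ℝ} (hc : 0 < c) : Function.Injective (gHalf c) := by
  rw [injective_iff_map_eq_zero]
  intro f hf
  apply eq_of_F2_ae
  have h := F2_gHalf hc f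
  rw [hf, map_zero] at h
  rw [map_zero]
  filter_upwards [h, Lp.coeFn_zero ℂ 2 (volume : Measure E3)] with ξ h1 h2
  rw [h2] at h1 ⊢
  have := (rsym_pos hc ξ).ne'
  simpa [this] using h1.symm

theorem norm_gHalf_le {c : ℝ} (hc : 0 < c) : ‖gHalf c‖ ≤ (Real.sqrt c)⁻¹ := by
  refine norm_fmul_le (memLp_rsym hc) (by positivity) (Eventually.of_forall fun ξ => ?_)
  rw [Complex.norm_real, Real.norm_eq_abs, abs_of_pos (rsym_pos hc ξ)]
  exact rsym_le hc ξ

theorem exists_ae_eq_mul {m : E3 → ℝ} (hm : Continuous m) {C : ℝ} (hC : ∀ ξ, |m ξ| ≤ C)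
    (v : L2) : ∃ w : L2, w =ᵐ[volume] fun ξ => (m ξ : ℂ) * v ξ :=
  ⟨mulOp (fun ξ => (m ξ : ℂ)) v, coeFn_mulOp (memLp_top_of_continuous (C := C) (by fun_prop)
    fun ξ => by rw [Complex.norm_real]; exact hC ξ) v⟩

theorem lsym_add_div_le {c : ℝ} (hc : 0 < c) (ξ : E3) :
    (lsym ξ + c) / (1 + ‖ξ‖ ^ 2) ≤ (2 * Real.pi) ^ 2 + c := by
  rw [div_le_iff₀ (by positivity)]
  unfold lsym
  nlinarith [sq_nonneg ‖ξ‖, sq_nonneg (2 * Real.pi)]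

theorem div_lsym_add_le {c : ℝ} (hc : 0 < c) (ξ : E3) :
    (1 + ‖ξ‖ ^ 2) / (lsym ξ + c) ≤ 1 + c⁻¹ := by
  have h0 := lsym_nonneg ξ
  rw [div_le_iff₀ (by positivity)]
  have h1 : ‖ξ‖ ^ 2 ≤ lsym ξ := by
    unfold lsym
    have : 1 ≤ (2 * Real.pi) ^ 2 := by nlinarith [Real.pi_gt_three]
    nlinarith [sq_nonneg ‖ξ‖]
  have h2 : c⁻¹ * c = 1 := inv_mul_cancel₀ hc.ne'
  have h3 : 0 ≤ c⁻¹ * lsym ξ := by positivity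
  nlinarith

/-- The symbols `1 + |ξ|²` and `|2πξ|² + c` are comparable in both directions. The form domain is
thereby parametrized by all of `L²`, so quadratic forms on `H¹` become forms of bounded operators.
-/
theorem memH1_iff {c : ℝ} (hc : 0 < c) (u : L2) : MemH1 u ↔ ∃ w : L2, u = gHalf c w := by
  unfold MemH1
  rw [memSobolev_iff_ae]
  constructor
  · rintro ⟨v, hv⟩
    obtain ⟨w, hw⟩ := exists_ae_eq_mul (m := fun ξ => Real.sqrt ((lsym ξ + c) / (1 + ‖ξ‖ ^ 2)))
      (by
        refine Real.continuous_sqrt.comp (Continuous.div (by have := continuous_lsym; fun_prop)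
          (by fun_prop) fun ξ => by positivity))
      (C := Real.sqrt ((2 * Real.pi) ^ 2 + c))
      (fun ξ => by
        rw [abs_of_nonneg (Real.sqrt_nonneg _)]
        exact Real.sqrt_le_sqrt (lsym_add_div_le hc ξ)) v
    refine ⟨F2.symm w, eq_of_F2_ae ?_⟩
    filter_upwards [F2_gHalf hc (F2.symm w), hv, hw] with ξ h1 h2 h3
    rw [h1, LinearIsometryEquiv.apply_symm_apply, h3, ← h2, ← mul_assoc, ← mul_assoc,
      ← Complex.ofReal_mul, ← Complex.ofReal_mul]
    have h0 := lsym_nonneg ξ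
    have e : rsym c ξ * Real.sqrt ((lsym ξ + c) / (1 + ‖ξ‖ ^ 2)) * (1 + ‖ξ‖ ^ 2) ^ ((1 : ℝ) / 2)
        = 1 := by
      rw [← Real.sqrt_eq_rpow, Real.sqrt_div (by positivity)]
      unfold rsym
      have h1 : Real.sqrt (lsym ξ + c) ≠ 0 := by positivity
      have h2 : Real.sqrt (1 + ‖ξ‖ ^ 2) ≠ 0 := by positivity
      field_simp
    rw [e]; simp
  · rintro ⟨w, rfl⟩
    obtain ⟨v, hv⟩ := exists_ae_eq_mul (m := fun ξ => Real.sqrt ((1 + ‖ξ‖ ^ 2) / (lsym ξ + c)))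
      (by
        refine Real.continuous_sqrt.comp (Continuous.div (by fun_prop)
          (by have := continuous_lsym; fun_prop) fun ξ => by have := lsym_nonneg ξ; positivity))
      (C := Real.sqrt (1 + c⁻¹))
      (fun ξ => by
        rw [abs_of_nonneg (Real.sqrt_nonneg _)]
        exact Real.sqrt_le_sqrt (div_lsym_add_le hc ξ)) (F2 w)
    refine ⟨v, ?_⟩
    filter_upwards [F2_gHalf hc w, hv] with ξ h1 h2
    rw [h1, h2, ← mul_assoc, ← Complex.ofReal_mul]
    congr 2
    rw [← Real.sqrt_eq_rpow, Real.sqrt_div (by positivity)]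
    rfl

theorem memH2_iff {c : ℝ} (hc : 0 < c) (u : L2) : MemH2 u ↔ ∃ w : L2, u = gRes c w := by
  unfold MemH2
  rw [memSobolev_iff_ae]
  have hp : ∀ ξ : E3, (1 + ‖ξ‖ ^ 2) ^ ((2 : ℝ) / 2) = 1 + ‖ξ‖ ^ 2 := fun ξ => by
    rw [div_self two_ne_zero, Real.rpow_one]
  simp_rw [hp]
  constructor
  · rintro ⟨v, hv⟩
    obtain ⟨w, hw⟩ := exists_ae_eq_mul (m := fun ξ => (lsym ξ + c) / (1 + ‖ξ‖ ^ 2))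
      (Continuous.div (by have := continuous_lsym; fun_prop)
          (by fun_prop) fun ξ => by positivity)
      (C := (2 * Real.pi) ^ 2 + c)
      (fun ξ => by
        have := lsym_nonneg ξ
        rw [abs_of_nonneg (by positivity)]
        exact lsym_add_div_le hc ξ) v
    refine ⟨F2.symm w, eq_of_F2_ae ?_⟩
    filter_upwards [F2_gRes hc (F2.symm w), hv, hw] with ξ h1 h2 h3
    rw [h1, LinearIsometryEquiv.apply_symm_apply, h3, ← h2, ← mul_assoc, ← mul_assoc,
      ← Complex.ofReal_inv, ← Complex.ofReal_mul, ← Complex.ofReal_mul]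
    have h0 := lsym_nonneg ξ
    have e : (lsym ξ + c)⁻¹ * ((lsym ξ + c) / (1 + ‖ξ‖ ^ 2)) * (1 + ‖ξ‖ ^ 2) = 1 := by
      field_simp
    rw [e]; simp
  · rintro ⟨w, rfl⟩
    obtain ⟨v, hv⟩ := exists_ae_eq_mul (m := fun ξ => (1 + ‖ξ‖ ^ 2) / (lsym ξ + c))
      (Continuous.div (by fun_prop)
          (by have := continuous_lsym; fun_prop) fun ξ => by have := lsym_nonneg ξ; positivity)
      (C := 1 + c⁻¹)
      (fun ξ => by
        have := lsym_nonneg ξ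
        rw [abs_of_nonneg (by positivity)]
        exact div_lsym_add_le hc ξ) (F2 w)
    refine ⟨v, ?_⟩
    filter_upwards [F2_gRes hc w, hv] with ξ h1 h2
    rw [h1, h2, ← mul_assoc, ← Complex.ofReal_inv, ← Complex.ofReal_mul]
    rfl

theorem inner_single_one (ξ : E3) (i : Fin 3) :
    inner ℝ ξ (EuclideanSpace.single i (1 : ℝ)) = ξ i := by
  rw [EuclideanSpace.inner_single_right]
  simp

theorem isWeakPartial_iff (i : Fin 3) (u g : L2) : IsWeakPartial i u g ↔
    F2 g =ᵐ[volume] fun ξ => (2 * Real.pi * Complex.I) * ((ξ i : ℝ) : ℂ) * F2 u ξ := by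
  unfold IsWeakPartial
  have hg : (fun ξ : E3 => (2 * Real.pi * Complex.I) * ((ξ i : ℝ) : ℂ)).HasTemperateGrowth := by
    have h1 : (fun ξ : E3 => ((inner ℝ ξ (EuclideanSpace.single i (1 : ℝ)) : ℝ) : ℂ)).HasTemperateGrowth := by
      fun_prop
    have h2 : (fun ξ : E3 => (2 * Real.pi * Complex.I) *
        ((inner ℝ ξ (EuclideanSpace.single i (1 : ℝ)) : ℝ) : ℂ)).HasTemperateGrowth := by
      exact (Function.HasTemperateGrowth.const _).mul h1
    simpa only [inner_single_one] using h2
  have key : (2 * Real.pi * Complex.I) • TemperedDistribution.smulLeftCLM ℂ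
      (fun ξ : E3 => ((inner ℝ ξ (EuclideanSpace.single i (1 : ℝ)) : ℝ) : ℂ)) (F2 u : 𝓢'(E3, ℂ))
      = TemperedDistribution.smulLeftCLM ℂ
        (fun ξ : E3 => (2 * Real.pi * Complex.I) * ((ξ i : ℝ) : ℂ)) (F2 u : 𝓢'(E3, ℂ)) := by
    have h1 : (fun ξ : E3 => ((inner ℝ ξ (EuclideanSpace.single i (1 : ℝ)) : ℝ) : ℂ)).HasTemperateGrowth := by
      fun_prop
    have := TemperedDistribution.smulLeftCLM_smul (F := ℂ) h1 (2 * Real.pi * Complex.I)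
    have e : (2 * Real.pi * Complex.I) • (fun ξ : E3 => ((inner ℝ ξ (EuclideanSpace.single i (1 : ℝ)) : ℝ) : ℂ))
        = fun ξ : E3 => (2 * Real.pi * Complex.I) * ((ξ i : ℝ) : ℂ) := by
      ext ξ; simp [inner_single_one]
    rw [e] at this
    rw [this]; rfl
  constructor
  · intro h
    have h1 := congrArg (fun z : 𝓢'(E3, ℂ) => 𝓕 z) h
    simp only [TemperedDistribution.fourier_lineDerivOp_eq, fourier_coe_eq] at h1
    rw [key, smulLeftCLM_eq_iff hg] at h1
    exact h1.symm
  · intro h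
    apply fourier_injective
    rw [TemperedDistribution.fourier_lineDerivOp_eq, fourier_coe_eq, fourier_coe_eq, key,
      smulLeftCLM_eq_iff hg]
    exact h.symm

theorem neg_laplacian_eq_iff (u h : L2) : -Δ (u : 𝓢'(E3, ℂ)) = (h : 𝓢'(E3, ℂ)) ↔
    (fun ξ => (lsym ξ : ℂ) * F2 u ξ) =ᵐ[volume] F2 h := by
  have hg : (fun ξ : E3 => (lsym ξ : ℂ)).HasTemperateGrowth := by
    unfold lsym; fun_prop
  have h1 : (fun ξ : E3 => ((‖ξ‖ ^ 2 : ℝ) : ℂ)).HasTemperateGrowth := by fun_prop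
  rw [← smulLeftCLM_eq_iff hg]
  have key : 𝓕 (-Δ (u : 𝓢'(E3, ℂ))) = TemperedDistribution.smulLeftCLM ℂ
      (fun ξ : E3 => (lsym ξ : ℂ)) (F2 u : 𝓢'(E3, ℂ)) := by
    have e1 : -Δ (u : 𝓢'(E3, ℂ)) = ((2 * Real.pi : ℂ) ^ 2) •
        TemperedDistribution.fourierMultiplierCLM ℂ (fun x ↦ Complex.ofReal (‖x‖ ^ 2))
          (u : 𝓢'(E3, ℂ)) := by
      rw [TemperedDistribution.laplacian_eq_fourierMultiplierCLM, neg_smul, neg_neg]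
      rw [← Complex.coe_smul]
      congr 1
      push_cast; ring
    rw [e1, TemperedDistribution.fourierMultiplierCLM_apply]
    rw [FourierTransform.fourier_smul, FourierTransform.fourier_fourierInv_eq, fourier_coe_eq]
    have := TemperedDistribution.smulLeftCLM_smul (F := ℂ) h1 ((2 * Real.pi : ℂ) ^ 2)
    have e : ((2 * Real.pi : ℂ) ^ 2) • (fun ξ : E3 => ((‖ξ‖ ^ 2 : ℝ) : ℂ))
        = fun ξ : E3 => (lsym ξ : ℂ) := by
      ext ξ; simp [lsym]
    rw [e] at this
    rw [this]; rfl
  rw [← key, ← fourier_coe_eq]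
  exact ⟨fun h => by rw [h], fun h => fourier_injective h⟩

theorem eq_gRes_iff {c : ℝ} (hc : 0 < c) (u h : L2) :
    u = gRes c h ↔ (fun ξ => ((lsym ξ + c : ℝ) : ℂ) * F2 u ξ) =ᵐ[volume] F2 h := by
  have hne : ∀ ξ, ((lsym ξ + c : ℝ) : ℂ) ≠ 0 := fun ξ => by
    have := lsym_nonneg ξ
    exact_mod_cast (by positivity : lsym ξ + c ≠ 0)
  constructor
  · rintro rfl
    filter_upwards [F2_gRes hc h] with ξ h1
    rw [h1, mul_inv_cancel_left₀ (hne ξ)]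
  · intro hh
    apply eq_of_F2_ae
    filter_upwards [F2_gRes hc h, hh] with ξ h1 h2
    rw [h1, ← h2, inv_mul_cancel_left₀ (hne ξ)]

/-- Adding `c u` to both sides and inverting `-Δ + c` turns the differential equation together with
its regularity requirement into one equation between bounded operators. -/
theorem memH2_and_laplacian_iff {c : ℝ} (hc : 0 < c) (u w f : L2) :
    (MemH2 u ∧ -Δ (u : 𝓢'(E3, ℂ)) + (w : 𝓢'(E3, ℂ)) = (f : 𝓢'(E3, ℂ))) ↔
      u = gRes c (f - w + (c : ℂ) • u) := by
  have e1 : -Δ (u : 𝓢'(E3, ℂ)) + (w : 𝓢'(E3, ℂ)) = (f : 𝓢'(E3, ℂ)) ↔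
      -Δ (u : 𝓢'(E3, ℂ)) = ((f - w : L2) : 𝓢'(E3, ℂ)) := by
    have : ((f - w : L2) : 𝓢'(E3, ℂ)) = (f : 𝓢'(E3, ℂ)) - (w : 𝓢'(E3, ℂ)) :=
      map_sub (Lp.toTemperedDistributionCLM ℂ (volume : Measure E3) 2) f w
    rw [this, eq_sub_iff_add_eq]
  have e2 : (fun ξ => (lsym ξ : ℂ) * F2 u ξ) =ᵐ[volume] F2 (f - w) ↔
      (fun ξ => ((lsym ξ + c : ℝ) : ℂ) * F2 u ξ) =ᵐ[volume] F2 (f - w + (c : ℂ) • u) := by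
    rw [map_add, map_smul]
    have h1 := Lp.coeFn_add (F2 (f - w)) ((c : ℂ) • F2 u)
    have h2 := Lp.coeFn_smul (c : ℂ) (F2 u)
    constructor
    · intro h
      filter_upwards [h, h1, h2] with ξ h3 h4 h5
      rw [h4, Pi.add_apply, ← h3, h5]
      push_cast
      simp [add_mul]
    · intro h
      filter_upwards [h, h1, h2] with ξ h3 h4 h5
      rw [h4, Pi.add_apply, h5] at h3
      push_cast at h3
      simp only [add_mul, Pi.smul_apply, smul_eq_mul, add_left_inj] at h3
      exact h3
  rw [e1, neg_laplacian_eq_iff, e2, ← eq_gRes_iff hc]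
  exact ⟨fun h => h.2, fun h => ⟨(memH2_iff hc u).2 ⟨_, h⟩, h⟩⟩

/-- Weak derivatives are unique, so each infimum runs over a single function. -/
theorem gradNormSq_eq {u : L2} (g : Fin 3 → L2) (hg : ∀ i, IsWeakPartial i u (g i)) :
    gradNormSq u = ENNReal.ofReal (∑ i, ‖g i‖ ^ 2) := by
  unfold gradNormSq
  rw [ENNReal.ofReal_sum_of_nonneg fun i _ => by positivity]
  refine Finset.sum_congr rfl fun i _ => ?_
  rw [ENNReal.ofReal_pow (norm_nonneg _), ofReal_norm]
  refine le_antisymm (iInf₂_le (g i) (hg i)) (le_iInf₂ fun g' hg' => ?_)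
  have : g' = g i := toTemperedDistribution_injective (hg'.symm.trans (hg i))
  rw [this]

theorem norm_sq_eq_sum (ξ : E3) : ‖ξ‖ ^ 2 = ∑ i : Fin 3, ξ i ^ 2 := by
  rw [EuclideanSpace.norm_eq, Real.sq_sqrt (by positivity)]
  simp

theorem gradNormSq_eq_of_memLp {u : L2}
    (h : MemLp (fun ξ => (Real.sqrt (lsym ξ) : ℂ) * F2 u ξ) 2 (volume : Measure E3)) :
    gradNormSq u = ENNReal.ofReal (∫ ξ, lsym ξ * ‖F2 u ξ‖ ^ 2) := by
  have hmem : ∀ i : Fin 3, MemLp (fun ξ : E3 => (2 * Real.pi * Complex.I) * ((ξ i : ℝ) : ℂ) * F2 u ξ)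
      2 (volume : Measure E3) := by
    intro i
    refine h.of_le ?_ (Eventually.of_forall fun ξ => ?_)
    · refine AEStronglyMeasurable.mul ?_ (Lp.aestronglyMeasurable _)
      exact Continuous.aestronglyMeasurable (by fun_prop)
    · simp only [norm_mul, Complex.norm_real, Complex.norm_I, mul_one]
      gcongr
      rw [Real.norm_eq_abs, Real.norm_eq_abs, Real.norm_eq_abs, abs_of_pos Real.pi_pos,
        abs_of_nonneg (Real.sqrt_nonneg _)]
      have : lsym ξ = (2 * Real.pi * ‖ξ‖) ^ 2 := by unfold lsym; ring
      rw [this, Real.sqrt_sq (by positivity)]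
      simp only [Complex.norm_ofNat]
      gcongr
      exact PiLp.norm_apply_le ξ i
  have hpart : ∀ i, IsWeakPartial i u (F2.symm ((hmem i).toLp _)) := by
    intro i
    rw [isWeakPartial_iff, LinearIsometryEquiv.apply_symm_apply]
    exact (hmem i).coeFn_toLp
  rw [gradNormSq_eq _ hpart]
  congr 1
  have hn : ∀ i, ‖F2.symm ((hmem i).toLp _)‖ ^ 2 =
      ∫ ξ, (2 * Real.pi) ^ 2 * (ξ i) ^ 2 * ‖F2 u ξ‖ ^ 2 := by
    intro i
    rw [LinearIsometryEquiv.norm_map, norm_sq_eq_integral]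
    refine integral_congr_ae ?_
    filter_upwards [(hmem i).coeFn_toLp] with ξ h1
    rw [h1]
    simp only [norm_mul, Complex.norm_real, Complex.norm_I, mul_one, Complex.norm_ofNat, mul_pow,
      Real.norm_eq_abs, sq_abs]
  have hi : ∀ i, Integrable (fun ξ => (2 * Real.pi) ^ 2 * (ξ i) ^ 2 * ‖F2 u ξ‖ ^ 2) := by
    intro i
    have := (memLp_two_iff_integrable_sq_norm (hmem i).1).1 (hmem i)
    refine this.congr (Eventually.of_forall fun ξ => ?_)
    simp only [norm_mul, Complex.norm_real, Complex.norm_I, mul_one, Complex.norm_ofNat, mul_pow,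
      Real.norm_eq_abs, sq_abs]
  simp_rw [hn]
  rw [← integral_finsetSum _ fun i _ => hi i]
  congr 1
  ext ξ
  rw [lsym, norm_sq_eq_sum, Finset.mul_sum, Finset.sum_mul]

theorem memLp_sqrt_lsym_gHalf {c : ℝ} (hc : 0 < c) (w : L2) :
    MemLp (fun ξ => (Real.sqrt (lsym ξ) : ℂ) * F2 (gHalf c w) ξ) 2 (volume : Measure E3) := by
  refine (Lp.memLp (F2 w)).of_le ?_ ?_
  · refine AEStronglyMeasurable.mul ?_ (Lp.aestronglyMeasurable _)
    exact Continuous.aestronglyMeasurable (by have := continuous_lsym; fun_prop)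
  · filter_upwards [F2_gHalf hc w] with ξ h1
    rw [h1, ← mul_assoc, norm_mul, ← Complex.ofReal_mul, Complex.norm_real, Real.norm_eq_abs,
      abs_of_nonneg (mul_nonneg (Real.sqrt_nonneg _) (rsym_pos hc ξ).le)]
    refine mul_le_of_le_one_left (norm_nonneg _) ?_
    have h0 := lsym_nonneg ξ
    unfold rsym
    rw [← div_eq_mul_inv, div_le_one (by positivity)]
    exact Real.sqrt_le_sqrt (by linarith)

/-- Pointwise on the Fourier side this is `ℓ/(ℓ + c) = 1 - c/(ℓ + c)`, with `ℓ` the symbol of `-Δ`.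
-/
theorem gradNormSq_gHalf {c : ℝ} (hc : 0 < c) (w : L2) :
    gradNormSq (gHalf c w) = ENNReal.ofReal (‖w‖ ^ 2 - c * ‖gHalf c w‖ ^ 2) := by
  rw [gradNormSq_eq_of_memLp (memLp_sqrt_lsym_gHalf hc w)]
  congr 1
  rw [← F2.norm_map w, ← F2.norm_map (gHalf c w), norm_sq_eq_integral, norm_sq_eq_integral,
    ← integral_const_mul, ← integral_sub (integrable_norm_sq _) ((integrable_norm_sq _).const_mul c)]
  refine integral_congr_ae ?_
  filter_upwards [F2_gHalf hc w] with ξ h1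
  rw [h1, norm_mul, mul_pow, Complex.norm_real, Real.norm_eq_abs, sq_abs, rsym_sq hc]
  have h0 := lsym_nonneg ξ
  have : lsym ξ + c ≠ 0 := by positivity
  field_simp
  ring

theorem norm_gHalf_sq_le {c : ℝ} (hc : 0 < c) (w : L2) : c * ‖gHalf c w‖ ^ 2 ≤ ‖w‖ ^ 2 := by
  have h1 : ‖gHalf c w‖ ≤ (Real.sqrt c)⁻¹ * ‖w‖ :=
    ((gHalf c).le_opNorm w).trans (by gcongr; exact norm_gHalf_le hc)
  calc c * ‖gHalf c w‖ ^ 2 ≤ c * ((Real.sqrt c)⁻¹ * ‖w‖) ^ 2 := by gcongr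
    _ = ‖w‖ ^ 2 := by
      rw [mul_pow, inv_pow, Real.sq_sqrt hc.le]
      field_simp

theorem toReal_gradNormSq_gHalf {c : ℝ} (hc : 0 < c) (w : L2) :
    (gradNormSq (gHalf c w)).toReal = ‖w‖ ^ 2 - c * ‖gHalf c w‖ ^ 2 := by
  rw [gradNormSq_gHalf hc, ENNReal.toReal_ofReal]
  linarith [norm_gHalf_sq_le hc w]

/-! ### The heat semigroup -/

/-- The heat kernel of `exp (a² Δ)` on `ℝ³`. -/
def heat (a : ℝ) (x : E3) : ℝ :=
  ((2 * Real.sqrt Real.pi * a) ^ 3)⁻¹ * Real.exp (-(‖x‖ ^ 2 / (4 * a ^ 2)))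

/-- The symbol of `exp (a² Δ)`. -/
def heatSym (a : ℝ) (ξ : E3) : ℝ := Real.exp (-(a ^ 2 * lsym ξ))

theorem heat_pos {a : ℝ} (ha : 0 < a) (x : E3) : 0 < heat a x := by
  unfold heat; positivity

theorem heat_neg (a : ℝ) (x : E3) : heat a (-x) = heat a x := by
  unfold heat; rw [norm_neg]

theorem measurable_heat : Measurable fun p : ℝ × E3 => heat p.1 p.2 := by
  unfold heat; fun_prop

theorem heatSym_eq (a : ℝ) (ξ : E3) :
    heatSym a ξ = Real.exp (-((2 * Real.pi * a) ^ 2) * ‖ξ‖ ^ 2) := by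
  unfold heatSym lsym
  congr 1
  ring

theorem continuous_heatSym (a : ℝ) : Continuous (heatSym a) := by
  unfold heatSym; have := continuous_lsym; fun_prop

theorem heatSym_pos (a : ℝ) (ξ : E3) : 0 < heatSym a ξ := Real.exp_pos _

theorem heatSym_le_one (a : ℝ) (ξ : E3) : heatSym a ξ ≤ 1 := by
  unfold heatSym
  rw [Real.exp_le_one_iff]
  have := lsym_nonneg ξ
  nlinarith [mul_nonneg (sq_nonneg a) this]

theorem heatSym_mul (a b : ℝ) (ξ : E3) :
    heatSym a ξ * heatSym b ξ = heatSym (Real.sqrt (a ^ 2 + b ^ 2)) ξ := by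
  unfold heatSym
  rw [← Real.exp_add, Real.sq_sqrt (by positivity)]
  congr 1; ring

theorem integrable_heatSym {a : ℝ} (ha : 0 < a) : Integrable (heatSym a) := by
  have h := (GaussianFourier.integrable_cexp_neg_mul_sq_norm_add (V := E3)
    (b := (((2 * Real.pi * a) ^ 2 : ℝ) : ℂ)) (by rw [Complex.ofReal_re]; positivity) 0 0).norm
  refine h.congr (Eventually.of_forall fun ξ => ?_)
  rw [heatSym_eq]
  simp only [zero_mul, add_zero]
  rw [Complex.norm_exp]
  norm_cast

theorem memLp_heatSym_top (a : ℝ) :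
    MemLp (fun ξ => (heatSym a ξ : ℂ)) ∞ (volume : Measure E3) := by
  refine memLp_top_of_continuous (C := 1) (by have := continuous_heatSym a; fun_prop) fun ξ => ?_
  rw [Complex.norm_real, Real.norm_eq_abs, abs_of_pos (heatSym_pos a ξ)]
  exact heatSym_le_one a ξ

theorem memLp_heatSym_one {a : ℝ} (ha : 0 < a) :
    MemLp (fun ξ => (heatSym a ξ : ℂ)) 1 (volume : Measure E3) :=
  memLp_one_iff_integrable.2 (integrable_heatSym ha).ofReal

theorem memLp_two_of_one_of_top {f : E3 → ℂ} (h1 : MemLp f 1 (volume : Measure E3))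
    (h2 : MemLp f ∞ (volume : Measure E3)) : MemLp f 2 (volume : Measure E3) := by
  rw [memLp_two_iff_integrable_sq_norm h1.1]
  have := h1.norm.mul (f := fun x => ‖f x‖) (r := 1) h2.norm
  rw [memLp_one_iff_integrable] at this
  refine this.congr (Eventually.of_forall fun x => ?_)
  simp [sq]

theorem memLp_heatSym_two {a : ℝ} (ha : 0 < a) :
    MemLp (fun ξ => (heatSym a ξ : ℂ)) 2 (volume : Measure E3) :=
  memLp_two_of_one_of_top (memLp_heatSym_one ha) (memLp_heatSym_top a)

theorem fourier_heatSym {a : ℝ} (ha : 0 < a) (x : E3) :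
    𝓕 (fun ξ : E3 => (heatSym a ξ : ℂ)) x = (heat a x : ℂ) := by
  have h := fourier_gaussian_innerProductSpace (V := E3)
    (b := (((2 * Real.pi * a) ^ 2 : ℝ) : ℂ)) (by rw [Complex.ofReal_re]; positivity) x
  have e : (fun ξ : E3 => (heatSym a ξ : ℂ)) =
      fun v : E3 => Complex.exp (-(((2 * Real.pi * a) ^ 2 : ℝ) : ℂ) * (‖v‖ : ℂ) ^ 2) := by
    ext ξ
    rw [heatSym_eq]
    push_cast
    rfl
  rw [e, h]
  unfold heat
  rw [finrank_euclideanSpace_fin]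
  have hpi := Real.pi_pos
  have h1 : ((Real.pi : ℂ) / (((2 * Real.pi * a) ^ 2 : ℝ) : ℂ)) ^ (((3 : ℕ) : ℂ) / 2) =
      ((((2 * Real.sqrt Real.pi * a) ^ 3)⁻¹ : ℝ) : ℂ) := by
    rw [← Complex.ofReal_div, show (((3 : ℕ) : ℂ) / 2) = ((3 / 2 : ℝ) : ℂ) by push_cast; rfl,
      ← Complex.ofReal_cpow (by positivity)]
    congr 1
    have h2 : Real.pi / (2 * Real.pi * a) ^ 2 = ((2 * Real.sqrt Real.pi * a)⁻¹) ^ (2 : ℝ) := by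
      have hs := Real.sq_sqrt hpi.le
      rw [Real.rpow_two, inv_pow, show (2 * Real.sqrt Real.pi * a) ^ 2 =
        4 * Real.sqrt Real.pi ^ 2 * a ^ 2 by ring, hs]
      field_simp
      ring
    rw [h2, ← Real.rpow_mul (by positivity)]
    rw [show (2 : ℝ) * (3 / 2) = ((3 : ℕ) : ℝ) by norm_num, Real.rpow_natCast, inv_pow]
  rw [h1]
  push_cast
  congr 2
  field_simp
  ring

theorem fourierInv_heatSym {a : ℝ} (ha : 0 < a) (x : E3) :
    𝓕⁻ (fun ξ : E3 => (heatSym a ξ : ℂ)) x = (heat a x : ℂ) := by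
  rw [Real.fourierInv_eq_fourier_neg, fourier_heatSym ha, heat_neg]

theorem memLp_char_mul {m : E3 → ℂ} {p : ℝ≥0∞} (h : MemLp m p (volume : Measure E3)) (x : E3) :
    MemLp (fun ξ => Complex.exp (↑(2 * Real.pi * inner ℝ ξ x) * Complex.I) * m ξ) p
      (volume : Measure E3) := by
  refine h.of_le ?_ (Eventually.of_forall fun ξ => ?_)
  · refine AEStronglyMeasurable.mul (Continuous.aestronglyMeasurable (by fun_prop)) h.1
  · rw [norm_mul, Complex.norm_exp_ofReal_mul_I, one_mul]

/-- Convolution with the inverse Fourier transform of a symbol. -/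
theorem integral_fourierInv_sub_mul {m : E3 → ℂ} (h1 : MemLp m 1 (volume : Measure E3))
    (h2 : MemLp m 2 (volume : Measure E3)) (g : L2) (x : E3) :
    ∫ y, 𝓕⁻ m (x - y) * g y = 𝓕⁻ (fun ξ => m ξ * F2 g ξ) x := by
  -- Plancherel with `N` the conjugate of symbol times character: the inverse transform of `N` is
  -- the conjugate of the kernel `y ↦ 𝓕⁻ m (x - y)`, while on the Fourier side the pairing with `g`
  -- is an inverse Fourier integral.
  set n : E3 → ℂ := fun ξ => conj (Complex.exp (↑(2 * Real.pi * inner ℝ ξ x) * Complex.I) * m ξ)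
    with hn
  have hn1 : MemLp n 1 (volume : Measure E3) := memLp_conj (memLp_char_mul h1 x)
  have hn2 : MemLp n 2 (volume : Measure E3) := memLp_conj (memLp_char_mul h2 x)
  set N : L2 := hn2.toLp n
  have hN : N =ᵐ[volume] n := hn2.coeFn_toLp
  have hNi : Integrable N := (memLp_one_iff_integrable.1 hn1).congr hN.symm
  have e1 := inner_F2 (F2.symm N) g
  rw [F2.apply_symm_apply, inner_eq_integral, inner_eq_integral] at e1
  rw [Real.fourierInv_eq']
  have e2 : ∫ ξ, F2 g ξ * conj (N ξ) =
      ∫ v, Complex.exp (↑(2 * Real.pi * inner ℝ v x) * Complex.I) • (m v * F2 g v) := by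
    refine integral_congr_ae ?_
    filter_upwards [hN] with ξ h
    rw [h, hn]
    simp only [Complex.conj_conj, smul_eq_mul]
    ring
  rw [← e2, e1]
  refine integral_congr_ae ?_
  filter_upwards [F2_symm_ae_eq_fourierInv hNi] with y hy
  rw [hy, mul_comm]
  congr 1
  rw [Real.fourierInv_eq', Real.fourierInv_eq', ← integral_conj]
  refine integral_congr_ae ?_
  filter_upwards [hN] with ξ h
  rw [h, hn]
  simp only [smul_eq_mul, map_mul, Complex.conj_conj]
  rw [← mul_assoc, ← Complex.exp_conj, ← Complex.exp_add]
  congr 2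
  simp only [map_mul, Complex.conj_I, Complex.conj_ofReal, inner_sub_right]
  push_cast
  ring

/-- The operator `exp (a² Δ)`. -/
def heatOp (a : ℝ) : L2 →L[ℂ] L2 := fmul fun ξ => (heatSym a ξ : ℂ)

theorem F2_heatOp (a : ℝ) (g : L2) :
    F2 (heatOp a g) =ᵐ[volume] fun ξ => (heatSym a ξ : ℂ) * F2 g ξ := by
  unfold heatOp
  rw [F2_fmul]
  exact coeFn_mulOp (memLp_heatSym_top a) _

theorem integrable_heatSym_mul {a : ℝ} (ha : 0 < a) (g : L2) :
    Integrable (fun ξ => (heatSym a ξ : ℂ) * F2 g ξ) := by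
  rw [← memLp_one_iff_integrable]
  exact (Lp.memLp (F2 g)).mul (memLp_heatSym_two ha) (r := 1)

theorem heatOp_ae_eq {a : ℝ} (ha : 0 < a) (g : L2) :
    heatOp a g =ᵐ[volume] fun x => ∫ y, (heat a (x - y) : ℂ) * g y := by
  have h1 : Integrable (F2 (heatOp a g)) :=
    (integrable_heatSym_mul ha g).congr (F2_heatOp a g).symm
  have h2 := F2_symm_ae_eq_fourierInv h1
  rw [F2.symm_apply_apply] at h2
  filter_upwards [h2] with x hx
  rw [hx]
  have h3 := integral_fourierInv_sub_mul (memLp_heatSym_one ha) (memLp_heatSym_two ha) g x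
  simp_rw [fourierInv_heatSym ha] at h3
  rw [h3, Real.fourierInv_eq', Real.fourierInv_eq']
  refine integral_congr_ae ?_
  filter_upwards [F2_heatOp a g] with ξ h
  rw [h]

theorem inner_heatOp {a : ℝ} (ha : 0 < a) (f g : L2) :
    inner ℂ f (heatOp a g) = ∫ x, (∫ y, (heat a (x - y) : ℂ) * g y) * conj (f x) := by
  rw [inner_eq_integral]
  refine integral_congr_ae ?_
  filter_upwards [heatOp_ae_eq ha g] with x h
  rw [h]

theorem inner_heatOp_eq_fourier (a : ℝ) (f g : L2) :
    inner ℂ f (heatOp a g) = ∫ ξ, (heatSym a ξ : ℂ) * (F2 g ξ * conj (F2 f ξ)) := by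
  rw [← inner_F2, inner_eq_integral]
  refine integral_congr_ae ?_
  filter_upwards [F2_heatOp a g] with x h
  rw [h]
  ring

theorem integral_heat {a : ℝ} (ha : 0 < a) : Integrable (heat a) ∧ ∫ x, heat a x = 1 := by
  have hi : Integrable (fun x : E3 => Real.exp (-(1 / (4 * a ^ 2)) * ‖x‖ ^ 2)) := by
    have h := (GaussianFourier.integrable_cexp_neg_mul_sq_norm_add (V := E3)
      (b := ((1 / (4 * a ^ 2) : ℝ) : ℂ)) (by rw [Complex.ofReal_re]; positivity) 0 0).norm
    refine h.congr (Eventually.of_forall fun ξ => ?_)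
    simp only [zero_mul, add_zero]
    rw [Complex.norm_exp]
    norm_cast
  have e : heat a = fun x => ((2 * Real.sqrt Real.pi * a) ^ 3)⁻¹ *
      Real.exp (-(1 / (4 * a ^ 2)) * ‖x‖ ^ 2) := by
    ext x
    unfold heat
    congr 2
    ring
  have hpi := Real.pi_pos
  refine ⟨by rw [e]; exact hi.const_mul _, ?_⟩
  rw [e, integral_const_mul, GaussianFourier.integral_rexp_neg_mul_sq_norm (by positivity),
    finrank_euclideanSpace_fin]
  have h2 : Real.pi / (1 / (4 * a ^ 2)) = (2 * Real.sqrt Real.pi * a) ^ (2 : ℝ) := by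
    have hs := Real.sq_sqrt hpi.le
    rw [Real.rpow_two, show (2 * Real.sqrt Real.pi * a) ^ 2 =
        4 * Real.sqrt Real.pi ^ 2 * a ^ 2 by ring, hs]
    field_simp
  rw [h2, ← Real.rpow_mul (by positivity), show (2 : ℝ) * (((3 : ℕ) : ℝ) / 2) = ((3 : ℕ) : ℝ) by norm_num,
    Real.rpow_natCast]
  field_simp

theorem heat_le {a : ℝ} (ha : 0 < a) (x : E3) :
    heat a x ≤ ((2 * Real.sqrt Real.pi * a) ^ 3)⁻¹ := by
  unfold heat
  have : Real.exp (-(‖x‖ ^ 2 / (4 * a ^ 2))) ≤ 1 := by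
    rw [Real.exp_le_one_iff]
    have : 0 ≤ ‖x‖ ^ 2 / (4 * a ^ 2) := by positivity
    linarith
  exact mul_le_of_le_one_right (by positivity) this

theorem continuous_heat {a : ℝ} : Continuous (heat a) := by
  unfold heat; fun_prop

theorem memLp_heat {a : ℝ} (ha : 0 < a) :
    MemLp (fun x => (heat a x : ℂ)) 2 (volume : Measure E3) := by
  refine memLp_two_of_one_of_top (memLp_one_iff_integrable.2 (integral_heat ha).1.ofReal)
    (memLp_top_of_continuous (C := ((2 * Real.sqrt Real.pi * a) ^ 3)⁻¹)
    (by have := continuous_heat (a := a); fun_prop) fun x => ?_)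
  rw [Complex.norm_real, Real.norm_eq_abs, abs_of_pos (heat_pos ha x)]
  exact heat_le ha x

/-- The semigroup property of the heat kernel. -/
theorem integral_heat_mul_heat {a b : ℝ} (ha : 0 < a) (hb : 0 < b) (x y : E3) :
    ∫ z, heat a (x - z) * heat b (z - y) = heat (Real.sqrt (a ^ 2 + b ^ 2)) (x - y) := by
  have hc : 0 < Real.sqrt (a ^ 2 + b ^ 2) := by positivity
  -- The convolution formula is applied to the heat kernel centred at `y`, entered through its
  -- Fourier transform; the two Gaussian symbols then multiply.
  set n : E3 → ℂ := fun ξ => Complex.exp (↑(2 * Real.pi * inner ℝ ξ (-y)) * Complex.I) *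
    (heatSym b ξ : ℂ) with hn
  have hn1 : MemLp n 1 (volume : Measure E3) := memLp_char_mul (memLp_heatSym_one hb) _
  have hn2 : MemLp n 2 (volume : Measure E3) := memLp_char_mul (memLp_heatSym_two hb) _
  set N : L2 := hn2.toLp n
  have hN : N =ᵐ[volume] n := hn2.coeFn_toLp
  have hNi : Integrable N := (memLp_one_iff_integrable.1 hn1).congr hN.symm
  have h3 := integral_fourierInv_sub_mul (memLp_heatSym_one ha) (memLp_heatSym_two ha)
    (F2.symm N) x
  simp_rw [fourierInv_heatSym ha, F2.apply_symm_apply] at h3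
  have e1 : ∫ z, (heat a (x - z) : ℂ) * F2.symm N z =
      ∫ z, ((heat a (x - z) * heat b (z - y) : ℝ) : ℂ) := by
    refine integral_congr_ae ?_
    filter_upwards [F2_symm_ae_eq_fourierInv hNi] with z hz
    rw [hz, Complex.ofReal_mul, ← fourierInv_heatSym hb, Real.fourierInv_eq',
      Real.fourierInv_eq']
    congr 1
    refine integral_congr_ae ?_
    filter_upwards [hN] with ξ h
    rw [h, hn]
    simp only [smul_eq_mul]
    rw [← mul_assoc, ← Complex.exp_add]
    congr 2
    simp only [inner_sub_right, inner_neg_right]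
    push_cast
    ring
  rw [e1, integral_complex_ofReal] at h3
  have e2 : 𝓕⁻ (fun ξ => (heatSym a ξ : ℂ) * N ξ) x =
      (heat (Real.sqrt (a ^ 2 + b ^ 2)) (x - y) : ℂ) := by
    rw [← fourierInv_heatSym hc, Real.fourierInv_eq', Real.fourierInv_eq']
    refine integral_congr_ae ?_
    filter_upwards [hN] with ξ h
    rw [h, hn, ← heatSym_mul]
    simp only [smul_eq_mul]
    have e : Complex.exp (↑(2 * Real.pi * inner ℝ ξ (x - y)) * Complex.I) =
        Complex.exp (↑(2 * Real.pi * inner ℝ ξ x) * Complex.I) *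
          Complex.exp (↑(2 * Real.pi * inner ℝ ξ (-y)) * Complex.I) := by
      rw [← Complex.exp_add]
      congr 1
      simp only [inner_sub_right, inner_neg_right]
      push_cast
      ring
    rw [e, Complex.ofReal_mul (heatSym a ξ)]
    ring
  rw [e2] at h3
  exact_mod_cast h3

/-! ### Riesz and Newton kernels as superpositions of heat kernels -/

/-- The kernel of `(-Δ)^{-1/2}`. -/
def riesz (x : E3) : ℝ := 1 / (2 * Real.pi ^ 2 * ‖x‖ ^ 2)

/-- The kernel of `(-Δ)^{-1}`. -/
def newton (x : E3) : ℝ := 1 / (4 * Real.pi * ‖x‖)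

theorem riesz_nonneg (x : E3) : 0 ≤ riesz x := by unfold riesz; positivity

theorem newton_nonneg (x : E3) : 0 ≤ newton x := by
  have := Real.pi_pos
  unfold newton; positivity

theorem measurable_riesz : Measurable riesz := by unfold riesz; fun_prop

theorem measurable_newton : Measurable newton := by unfold newton; fun_prop

theorem riesz_sub_comm (x y : E3) : riesz (x - y) = riesz (y - x) := by
  unfold riesz; rw [norm_sub_rev]

theorem formFactor_eq (x y : E3) : formFactor x y = -riesz (x - y) := rfl

/-- The substitution `s = 1/a` reduces integrals of heat kernels over the parameter to elementary
Gaussian moments. -/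
theorem lintegral_Ioi_comp_inv {g : ℝ → ℝ} (hg : IntegrableOn g (Set.Ioi 0))
    (h0 : ∀ s, 0 < s → 0 ≤ g s) :
    ∫⁻ a in Set.Ioi (0 : ℝ), ENNReal.ofReal (a ^ (-2 : ℝ) * g (a⁻¹)) =
      ENNReal.ofReal (∫ s in Set.Ioi (0 : ℝ), g s) := by
  have hp : (-1 : ℝ) ≠ 0 := by norm_num
  have h1 := (integrableOn_Ioi_comp_rpow_iff g hp).2 hg
  have h2 := integral_comp_rpow_Ioi g hp
  have e : ∀ a : ℝ, (|(-1 : ℝ)| * a ^ ((-1 : ℝ) - 1)) • g (a ^ (-1 : ℝ)) = a ^ (-2 : ℝ) * g a⁻¹ := by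
    intro a
    rw [Real.rpow_neg_one, abs_neg, abs_one, one_mul, smul_eq_mul]
    norm_num
  simp_rw [e] at h1 h2
  rw [← h2, ofReal_integral_eq_lintegral_ofReal h1]
  filter_upwards [ae_restrict_mem measurableSet_Ioi] with a ha
  have ha : (0 : ℝ) < a := ha
  have := h0 a⁻¹ (by positivity)
  simp only [Pi.zero_apply]
  positivity

theorem integral_mul_exp_neg_mul_sq {b : ℝ} (hb : 0 < b) :
    ∫ s in Set.Ioi (0 : ℝ), s * Real.exp (-b * s ^ 2) = (2 * b)⁻¹ := by
  have h := integral_mul_cexp_neg_mul_sq (b := (b : ℂ)) (by simpa using hb)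
  have e : ∀ r : ℝ, (r : ℂ) * Complex.exp (-(b : ℂ) * (r : ℂ) ^ 2) =
      ((r * Real.exp (-b * r ^ 2) : ℝ) : ℂ) := fun r => by push_cast; rfl
  simp_rw [e] at h
  rw [integral_complex_ofReal] at h
  exact_mod_cast h

theorem lintegral_heat {x : E3} (hx : x ≠ 0) :
    ∫⁻ a in Set.Ioi (0 : ℝ), ENNReal.ofReal (heat a x) =
      ENNReal.ofReal (Real.sqrt Real.pi / 2 * riesz x) := by
  have hr : 0 < ‖x‖ := norm_pos_iff.2 hx
  have hpi := Real.pi_pos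
  have hs := Real.sq_sqrt hpi.le
  have hs0 : 0 < Real.sqrt Real.pi := Real.sqrt_pos.2 hpi
  have hb : 0 < ‖x‖ ^ 2 / 4 := by positivity
  have h := lintegral_Ioi_comp_inv (g := fun s => ((2 * Real.sqrt Real.pi) ^ 3)⁻¹ *
    (s * Real.exp (-(‖x‖ ^ 2 / 4) * s ^ 2)))
    ((integrable_mul_exp_neg_mul_sq hb).const_mul _).integrableOn (fun s hs => by positivity)
  rw [integral_const_mul, integral_mul_exp_neg_mul_sq hb] at h
  have e : ((2 * Real.sqrt Real.pi) ^ 3)⁻¹ * (2 * (‖x‖ ^ 2 / 4))⁻¹ =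
      Real.sqrt Real.pi / 2 * riesz x := by
    unfold riesz
    rw [show Real.pi ^ 2 = Real.sqrt Real.pi ^ 4 by rw [show Real.sqrt Real.pi ^ 4 = (Real.sqrt Real.pi ^ 2) ^ 2 by ring, hs]]
    field_simp
    norm_num
  rw [← e, ← h]
  refine setLIntegral_congr_fun measurableSet_Ioi fun a ha => ?_
  have ha : (0 : ℝ) < a := ha
  congr 1
  unfold heat
  rw [Real.rpow_neg ha.le, Real.rpow_two]
  have : -(‖x‖ ^ 2 / (4 * a ^ 2)) = -(‖x‖ ^ 2 / 4) * a⁻¹ ^ 2 := by field_simp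
  rw [this]
  field_simp

theorem lintegral_mul_heat {x : E3} (hx : x ≠ 0) :
    ∫⁻ a in Set.Ioi (0 : ℝ), ENNReal.ofReal (a * heat a x) =
      ENNReal.ofReal (newton x / 2) := by
  have hr : 0 < ‖x‖ := norm_pos_iff.2 hx
  have hpi := Real.pi_pos
  have hs := Real.sq_sqrt hpi.le
  have hs0 : 0 < Real.sqrt Real.pi := Real.sqrt_pos.2 hpi
  have hb : 0 < ‖x‖ ^ 2 / 4 := by positivity
  have h := lintegral_Ioi_comp_inv (g := fun s => ((2 * Real.sqrt Real.pi) ^ 3)⁻¹ *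
    (Real.exp (-(‖x‖ ^ 2 / 4) * s ^ 2)))
    ((integrable_exp_neg_mul_sq hb).const_mul _).integrableOn (fun s hs => by positivity)
  rw [integral_const_mul, integral_gaussian_Ioi] at h
  have e : ((2 * Real.sqrt Real.pi) ^ 3)⁻¹ * (Real.sqrt (Real.pi / (‖x‖ ^ 2 / 4)) / 2) =
      newton x / 2 := by
    unfold newton
    rw [show Real.pi / (‖x‖ ^ 2 / 4) = (2 * Real.sqrt Real.pi / ‖x‖) ^ 2 by
      rw [div_pow, mul_pow, hs]; field_simp; norm_num, Real.sqrt_sq (by positivity)]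
    rw [mul_pow, show Real.sqrt Real.pi ^ 3 = Real.sqrt Real.pi * Real.pi by
      rw [pow_succ, hs, mul_comm]]
    field_simp
    norm_num
  rw [← e, ← h]
  refine setLIntegral_congr_fun measurableSet_Ioi fun a ha => ?_
  have ha : (0 : ℝ) < a := ha
  congr 1
  unfold heat
  rw [Real.rpow_neg ha.le, Real.rpow_two]
  have : -(‖x‖ ^ 2 / (4 * a ^ 2)) = -(‖x‖ ^ 2 / 4) * a⁻¹ ^ 2 := by field_simp
  rw [this]
  field_simp

/-- Polar coordinates in the open quadrant, whose angle is `π/2`. The parameters of two heat kernels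
combine to `√(a² + b²)`, so a double superposition becomes a single one with weight `r`. -/
theorem lintegral_lintegral_sqrt {F : ℝ → ℝ≥0∞} (hF : Measurable F) :
    ∫⁻ a in Set.Ioi (0 : ℝ), ∫⁻ b in Set.Ioi (0 : ℝ), F (Real.sqrt (a ^ 2 + b ^ 2)) =
      ENNReal.ofReal (Real.pi / 2) * ∫⁻ r in Set.Ioi (0 : ℝ), ENNReal.ofReal r * F r := by
  have hS : MeasurableSet (Set.Ioi (0 : ℝ) ×ˢ Set.Ioi (0 : ℝ)) :=
    measurableSet_Ioi.prod measurableSet_Ioi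
  have hpi := Real.pi_pos
  have hm : Measurable fun p : ℝ × ℝ => F (Real.sqrt (p.1 ^ 2 + p.2 ^ 2)) :=
    hF.comp (by fun_prop)
  rw [← lintegral_prod (μ := volume.restrict (Set.Ioi (0 : ℝ))) (ν := volume.restrict (Set.Ioi (0 : ℝ)))
    (fun p : ℝ × ℝ => F (Real.sqrt (p.1 ^ 2 + p.2 ^ 2))) hm.aemeasurable,
    Measure.prod_restrict, ← lintegral_indicator hS]
  change ∫⁻ p : ℝ × ℝ, _ = _
  rw [← lintegral_comp_polarCoord_symm, polarCoord_target]
  have e : ∀ p ∈ Set.Ioi (0 : ℝ) ×ˢ Set.Ioo (-Real.pi) Real.pi,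
      ENNReal.ofReal p.1 • (Set.Ioi (0 : ℝ) ×ˢ Set.Ioi (0 : ℝ)).indicator
        (fun p : ℝ × ℝ => F (Real.sqrt (p.1 ^ 2 + p.2 ^ 2))) (polarCoord.symm p) =
      (ENNReal.ofReal p.1 * F p.1) * (Set.Ioo (0 : ℝ) (Real.pi / 2)).indicator 1 p.2 := by
    rintro ⟨r, θ⟩ ⟨hr, hθ1, hθ2⟩
    have hr : 0 < r := hr
    simp only [polarCoord_symm_apply, smul_eq_mul] at *
    have hiff : (r * Real.cos θ, r * Real.sin θ) ∈ Set.Ioi (0 : ℝ) ×ˢ Set.Ioi (0 : ℝ) ↔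
        θ ∈ Set.Ioo (0 : ℝ) (Real.pi / 2) := by
      simp only [Set.mem_prod, Set.mem_Ioi, Set.mem_Ioo, mul_pos_iff_of_pos_left hr]
      constructor
      · rintro ⟨hc, hs⟩
        constructor
        · by_contra hle
          exact absurd hs (not_lt.2 (Real.sin_nonpos_of_nonpos_of_neg_pi_le (not_lt.1 hle) hθ1.le))
        · by_contra hle
          exact absurd hc (not_lt.2 (Real.cos_nonpos_of_pi_div_two_le_of_le (not_lt.1 hle)
            (by linarith)))
      · rintro ⟨h1, h2⟩
        exact ⟨Real.cos_pos_of_mem_Ioo ⟨by linarith, h2⟩, Real.sin_pos_of_pos_of_lt_pi h1 hθ2⟩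
    by_cases hθ : θ ∈ Set.Ioo (0 : ℝ) (Real.pi / 2)
    · rw [Set.indicator_of_mem (hiff.2 hθ), Set.indicator_of_mem hθ]
      rw [show (r * Real.cos θ) ^ 2 + (r * Real.sin θ) ^ 2 = r ^ 2 by
        have := Real.sin_sq_add_cos_sq θ
        linear_combination r ^ 2 * this, Real.sqrt_sq hr.le]
      simp
    · rw [Set.indicator_of_notMem (fun h => hθ (hiff.1 h)), Set.indicator_of_notMem hθ]
      simp
  rw [setLIntegral_congr_fun (measurableSet_Ioi.prod measurableSet_Ioo) e]
  change ∫⁻ p, _ ∂((volume.prod volume).restrict _) = _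
  rw [← Measure.prod_restrict, lintegral_prod_mul (f := fun r => ENNReal.ofReal r * F r)
    (g := (Set.Ioo (0 : ℝ) (Real.pi / 2)).indicator 1) (by fun_prop)
    (measurable_one.indicator measurableSet_Ioo).aemeasurable, mul_comm]
  congr 1
  rw [lintegral_indicator_one measurableSet_Ioo, Measure.restrict_apply measurableSet_Ioo,
    Set.inter_eq_left.2 (Set.Ioo_subset_Ioo (by linarith) (by linarith)), Real.volume_Ioo, sub_zero]

/-- The composition formula for the Riesz kernels. -/
theorem lintegral_riesz_mul_riesz {x y : E3} (hxy : x ≠ y) :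
    ∫⁻ z, ENNReal.ofReal (riesz (x - z)) * ENNReal.ofReal (riesz (z - y)) =
      ENNReal.ofReal (newton (x - y)) := by
  have hpi := Real.pi_pos
  have hs := Real.sq_sqrt hpi.le
  have hs0 : 0 < Real.sqrt Real.pi := Real.sqrt_pos.2 hpi
  have hk : ∀ w : E3, w ≠ 0 → ENNReal.ofReal (riesz w) = ENNReal.ofReal (2 / Real.sqrt Real.pi) *
      ∫⁻ a in Set.Ioi (0 : ℝ), ENNReal.ofReal (heat a w) := by
    intro w hw
    rw [lintegral_heat hw, ← ENNReal.ofReal_mul (by positivity)]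
    congr 1
    field_simp
  have hmeas : ∀ w : E3, Measurable fun a => ENNReal.ofReal (heat a w) := fun w =>
    (measurable_heat.comp (measurable_id.prodMk measurable_const)).ennreal_ofReal
  -- Each Riesz kernel is `2/√π` times an integral of heat kernels, which produces the factor `4/π`.
  have h1 : ∫⁻ z, ENNReal.ofReal (riesz (x - z)) * ENNReal.ofReal (riesz (z - y)) =
      ∫⁻ z, ENNReal.ofReal (4 / Real.pi) * ∫⁻ a in Set.Ioi (0 : ℝ), ∫⁻ b in Set.Ioi (0 : ℝ),
        ENNReal.ofReal (heat a (x - z)) * ENNReal.ofReal (heat b (z - y)) := by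
    have hx : ∀ᵐ z : E3, z ≠ x := by simp [ae_iff]
    have hy : ∀ᵐ z : E3, z ≠ y := by simp [ae_iff]
    refine lintegral_congr_ae ?_
    filter_upwards [hx, hy] with z hzx hzy
    rw [hk _ (sub_ne_zero.2 hzx.symm), hk _ (sub_ne_zero.2 hzy),
      lintegral_lintegral_mul (hmeas _).aemeasurable (hmeas _).aemeasurable,
      mul_mul_mul_comm, ← ENNReal.ofReal_mul (by positivity)]
    congr 2
    rw [div_mul_div_comm, ← sq (Real.sqrt Real.pi), hs]
    norm_num
  have hmeas3 : Measurable fun p : (E3 × ℝ) × ℝ =>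
      ENNReal.ofReal (heat p.1.2 (x - p.1.1)) * ENNReal.ofReal (heat p.2 (p.1.1 - y)) := by
    refine Measurable.fun_mul ?_ ?_
    · exact (measurable_heat.comp (by fun_prop : Measurable fun p : (E3 × ℝ) × ℝ =>
        (p.1.2, x - p.1.1))).ennreal_ofReal
    · exact (measurable_heat.comp (by fun_prop : Measurable fun p : (E3 × ℝ) × ℝ =>
        (p.2, p.1.1 - y))).ennreal_ofReal
  rw [h1, lintegral_const_mul _ (by
    exact (hmeas3.lintegral_prod_right' (ν := volume.restrict (Set.Ioi (0:ℝ)))).lintegral_prod_right'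
      (ν := volume.restrict (Set.Ioi (0:ℝ))))]
  rw [lintegral_lintegral_swap (f := fun (z : E3) (a : ℝ) => ∫⁻ b in Set.Ioi (0 : ℝ),
        ENNReal.ofReal (heat a (x - z)) * ENNReal.ofReal (heat b (z - y)))
    (hmeas3.lintegral_prod_right' (ν := volume.restrict (Set.Ioi (0:ℝ)))).aemeasurable]
  have h2 : ∀ a ∈ Set.Ioi (0 : ℝ), ∫⁻ z, ∫⁻ b in Set.Ioi (0 : ℝ),
        ENNReal.ofReal (heat a (x - z)) * ENNReal.ofReal (heat b (z - y)) =
      ∫⁻ b in Set.Ioi (0 : ℝ), ENNReal.ofReal (heat (Real.sqrt (a ^ 2 + b ^ 2)) (x - y)) := by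
    intro a ha
    have ha : 0 < a := ha
    rw [lintegral_lintegral_swap (f := fun (z : E3) (b : ℝ) =>
        ENNReal.ofReal (heat a (x - z)) * ENNReal.ofReal (heat b (z - y))) (hmeas3.comp (by fun_prop : Measurable fun p : E3 × ℝ =>
      ((p.1, a), p.2))).aemeasurable]
    refine setLIntegral_congr_fun measurableSet_Ioi fun b hb => ?_
    have hb : 0 < b := hb
    rw [← integral_heat_mul_heat ha hb, ofReal_integral_eq_lintegral_ofReal]
    · refine lintegral_congr fun z => ?_
      rw [ENNReal.ofReal_mul (heat_pos ha _).le]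
    · refine Integrable.bdd_mul (c := ((2 * Real.sqrt Real.pi * a) ^ 3)⁻¹)
        ((integral_heat hb).1.comp_sub_right y) ?_ ?_
      · exact (continuous_heat.comp (by fun_prop)).aestronglyMeasurable
      · refine Eventually.of_forall fun z => ?_
        rw [Real.norm_eq_abs, abs_of_pos (heat_pos ha _)]
        exact heat_le ha _
    · exact Eventually.of_forall fun z => (mul_pos (heat_pos ha _) (heat_pos hb _)).le
  -- The constants match: `4/π` from the Riesz kernels, `π/2` from the angle, and `1/2` from the
  -- integral of `r` times the heat kernel.
  rw [setLIntegral_congr_fun measurableSet_Ioi h2, lintegral_lintegral_sqrt (hmeas (x - y))]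
  have h3 : ∀ r ∈ Set.Ioi (0 : ℝ), ENNReal.ofReal r * ENNReal.ofReal (heat r (x - y)) =
      ENNReal.ofReal (r * heat r (x - y)) := fun r hr => (ENNReal.ofReal_mul (le_of_lt hr)).symm
  rw [setLIntegral_congr_fun measurableSet_Ioi h3, lintegral_mul_heat (sub_ne_zero.2 hxy),
    ← mul_assoc, ← ENNReal.ofReal_mul (by positivity), ← ENNReal.ofReal_mul (by positivity)]
  congr 1
  field_simp
  norm_num

/-! ### Subordination and simplicity of the ground state -/

theorem re_integral {α : Type*} [MeasurableSpace α] {μ : Measure α} {f : α → ℂ}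
    (hf : Integrable f μ) : (∫ x, f x ∂μ).re = ∫ x, (f x).re ∂μ :=
  (integral_re hf).symm

/-- Subordination: a superposition of the heat semigroup is a Fourier multiplier. -/
theorem integral_inner_heatOp {ω : ℝ → ℝ} (hω : Measurable ω) (hω0 : ∀ a, 0 < a → 0 ≤ ω a)
    {S : E3 → ℝ}
    (hS : ∀ ξ, ξ ≠ 0 → IntegrableOn (fun a => ω a * heatSym a ξ) (Set.Ioi 0) ∧
      ∫ a in Set.Ioi (0 : ℝ), ω a * heatSym a ξ = S ξ)
    (f g : L2) (hI : Integrable (fun ξ => (S ξ : ℂ) * (F2 g ξ * conj (F2 f ξ)))) :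
    IntegrableOn (fun a => (ω a : ℂ) * inner ℂ f (heatOp a g)) (Set.Ioi 0) ∧
      ∫ a in Set.Ioi (0 : ℝ), (ω a : ℂ) * inner ℂ f (heatOp a g) =
        ∫ ξ, (S ξ : ℂ) * (F2 g ξ * conj (F2 f ξ)) := by
  have h0 : ∀ᵐ ξ : E3, ξ ≠ 0 := by simp [ae_iff]
  set G : E3 → ℂ := fun ξ => F2 g ξ * conj (F2 f ξ) with hG
  have hGm : AEStronglyMeasurable G volume := (integrable_inner _ _).1
  have hm : AEStronglyMeasurable (fun p : E3 × ℝ => ((ω p.2 * heatSym p.2 p.1 : ℝ) : ℂ) * G p.1)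
      (volume.prod (volume.restrict (Set.Ioi (0 : ℝ)))) := by
    refine AEStronglyMeasurable.mul ?_ hGm.comp_fst
    refine (Measurable.aestronglyMeasurable ?_)
    unfold heatSym lsym
    fun_prop
  have hint : Integrable (fun p : E3 × ℝ => ((ω p.2 * heatSym p.2 p.1 : ℝ) : ℂ) * G p.1)
      (volume.prod (volume.restrict (Set.Ioi (0 : ℝ)))) := by
    rw [integrable_prod_iff hm]
    constructor
    · filter_upwards [h0] with ξ hξ
      exact (hS ξ hξ).1.ofReal.mul_const _
    · refine hI.norm.congr ?_
      filter_upwards [h0] with ξ hξ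
      have e : ∀ a ∈ Set.Ioi (0 : ℝ), ‖((ω a * heatSym a ξ : ℝ) : ℂ) * G ξ‖ =
          ω a * heatSym a ξ * ‖G ξ‖ := by
        intro a ha
        rw [norm_mul, Complex.norm_real, Real.norm_eq_abs,
          abs_of_nonneg (mul_nonneg (hω0 a ha) (heatSym_pos a ξ).le)]
      rw [setIntegral_congr_fun measurableSet_Ioi e, integral_mul_const, (hS ξ hξ).2, norm_mul,
        Complex.norm_real, Real.norm_eq_abs, abs_of_nonneg]
      rw [← (hS ξ hξ).2]
      exact setIntegral_nonneg measurableSet_Ioi fun a ha =>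
        mul_nonneg (hω0 a ha) (heatSym_pos a ξ).le
  have e1 : ∀ a, (ω a : ℂ) * inner ℂ f (heatOp a g) =
      ∫ ξ, ((ω a * heatSym a ξ : ℝ) : ℂ) * G ξ := by
    intro a
    rw [inner_heatOp_eq_fourier, ← integral_const_mul]
    refine integral_congr_ae (Eventually.of_forall fun ξ => ?_)
    simp only [hG]
    push_cast
    ring
  simp_rw [e1]
  refine ⟨hint.integral_prod_right, ?_⟩
  rw [← integral_integral_swap hint]
  refine integral_congr_ae ?_
  filter_upwards [h0] with ξ hξ
  rw [integral_mul_const, integral_complex_ofReal, (hS ξ hξ).2]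

/-- The resolvent as the Laplace transform of the heat semigroup. -/
theorem integral_heatSym_resolvent {c : ℝ} (hc : 0 < c) (ξ : E3) :
    IntegrableOn (fun a => 2 * (a * Real.exp (-(c * a ^ 2))) * heatSym a ξ) (Set.Ioi 0) ∧
      ∫ a in Set.Ioi (0 : ℝ), 2 * (a * Real.exp (-(c * a ^ 2))) * heatSym a ξ = (lsym ξ + c)⁻¹ := by
  have hb : 0 < lsym ξ + c := by have := lsym_nonneg ξ; positivity
  have e : (fun a => 2 * (a * Real.exp (-(c * a ^ 2))) * heatSym a ξ) =
      fun a => 2 * (a * Real.exp (-(lsym ξ + c) * a ^ 2)) := by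
    ext a
    unfold heatSym
    rw [mul_assoc, mul_assoc, ← Real.exp_add]
    congr 3
    ring
  rw [e]
  refine ⟨((integrable_mul_exp_neg_mul_sq hb).const_mul 2).integrableOn, ?_⟩
  rw [integral_const_mul, integral_mul_exp_neg_mul_sq hb]
  field_simp

theorem integral_heatSym_riesz {ξ : E3} (hξ : ξ ≠ 0) :
    IntegrableOn (fun a => 2 / Real.sqrt Real.pi * heatSym a ξ) (Set.Ioi 0) ∧
      ∫ a in Set.Ioi (0 : ℝ), 2 / Real.sqrt Real.pi * heatSym a ξ = (2 * Real.pi * ‖ξ‖)⁻¹ := by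
  have hr : 0 < ‖ξ‖ := norm_pos_iff.2 hξ
  have hpi := Real.pi_pos
  have hb : 0 < lsym ξ := by unfold lsym; positivity
  have e : (fun a => heatSym a ξ) = fun a => Real.exp (-(lsym ξ) * a ^ 2) := by
    ext a
    unfold heatSym
    congr 1
    ring
  have e' : (fun a => 2 / Real.sqrt Real.pi * heatSym a ξ) =
      fun a => 2 / Real.sqrt Real.pi * Real.exp (-(lsym ξ) * a ^ 2) := by
    ext a; rw [← congrFun e a]
  rw [e']
  refine ⟨((integrable_exp_neg_mul_sq hb).const_mul _).integrableOn, ?_⟩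
  rw [integral_const_mul, integral_gaussian_Ioi, Real.sqrt_div hpi.le]
  have : Real.sqrt (lsym ξ) = 2 * Real.pi * ‖ξ‖ := by
    unfold lsym
    rw [← mul_pow, Real.sqrt_sq (by positivity)]
  rw [this]
  have := Real.sqrt_pos.2 hpi
  field_simp

theorem inner_gRes_eq {c : ℝ} (hc : 0 < c) (f g : L2) :
    IntegrableOn (fun a => ((2 * (a * Real.exp (-(c * a ^ 2))) : ℝ) : ℂ) * inner ℂ f (heatOp a g))
      (Set.Ioi 0) ∧
    ∫ a in Set.Ioi (0 : ℝ), ((2 * (a * Real.exp (-(c * a ^ 2))) : ℝ) : ℂ) *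
      inner ℂ f (heatOp a g) = inner ℂ f (gRes c g) := by
  have e : inner ℂ f (gRes c g) = ∫ ξ, (((lsym ξ + c)⁻¹ : ℝ) : ℂ) * (F2 g ξ * conj (F2 f ξ)) := by
    rw [← inner_F2, inner_eq_integral]
    refine integral_congr_ae ?_
    filter_upwards [F2_gRes hc g] with ξ h
    rw [h]
    push_cast
    ring
  have hI : Integrable (fun ξ => (((lsym ξ + c)⁻¹ : ℝ) : ℂ) * (F2 g ξ * conj (F2 f ξ))) := by
    refine (integrable_inner (F2 f) (F2 (gRes c g))).congr ?_
    filter_upwards [F2_gRes hc g] with ξ h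
    rw [h]
    push_cast
    ring
  rw [e]
  exact integral_inner_heatOp (by fun_prop) (fun a ha => by positivity)
    (fun ξ _ => integral_heatSym_resolvent hc ξ) f g hI

theorem integrable_heat_mul {a : ℝ} (ha : 0 < a) (g : L2) (x : E3) :
    Integrable (fun y => (heat a (x - y) : ℂ) * g y) := by
  rw [← memLp_one_iff_integrable]
  have h : MemLp (fun y => (heat a (x - y) : ℂ)) 2 (volume : Measure E3) :=
    (memLp_heat ha).comp_measurePreserving (Measure.measurePreserving_sub_left volume x)
  exact (Lp.memLp g).mul h (r := 1)

theorem memLp_sign {u : L2} : MemLp (fun x => u x / (‖u x‖ : ℂ)) ∞ (volume : Measure E3) := by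
  have hm := Lp.aestronglyMeasurable u
  refine memLp_top_of_bound (C := 1) ?_ (Eventually.of_forall fun x => ?_)
  · exact (hm.aemeasurable.div (Complex.measurable_ofReal.comp_aemeasurable hm.norm.aemeasurable)).aestronglyMeasurable
  · rw [norm_div, Complex.norm_real, norm_norm]
    exact div_self_le_one _

/-- The ground state of a Schrödinger operator with attractive potential is simple. -/
theorem eq_zero_of_inner_ground_state_eq_zero {c : ℝ} (hc : 0 < c) {W : E3 → ℝ}
    (hWL : MemLp (fun x => (W x : ℂ)) ∞ (volume : Measure E3)) (hW : ∀ᵐ x, 0 < W x)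
    {ψ u : L2} (hψpos : ∀ᵐ x : E3, 0 < (ψ x).re ∧ (ψ x).im = 0)
    (hψ : ψ = gRes c (mulOp (fun x => (W x : ℂ)) ψ))
    (hu : u = gRes c (mulOp (fun x => (W x : ℂ)) u)) (hort : inner ℂ ψ u = 0) : u = 0 := by
  set Wm := mulOp (fun x => (W x : ℂ)) with hWm
  have hWa : ∀ v : L2, Wm v =ᵐ[volume] fun x => (W x : ℂ) * v x := fun v => coeFn_mulOp hWL v
  have habs : MemLp (fun x => (‖u x‖ : ℂ)) 2 (volume : Measure E3) := (Lp.memLp u).norm.ofReal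
  set v : L2 := habs.toLp _
  have hv : v =ᵐ[volume] fun x => (‖u x‖ : ℂ) := habs.coeFn_toLp
  -- `χ` is `ψ` carrying the phase of `u`; where `u` vanishes the quotient is zero by convention,
  -- which does no harm.
  set χ : L2 := mulOp (fun x => u x / (‖u x‖ : ℂ)) ψ
  have hχ : χ =ᵐ[volume] fun x => u x / (‖u x‖ : ℂ) * ψ x := coeFn_mulOp memLp_sign ψ
  have hWsym : ∀ f g : L2, inner ℂ (Wm f) g = inner ℂ f (Wm g) := by
    intro f g
    rw [hWm, inner_mulOp_left hWL]
    simp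
  -- The eigenvalue equations remove one resolvent on each side, and both sides become `∫ W |u| ψ`.
  -- Thus the inequality that a positive kernel gives between these two forms is an equality.
  have key : inner ℂ (Wm ψ) (gRes c (Wm v)) = inner ℂ (Wm χ) (gRes c (Wm u)) := by
    rw [← inner_gRes_left hc, ← hψ, ← hu, hWsym, inner_eq_integral, inner_eq_integral]
    refine integral_congr_ae ?_
    filter_upwards [hWa v, hWa u, hv, hχ, hψpos] with x h1 h2 h3 h4 h5
    rw [h1, h2, h3, h4, map_mul, map_div₀, Complex.conj_ofReal]
    by_cases h : u x = 0
    · simp [h]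
    · have hn : (‖u x‖ : ℂ) ≠ 0 := by simpa using h
      have := Complex.mul_conj' (u x)
      field_simp
      linear_combination (-(W x : ℂ)) * this * conj (ψ x)
  have hA := inner_gRes_eq hc (Wm ψ) (Wm v)
  have hB := inner_gRes_eq hc (Wm χ) (Wm u)
  -- For each time the deficit in that inequality is an integral of a nonnegative function against
  -- the heat kernel. The weighted time integral of the deficits is zero by `key`.
  have hpt : ∀ a, 0 < a → ∃ Φ : E3 → ℝ, (∀ᵐ x, Φ x = W x * (ψ x).re * ∫ y, heat a (x - y) * (W y *
      (‖u y‖ - (conj (u x / (‖u x‖ : ℂ)) * u y).re))) ∧ Integrable Φ ∧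
      (inner ℂ (Wm ψ) (heatOp a (Wm v)) - inner ℂ (Wm χ) (heatOp a (Wm u))).re = ∫ x, Φ x := by
    intro a ha
    refine ⟨fun x => (heatOp a (Wm v) x * conj (Wm ψ x) - heatOp a (Wm u) x * conj (Wm χ x)).re,
      ?_, ?_, ?_⟩
    · filter_upwards [hWa ψ, hWa χ, hχ, hψpos, heatOp_ae_eq ha (Wm v), heatOp_ae_eq ha (Wm u)]
        with x h1 h2 h3 h4 h5 h6
      have hr : ψ x = ((ψ x).re : ℂ) := by
        apply Complex.ext <;> simp [h4.2]
      rw [h5, h6, h1, h2, h3]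
      set s := conj (u x / (‖u x‖ : ℂ)) with hs
      rw [map_mul, map_mul, map_mul, ← hs, Complex.conj_ofReal, hr, Complex.conj_ofReal]
      have : (∫ y, (heat a (x - y) : ℂ) * Wm v y) * ((W x : ℂ) * ((ψ x).re : ℂ)) -
          (∫ y, (heat a (x - y) : ℂ) * Wm u y) * ((W x : ℂ) * (s * ((ψ x).re : ℂ))) =
          ((W x * (ψ x).re : ℝ) : ℂ) * ∫ y, ((heat a (x - y) : ℂ) * Wm v y -
            s * ((heat a (x - y) : ℂ) * Wm u y)) := by
        rw [integral_sub (integrable_heat_mul ha _ x) ((integrable_heat_mul ha _ x).const_mul s),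
          integral_const_mul]
        push_cast
        ring
      rw [this, Complex.re_ofReal_mul, Complex.ofReal_re]
      congr 1
      have hsub : Integrable fun y => (heat a (x - y) : ℂ) * Wm v y -
          s * ((heat a (x - y) : ℂ) * Wm u y) :=
        (integrable_heat_mul ha _ x).sub ((integrable_heat_mul ha _ x).const_mul s)
      rw [re_integral hsub]
      refine integral_congr_ae ?_
      filter_upwards [hWa v, hWa u, hv] with y g1 g2 g3
      rw [g1, g2, g3]
      have e : (heat a (x - y) : ℂ) * ((W y : ℂ) * (‖u y‖ : ℂ)) -
          s * ((heat a (x - y) : ℂ) * ((W y : ℂ) * u y)) =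
          ((heat a (x - y) * W y : ℝ) : ℂ) * (((‖u y‖ : ℝ) : ℂ) - s * u y) := by
        push_cast; ring
      rw [e, Complex.re_ofReal_mul, Complex.sub_re, Complex.ofReal_re]
      ring
    · exact ((integrable_inner (Wm ψ) (heatOp a (Wm v))).sub
        (integrable_inner (Wm χ) (heatOp a (Wm u)))).re
    · have := integral_re ((integrable_inner (Wm ψ) (heatOp a (Wm v))).sub
        (integrable_inner (Wm χ) (heatOp a (Wm u))))
      simp only [RCLike.re_eq_complex_re, Pi.sub_apply] at this
      rw [this, integral_sub (integrable_inner _ _) (integrable_inner _ _), inner_eq_integral,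
        inner_eq_integral]
  have hsle : ∀ x y : E3, (conj (u x / (‖u x‖ : ℂ)) * u y).re ≤ ‖u y‖ := by
    intro x y
    refine (Complex.re_le_norm _).trans ?_
    rw [norm_mul, RCLike.norm_conj, norm_div, Complex.norm_real, norm_norm]
    exact mul_le_of_le_one_left (norm_nonneg _) (div_self_le_one _)
  have hnn : ∀ a, 0 < a → ∀ x, 0 ≤ ∫ y, heat a (x - y) * (W y *
      (‖u y‖ - (conj (u x / (‖u x‖ : ℂ)) * u y).re)) := by
    intro a ha x
    refine integral_nonneg_of_ae ?_
    filter_upwards [hW] with y hy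
    have := hsle x y
    exact mul_nonneg (heat_pos ha _).le (mul_nonneg hy.le (by linarith))
  have hnn' : ∀ a, 0 < a →
      0 ≤ (inner ℂ (Wm ψ) (heatOp a (Wm v)) - inner ℂ (Wm χ) (heatOp a (Wm u))).re := by
    intro a ha
    obtain ⟨Φ, h1, h2, h3⟩ := hpt a ha
    rw [h3]
    refine integral_nonneg_of_ae ?_
    filter_upwards [h1, hW, hψpos] with x g1 g2 g3
    rw [g1]
    exact mul_nonneg (mul_nonneg g2.le g3.1.le) (hnn a ha x)
  -- some time at which the two forms agree
  obtain ⟨a, ha, ha0⟩ : ∃ a, 0 < a ∧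
      (inner ℂ (Wm ψ) (heatOp a (Wm v)) - inner ℂ (Wm χ) (heatOp a (Wm u))).re = 0 := by
    have hI := (hA.1.sub hB.1).re
    have h0 : ∫ a in Set.Ioi (0 : ℝ), RCLike.re (((2 * (a * Real.exp (-(c * a ^ 2))) : ℝ) : ℂ) *
        inner ℂ (Wm ψ) (heatOp a (Wm v)) - ((2 * (a * Real.exp (-(c * a ^ 2))) : ℝ) : ℂ) *
        inner ℂ (Wm χ) (heatOp a (Wm u))) = 0 := by
      have := integral_re (hA.1.sub hB.1)
      simp only [Pi.sub_apply] at this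
      rw [this, integral_sub hA.1 hB.1, hA.2, hB.2, key, sub_self, map_zero]
    have h1 := (integral_eq_zero_iff_of_nonneg_ae ?_ hI).1 h0
    · have hne : (ae (volume.restrict (Set.Ioi (0 : ℝ)))).NeBot := by
        rw [ae_neBot, Ne, Measure.restrict_eq_zero]
        simp
      obtain ⟨a, h2, ha⟩ := (h1.and (ae_restrict_mem measurableSet_Ioi)).exists
      have ha : 0 < a := ha
      refine ⟨a, ha, ?_⟩
      simp only [Pi.sub_apply, Pi.zero_apply] at h2
      rw [← mul_sub, RCLike.re_eq_complex_re, Complex.re_ofReal_mul, mul_eq_zero] at h2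
      exact h2.resolve_left (by positivity)
    · filter_upwards [ae_restrict_mem measurableSet_Ioi] with a ha
      have ha : 0 < a := ha
      simp only [Pi.sub_apply, Pi.zero_apply]
      rw [← mul_sub, RCLike.re_eq_complex_re, Complex.re_ofReal_mul]
      exact mul_nonneg (by positivity) (hnn' a ha)
  obtain ⟨Φ, h1, h2, h3⟩ := hpt a ha
  rw [ha0] at h3
  have h4 := (integral_eq_zero_iff_of_nonneg_ae (by
    filter_upwards [h1, hW, hψpos] with x g1 g2 g3
    rw [g1]
    exact mul_nonneg (mul_nonneg g2.le g3.1.le) (hnn a ha x)) h2).1 h3.symm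
  -- One good point `x` is enough: since the heat kernel and `W` are positive, `Re (s u(y)) =
  -- |u(y)|` for almost every `y`, with the single phase factor `s` taken from `x`.
  obtain ⟨x, g1, g2, g3, g4⟩ := (h1.and (hW.and (hψpos.and h4))).exists
  rw [g4, Pi.zero_apply, eq_comm, mul_eq_zero] at g1
  have g5 := g1.resolve_left (mul_pos g2 g3.1).ne'
  set s := conj (u x / (‖u x‖ : ℂ)) with hs
  have hint : Integrable (fun y => heat a (x - y) * (W y * (‖u y‖ - (s * u y).re))) := by
    refine (((integrable_heat_mul ha (Wm v) x).sub
        ((integrable_heat_mul ha (Wm u) x).const_mul s)).re).congr ?_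
    filter_upwards [hWa v, hWa u, hv] with y k1 k2 k3
    rw [RCLike.re_eq_complex_re, Pi.sub_apply, k1, k2, k3]
    have e : (heat a (x - y) : ℂ) * ((W y : ℂ) * (‖u y‖ : ℂ)) -
        s * ((heat a (x - y) : ℂ) * ((W y : ℂ) * u y)) =
        ((heat a (x - y) * W y : ℝ) : ℂ) * (((‖u y‖ : ℝ) : ℂ) - s * u y) := by
      push_cast; ring
    rw [e, Complex.re_ofReal_mul, Complex.sub_re, Complex.ofReal_re]
    ring
  have g6 := (integral_eq_zero_iff_of_nonneg_ae (by
    filter_upwards [hW] with y hy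
    have := hsle x y
    exact mul_nonneg (heat_pos ha _).le (mul_nonneg hy.le (by linarith))) hint).1 g5
  -- now `‖u‖ = re (s u)`
  have g7 : ∫ y, (ψ y).re * ‖u y‖ = 0 := by
    have : ∫ y, (ψ y).re * ‖u y‖ = (s * inner ℂ ψ u).re := by
      rw [inner_eq_integral, ← integral_const_mul, ← RCLike.re_eq_complex_re,
        ← integral_re ((integrable_inner ψ u).const_mul s)]
      refine integral_congr_ae ?_
      filter_upwards [g6, hW, hψpos] with y k1 k2 k3
      have hr : ψ y = ((ψ y).re : ℂ) := by
        apply Complex.ext <;> simp [k3.2]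
      have k4 : ‖u y‖ - (s * u y).re = 0 := by
        have := (mul_eq_zero.1 k1).resolve_left (heat_pos ha _).ne'
        exact (mul_eq_zero.1 this).resolve_left k2.ne'
      rw [RCLike.re_eq_complex_re, hr, Complex.conj_ofReal, ← mul_assoc, mul_comm _ ((_ : ℝ) : ℂ),
        Complex.re_ofReal_mul, ← sub_eq_zero.1 k4, Complex.ofReal_re]
    rw [this, hort, mul_zero, Complex.zero_re]
  have hint2 : Integrable (fun y => (ψ y).re * ‖u y‖) := by
    refine (integrable_inner ψ v).re.congr ?_
    filter_upwards [hv, hψpos] with y k1 k3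
    have hr : ψ y = ((ψ y).re : ℂ) := by
      apply Complex.ext <;> simp [k3.2]
    rw [k1, RCLike.re_eq_complex_re, hr, Complex.conj_ofReal, Complex.re_ofReal_mul]
    simp [mul_comm]
  have g8 := (integral_eq_zero_iff_of_nonneg_ae (by
    filter_upwards [hψpos] with y hy
    exact mul_nonneg hy.1.le (norm_nonneg _)) hint2).1 g7
  refine Lp.ext ?_
  filter_upwards [g8, hψpos, Lp.coeFn_zero ℂ 2 (volume : Measure E3)] with y k1 k2 k3
  rw [k3]
  have := (mul_eq_zero.1 k1).resolve_left k2.1.ne'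
  simpa using this

/-! ### Hilbert-Schmidt operators -/

/-- The conjugate of a square integrable symbol times the character `exp (2πi ξ·x)`. -/
def charLp {m : E3 → ℂ} (h : MemLp m 2 (volume : Measure E3)) (x : E3) : L2 :=
  (memLp_conj (memLp_char_mul h x)).toLp _

theorem coeFn_charLp {m : E3 → ℂ} (h : MemLp m 2 (volume : Measure E3)) (x : E3) :
    charLp h x =ᵐ[volume] fun ξ =>
      conj (Complex.exp (↑(2 * Real.pi * inner ℝ ξ x) * Complex.I) * m ξ) :=
  MemLp.coeFn_toLp _

theorem norm_charLp {m : E3 → ℂ} (h : MemLp m 2 (volume : Measure E3)) (x : E3) :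
    ‖charLp h x‖ = ‖h.toLp m‖ := by
  have e : ∀ᵐ ξ, ‖charLp h x ξ‖ = ‖h.toLp m ξ‖ := by
    filter_upwards [coeFn_charLp h x, h.coeFn_toLp] with ξ h1 h2
    rw [h1, h2, RCLike.norm_conj, norm_mul, Complex.norm_exp_ofReal_mul_I, one_mul]
  refine le_antisymm ?_ ?_
  · exact Lp.norm_le_norm_of_ae_le (e.mono fun _ => le_of_eq)
  · exact Lp.norm_le_norm_of_ae_le (e.mono fun _ h => h.ge)

theorem fourierInv_mul_eq_inner {m : E3 → ℂ} (h : MemLp m 2 (volume : Measure E3)) (g : L2)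
    (x : E3) : 𝓕⁻ (fun ξ => m ξ * g ξ) x = inner ℂ (charLp h x) g := by
  rw [inner_eq_integral, Real.fourierInv_eq']
  refine integral_congr_ae ?_
  filter_upwards [coeFn_charLp h x] with ξ h1
  rw [h1, Complex.conj_conj, smul_eq_mul]
  ring

theorem integrable_mul_of_memLp_two {m : E3 → ℂ} (h : MemLp m 2 (volume : Measure E3)) (g : L2) :
    Integrable (fun ξ => m ξ * g ξ) := by
  rw [← memLp_one_iff_integrable]
  exact (Lp.memLp g).mul h (r := 1)

theorem F2_symm_ae_eq_inner {m : E3 → ℂ} (h : MemLp m 2 (volume : Measure E3)) {g f : L2}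
    (hf : f =ᵐ[volume] fun ξ => m ξ * g ξ) :
    F2.symm f =ᵐ[volume] fun x => inner ℂ (charLp h x) g := by
  have hi : Integrable f := (integrable_mul_of_memLp_two h g).congr hf.symm
  filter_upwards [F2_symm_ae_eq_fourierInv hi] with x hx
  rw [hx, ← fourierInv_mul_eq_inner, Real.fourierInv_eq', Real.fourierInv_eq']
  refine integral_congr_ae ?_
  filter_upwards [hf] with ξ h1
  rw [h1]

theorem fmul_ae_eq_inner {m : E3 → ℂ} (h : MemLp m 2 (volume : Measure E3))
    (h' : MemLp m ∞ (volume : Measure E3)) (f : L2) :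
    fmul m f =ᵐ[volume] fun x => inner ℂ (charLp h x) (F2 f) :=
  F2_symm_ae_eq_inner h (coeFn_mulOp h' (F2 f))

/-- Hilbert-Schmidt operators are compact. -/
theorem isCompactOperator_of_kernel {A : L2 →L[ℂ] L2} {N : E3 → L2} {b : E3 → ℝ}
    (hb : MemLp b 2 (volume : Measure E3)) (hN : ∀ x, ‖N x‖ ≤ b x)
    (hA : ∀ f, A f =ᵐ[volume] fun x => inner ℂ (N x) f) : IsCompactOperator A := by
  obtain ⟨w, e, -⟩ := exists_hilbertBasis ℂ L2
  have hb2 : Integrable (fun x => b x ^ 2) := by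
    have := (memLp_two_iff_integrable_sq hb.1).1 hb
    exact this
  -- Bessel's inequality for the vector `N x`, integrated over `x`.
  have hfin : ∀ s : Finset w, ∑ i ∈ s, ‖A (e i)‖ ^ 2 ≤ ∫ x, b x ^ 2 := by
    intro s
    have h1 : ∑ i ∈ s, ‖A (e i)‖ ^ 2 = ∫ x, ∑ i ∈ s, ‖A (e i) x‖ ^ 2 := by
      rw [integral_finsetSum _ fun i _ => integrable_norm_sq _]
      exact Finset.sum_congr rfl fun i _ => norm_sq_eq_integral _
    rw [h1]
    refine integral_mono_ae (integrable_finsetSum _ fun i _ => integrable_norm_sq _) hb2 ?_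
    have h2 : ∀ᵐ x, ∀ i ∈ s, A (e i) x = inner ℂ (N x) (e i) :=
      (Finset.eventually_all s).2 fun i _ => hA (e i)
    filter_upwards [h2] with x hx
    calc ∑ i ∈ s, ‖A (e i) x‖ ^ 2 = ∑ i ∈ s, ‖inner ℂ (e i) (N x)‖ ^ 2 :=
          Finset.sum_congr rfl fun i hi => by rw [hx i hi, norm_inner_symm]
      _ ≤ ‖N x‖ ^ 2 := e.orthonormal.sum_inner_products_le (N x)
      _ ≤ b x ^ 2 := by
          have := hN x
          gcongr
  have hsum : Summable fun i : w => ‖A (e i)‖ ^ 2 :=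
    summable_of_sum_le (fun i => by positivity) hfin
  -- finite rank approximations
  set P : Finset w → (L2 →L[ℂ] L2) := fun s =>
    ∑ i ∈ s, (innerSL ℂ (e i)).smulRight (A (e i)) with hP
  have hPc : ∀ s, IsCompactOperator (P s) := by
    intro s
    have : IsCompactOperator (⇑(∑ i ∈ s, (innerSL ℂ (e i)).smulRight (A (e i)))) := by
      induction s using Finset.cons_induction with
      | empty => simpa using isCompactOperator_zero
      | cons i s hi ih =>
        rw [Finset.sum_cons]
        refine IsCompactOperator.add ?_ ih
        have h1 : ⇑((innerSL ℂ (e i)).smulRight (A (e i))) =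
            ⇑(ContinuousLinearMap.toSpanSingleton ℂ (A (e i))) ∘ ⇑(innerSL ℂ (e i)) := by
          ext1 f; simp [ContinuousLinearMap.smulRight_apply]
        change IsCompactOperator ⇑((innerSL ℂ (e i)).smulRight (A (e i)))
        rw [h1]
        exact (isCompactOperator_of_locallyCompactSpace_dom (innerSL ℂ (e i))).clm_comp _
    exact this
  have hlim : Tendsto P atTop (𝓝 A) := by
    rw [tendsto_iff_norm_sub_tendsto_zero]
    have htail := tendsto_tsum_compl_atTop_zero fun i : w => ‖A (e i)‖ ^ 2
    have hsq : Tendsto (fun s : Finset w => Real.sqrt (∑' i : {i // i ∉ s}, ‖A (e i)‖ ^ 2)) atTop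
        (𝓝 0) := by
      have := (Real.continuous_sqrt.tendsto 0).comp htail
      rwa [Real.sqrt_zero] at this
    refine squeeze_zero (fun _ => norm_nonneg _) (fun s => ?_) hsq
    rw [norm_sub_rev]
    refine ContinuousLinearMap.opNorm_le_bound _ (Real.sqrt_nonneg _) fun f => ?_
    have h1 : HasSum (fun i => inner ℂ (e i) f • A (e i)) (A f) := by
      have := (e.hasSum_repr f).mapL A
      simpa [e.repr_apply_apply] using this
    -- Subtracting `P s` removes the terms in `s`; Cauchy-Schwarz bounds the rest by `‖f‖` times the
    -- square root of the tail of `∑ ‖A (e i)‖²`, so the finite rank operators converge in norm.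
    have h2 : Tendsto (fun t : Finset w => ∑ i ∈ t, inner ℂ (e i) f • A (e i) -
        ∑ i ∈ s, inner ℂ (e i) f • A (e i)) atTop (𝓝 ((A - P s) f)) := by
      have : (A - P s) f = A f - ∑ i ∈ s, inner ℂ (e i) f • A (e i) := by
        simp [hP, ContinuousLinearMap.sum_apply]
      rw [this]
      exact h1.sub_const _
    refine le_of_tendsto h2.norm ?_
    filter_upwards [eventually_ge_atTop s] with t ht
    classical
    rw [← Finset.sum_sdiff ht, add_sub_cancel_right]
    have h3 : ∑ i ∈ t \ s, ‖A (e i)‖ ^ 2 ≤ ∑' i : {i // i ∉ s}, ‖A (e i)‖ ^ 2 := by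
      have hs2 : Summable fun i : {i // i ∉ s} => ‖A (e i)‖ ^ 2 := hsum.subtype _
      have := hs2.sum_le_tsum ((t \ s).subtype (fun i => i ∉ s)) (fun i _ => by positivity)
      rw [Finset.sum_subtype_of_mem (f := fun i : w => ‖A (e i)‖ ^ 2)
        (fun x hx => (Finset.mem_sdiff.1 hx).2)] at this
      exact this
    have h4 : ∑ i ∈ t \ s, ‖inner ℂ (e i) f‖ ^ 2 ≤ ‖f‖ ^ 2 :=
      e.orthonormal.sum_inner_products_le f
    calc ‖∑ i ∈ t \ s, inner ℂ (e i) f • A (e i)‖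
        ≤ ∑ i ∈ t \ s, ‖inner ℂ (e i) f‖ * ‖A (e i)‖ :=
          (norm_sum_le _ _).trans (le_of_eq (Finset.sum_congr rfl fun i _ => norm_smul _ _))
      _ ≤ Real.sqrt (∑ i ∈ t \ s, ‖inner ℂ (e i) f‖ ^ 2) *
            Real.sqrt (∑ i ∈ t \ s, ‖A (e i)‖ ^ 2) := Real.sum_mul_le_sqrt_mul_sqrt _ _ _
      _ ≤ ‖f‖ * Real.sqrt (∑' i : {i // i ∉ s}, ‖A (e i)‖ ^ 2) := by
          refine mul_le_mul ?_ (Real.sqrt_le_sqrt h3) (Real.sqrt_nonneg _) (norm_nonneg _)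
          exact Real.sqrt_le_iff.2 ⟨norm_nonneg _, h4⟩
      _ = _ := mul_comm _ _
  exact isCompactOperator_of_tendsto hlim (Eventually.of_forall hPc)

/-- The kernel is `a(x)` times a translate of the inverse transform of `m`; its norm in the second
variable is `|a(x)| ‖m‖₂`, which is square integrable. -/
theorem isCompactOperator_mulOp_comp_fmul {a m : E3 → ℂ} (ha : MemLp a 2 (volume : Measure E3))
    (ha' : MemLp a ∞ (volume : Measure E3)) (hm : MemLp m 2 (volume : Measure E3))
    (hm' : MemLp m ∞ (volume : Measure E3)) : IsCompactOperator (mulOp a ∘L fmul m) := by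
  refine isCompactOperator_of_kernel (b := fun x => ‖a x‖ * ‖hm.toLp m‖)
    (N := fun x => conj (a x) • F2.symm (charLp hm x)) (ha.norm.mul_const _) (fun x => ?_)
    (fun f => ?_)
  · rw [norm_smul, RCLike.norm_conj, F2.symm.norm_map, norm_charLp]
  · filter_upwards [coeFn_mulOp ha' (fmul m f), fmul_ae_eq_inner hm hm' f] with x h1 h2
    rw [ContinuousLinearMap.comp_apply, h1, h2, inner_smul_left, Complex.conj_conj,
      ← inner_F2 (F2.symm _) f, F2.apply_symm_apply]

theorem norm_mulOp_fmul_le {a m : E3 → ℂ} (ha : MemLp a 2 (volume : Measure E3))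
    (ha' : MemLp a ∞ (volume : Measure E3)) (hm : MemLp m 2 (volume : Measure E3))
    (hm' : MemLp m ∞ (volume : Measure E3)) (f : L2) :
    ‖mulOp a (fmul m f)‖ ≤ ‖ha.toLp a‖ * ‖hm.toLp m‖ * ‖f‖ := by
  have h : ∀ᵐ x, ‖mulOp a (fmul m f) x‖ ≤ (‖hm.toLp m‖ * ‖f‖) * ‖ha.toLp a x‖ := by
    filter_upwards [coeFn_mulOp ha' (fmul m f), fmul_ae_eq_inner hm hm' f, ha.coeFn_toLp]
      with x h1 h2 h3
    rw [h1, h2, h3, norm_mul, mul_comm]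
    gcongr
    refine (norm_inner_le_norm _ _).trans ?_
    rw [norm_charLp, F2.norm_map]
  refine (norm_toLp_le_of_bound (by positivity) h).trans (le_of_eq ?_)
  ring

/-! ### Form bounds for square integrable and Coulomb potentials -/

/-- The symbol of the resolvent is square integrable in three dimensions. -/
theorem memLp_two_inv_lsym {c : ℝ} (hc : 0 < c) :
    MemLp (fun ξ => (((lsym ξ + c)⁻¹ : ℝ) : ℂ)) 2 (volume : Measure E3) := by
  have hm : Continuous fun ξ => (((lsym ξ + c)⁻¹ : ℝ) : ℂ) := by
    refine Complex.continuous_ofReal.comp (Continuous.inv₀ (by have := continuous_lsym; fun_prop)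
      fun ξ => ?_)
    have := lsym_nonneg ξ
    positivity
  rw [memLp_two_iff_integrable_sq_norm hm.aestronglyMeasurable]
  have h1 := integrable_rpow_neg_one_add_norm_sq (E := E3) (μ := volume) (r := 4)
    (by rw [finrank_euclideanSpace_fin]; norm_num)
  refine (h1.const_mul ((1 + c⁻¹) ^ 2)).mono' (hm.norm.pow 2).aestronglyMeasurable
    (Eventually.of_forall fun ξ => ?_)
  have h0 := lsym_nonneg ξ
  have h2 := div_lsym_add_le hc ξ
  have h3 : (lsym ξ + c)⁻¹ ≤ (1 + c⁻¹) * (1 + ‖ξ‖ ^ 2)⁻¹ := by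
    rw [div_eq_mul_inv] at h2
    rw [← div_eq_mul_inv, le_div_iff₀ (by positivity), mul_comm]
    exact h2
  rw [Real.norm_eq_abs, abs_of_nonneg (by positivity), Complex.norm_real, Real.norm_eq_abs,
    abs_of_nonneg (by positivity), show (-(4 : ℝ) / 2) = -((2 : ℕ) : ℝ) by norm_num,
    Real.rpow_neg (by positivity), Real.rpow_natCast, ← inv_pow, ← mul_pow]
  gcongr

theorem memLp_top_inv_lsym {c : ℝ} (hc : 0 < c) :
    MemLp (fun ξ => (((lsym ξ + c)⁻¹ : ℝ) : ℂ)) ∞ (volume : Measure E3) := by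
  have := (memLp_rsym hc).mul (r := ∞) (memLp_rsym hc)
  refine this.ae_eq (Eventually.of_forall fun ξ => ?_)
  simp only [Pi.mul_apply]
  rw [← Complex.ofReal_mul, ← sq, rsym_sq hc]

theorem gRes_eq_fmul {c : ℝ} (hc : 0 < c) :
    gRes c = fmul fun ξ => (((lsym ξ + c)⁻¹ : ℝ) : ℂ) := by
  ext1 f
  apply eq_of_F2_ae
  rw [F2_fmul]
  filter_upwards [F2_gRes hc f, coeFn_mulOp (memLp_top_inv_lsym hc) (F2 f)] with ξ h1 h2
  rw [h1, h2]
  push_cast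
  rfl

/-- `‖(-Δ + c)^{-1}‖` as an operator from `L²` to `L^∞`. -/
def resNorm (c : ℝ) : ℝ :=
  open Classical in if hc : 0 < c then ‖(memLp_two_inv_lsym hc).toLp‖ else 0

theorem resNorm_nonneg (c : ℝ) : 0 ≤ resNorm c := by
  unfold resNorm
  split_ifs <;> positivity

theorem ae_norm_gRes_le {c : ℝ} (hc : 0 < c) (f : L2) :
    ∀ᵐ x, ‖gRes c f x‖ ≤ resNorm c * ‖f‖ := by
  rw [gRes_eq_fmul hc]
  filter_upwards [fmul_ae_eq_inner (memLp_two_inv_lsym hc) (memLp_top_inv_lsym hc) f] with x h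
  rw [h]
  refine (norm_inner_le_norm _ _).trans ?_
  rw [norm_charLp, F2.norm_map]
  unfold resNorm
  rw [dif_pos hc]

/-- `a b` and `b a` have the same nonzero spectrum, and the norm of a self-adjoint element is its
spectral radius. This replaces interpolation when a bound on `w (-Δ + c)⁻¹` has to be symmetrized.
-/
theorem norm_le_of_isSelfAdjoint_mul {A : Type*} [CStarAlgebra A] {a b : A}
    (h : IsSelfAdjoint (a * b)) : ‖a * b‖ ≤ ‖b * a‖ := by
  nontriviality A
  have h1 : spectralRadius ℂ (a * b) ≤ ‖b * a‖₊ := by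
    refine iSup₂_le fun k hk => ?_
    by_cases h0 : k = 0
    · simp [h0]
    · have h2 : k ∈ spectrum ℂ (b * a) \ {0} := by
        rw [← spectrum.nonzero_mul_comm]
        exact ⟨hk, h0⟩
      exact_mod_cast spectrum.norm_le_norm_of_mem h2.1
  rw [h.spectralRadius_eq_nnnorm] at h1
  exact_mod_cast h1

theorem isSymmetric_gHalf_mulOp {c : ℝ} (hc : 0 < c) {w : E3 → ℝ}
    (hw : MemLp (fun x => (w x : ℂ)) ∞ (volume : Measure E3)) (f g : L2) :
    inner ℂ (gHalf c (mulOp (fun x => (w x : ℂ)) (gHalf c f))) g =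
      inner ℂ f (gHalf c (mulOp (fun x => (w x : ℂ)) (gHalf c g))) := by
  rw [inner_gHalf_left hc, inner_mulOp_left hw, ← inner_gHalf_left hc]
  simp

theorem re_inner_mulOp {w : E3 → ℝ} (hw : MemLp (fun x => (w x : ℂ)) ∞ (volume : Measure E3))
    (f : L2) : inner ℂ f (mulOp (fun x => (w x : ℂ)) f) = ((∫ x, w x * ‖f x‖ ^ 2 : ℝ) : ℂ) := by
  rw [inner_eq_integral, ← integral_complex_ofReal]
  refine integral_congr_ae ?_
  filter_upwards [coeFn_mulOp hw f] with x h
  rw [h, mul_assoc, Complex.mul_conj, Complex.normSq_eq_norm_sq]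
  push_cast
  ring

theorem integrable_mul_norm_sq {w : E3 → ℝ}
    (hw : MemLp (fun x => (w x : ℂ)) ∞ (volume : Measure E3)) (f : L2) :
    Integrable fun x => w x * ‖f x‖ ^ 2 := by
  refine (integrable_inner f (mulOp (fun x => (w x : ℂ)) f)).re.congr ?_
  filter_upwards [coeFn_mulOp hw f] with x h
  rw [h, mul_assoc, Complex.mul_conj, Complex.normSq_eq_norm_sq, ← Complex.ofReal_mul]
  rfl

/-- With `a = (-Δ + c)^{-1/2}` and `b = w a`, the product `b a = w (-Δ + c)⁻¹` is bounded since the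
resolvent maps `L²` to `L^∞`; the form in question is that of the self-adjoint operator `a b`. -/
theorem integral_mul_gHalf_sq_le {c : ℝ} (hc : 0 < c) {w : E3 → ℝ}
    (hw : MemLp (fun x => (w x : ℂ)) ∞ (volume : Measure E3))
    (hw2 : MemLp (fun x => (w x : ℂ)) 2 (volume : Measure E3)) (f : L2) :
    ∫ x, w x * ‖gHalf c f x‖ ^ 2 ≤ ‖hw2.toLp _‖ * resNorm c * ‖f‖ ^ 2 := by
  set a : L2 →L[ℂ] L2 := gHalf c
  set b : L2 →L[ℂ] L2 := mulOp (fun x => (w x : ℂ)) ∘L gHalf c with hb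
  have hsa : IsSelfAdjoint (a * b) := by
    rw [ContinuousLinearMap.isSelfAdjoint_iff_isSymmetric]
    exact isSymmetric_gHalf_mulOp hc hw
  have h1 : ‖a * b‖ ≤ ‖hw2.toLp _‖ * resNorm c := by
    refine (norm_le_of_isSelfAdjoint_mul hsa).trans ?_
    refine ContinuousLinearMap.opNorm_le_bound _ (mul_nonneg (norm_nonneg _) (resNorm_nonneg c))
      fun g => ?_
    change ‖mulOp (fun x => (w x : ℂ)) (gRes c g)‖ ≤ _
    rw [gRes_eq_fmul hc]
    refine (norm_mulOp_fmul_le hw2 hw (memLp_two_inv_lsym hc) (memLp_top_inv_lsym hc) g).trans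
      (le_of_eq ?_)
    unfold resNorm
    rw [dif_pos hc]
  have h2 : ((∫ x, w x * ‖gHalf c f x‖ ^ 2 : ℝ) : ℂ) = inner ℂ f ((a * b) f) := by
    rw [← re_inner_mulOp hw, inner_gHalf_left hc]
    rfl
  have h3 : ∫ x, w x * ‖gHalf c f x‖ ^ 2 = (inner ℂ f ((a * b) f)).re := by
    rw [← h2, Complex.ofReal_re]
  rw [h3]
  calc (inner ℂ f ((a * b) f)).re ≤ ‖inner ℂ f ((a * b) f)‖ := Complex.re_le_norm _
    _ ≤ ‖f‖ * ‖(a * b) f‖ := norm_inner_le_norm _ _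
    _ ≤ ‖f‖ * (‖hw2.toLp _‖ * resNorm c * ‖f‖) := by
        gcongr
        exact ((a * b).le_opNorm f).trans (by gcongr)
    _ = _ := by ring

/-- A square integrable potential is form bounded. -/
theorem lintegral_mul_gHalf_sq_le {c : ℝ} (hc : 0 < c) {w : E3 → ℝ} (h0 : ∀ x, 0 ≤ w x)
    (hw2 : MemLp (fun x => (w x : ℂ)) 2 (volume : Measure E3)) (f : L2) :
    ∫⁻ x, ENNReal.ofReal (w x) * ‖gHalf c f x‖ₑ ^ 2 ≤
      ENNReal.ofReal (‖hw2.toLp _‖ * resNorm c * ‖f‖ ^ 2) := by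
  have hwm : AEMeasurable w volume := by
    have := hw2.1.aemeasurable
    exact (Complex.measurable_re.comp_aemeasurable this)
  -- The bound for bounded potentials depends only on the `L²` norm, so it holds uniformly for the
  -- truncations `min (w x) n` and survives monotone convergence.
  have hle : ∀ n : ℕ, ∫⁻ x, ENNReal.ofReal (min (w x) n) * ‖gHalf c f x‖ₑ ^ 2 ≤
      ENNReal.ofReal (‖hw2.toLp _‖ * resNorm c * ‖f‖ ^ 2) := by
    intro n
    have hmin0 : ∀ x, 0 ≤ min (w x) n := fun x => le_min (h0 x) (by positivity)
    have hmm : AEStronglyMeasurable (fun x => ((min (w x) n : ℝ) : ℂ)) volume :=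
      (Complex.measurable_ofReal.comp_aemeasurable
        (hwm.min aemeasurable_const)).aestronglyMeasurable
    have hn1 : MemLp (fun x => ((min (w x) n : ℝ) : ℂ)) ∞ (volume : Measure E3) :=
      memLp_top_of_bound hmm n (Eventually.of_forall fun x => by
        rw [Complex.norm_real, Real.norm_eq_abs, abs_of_nonneg (hmin0 x)]; exact min_le_right _ _)
    have hle : ∀ x, ‖((min (w x) n : ℝ) : ℂ)‖ ≤ ‖(w x : ℂ)‖ := fun x => by
      rw [Complex.norm_real, Complex.norm_real, Real.norm_eq_abs, Real.norm_eq_abs,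
        abs_of_nonneg (hmin0 x), abs_of_nonneg (h0 x)]
      exact min_le_left _ _
    have hn2 : MemLp (fun x => ((min (w x) n : ℝ) : ℂ)) 2 (volume : Measure E3) :=
      hw2.of_le hmm (Eventually.of_forall hle)
    have h1 := integral_mul_gHalf_sq_le hc hn1 hn2 f
    have h2 : ‖hn2.toLp _‖ ≤ ‖hw2.toLp _‖ := by
      refine Lp.norm_le_norm_of_ae_le ?_
      filter_upwards [hn2.coeFn_toLp, hw2.coeFn_toLp] with x h3 h4
      rw [h3, h4]
      exact hle x
    have h3 : ∫⁻ x, ENNReal.ofReal (min (w x) n) * ‖gHalf c f x‖ₑ ^ 2 =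
        ENNReal.ofReal (∫ x, min (w x) n * ‖gHalf c f x‖ ^ 2) := by
      rw [ofReal_integral_eq_lintegral_ofReal (integrable_mul_norm_sq hn1 _)
        (Eventually.of_forall fun x => mul_nonneg (hmin0 x) (by positivity))]
      refine lintegral_congr fun x => ?_
      rw [ENNReal.ofReal_mul (hmin0 x), ENNReal.ofReal_pow (norm_nonneg _), ofReal_norm]
    rw [h3]
    refine ENNReal.ofReal_le_ofReal (h1.trans ?_)
    have := resNorm_nonneg c
    gcongr
  have hmono : Tendsto (fun n : ℕ => ∫⁻ x, ENNReal.ofReal (min (w x) n) * ‖gHalf c f x‖ₑ ^ 2) atTop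
      (𝓝 (∫⁻ x, ENNReal.ofReal (w x) * ‖gHalf c f x‖ₑ ^ 2)) := by
    refine lintegral_tendsto_of_tendsto_of_monotone (fun n => ?_) ?_ ?_
    · exact (hwm.min aemeasurable_const).ennreal_ofReal.mul
        ((Lp.aestronglyMeasurable _).enorm.pow_const 2)
    · refine Eventually.of_forall fun x n m h => ?_
      have : (n : ℝ) ≤ m := by exact_mod_cast h
      dsimp only
      gcongr
    · refine Eventually.of_forall fun x => ?_
      refine tendsto_const_nhds.congr' ?_
      filter_upwards [eventually_ge_atTop ⌈w x⌉₊] with n hn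
      have : w x ≤ n := (Nat.le_ceil _).trans (by exact_mod_cast hn)
      rw [min_eq_left this]
  exact le_of_tendsto' hmono hle

/-- The local part of the Coulomb potential. -/
def coulombLoc (x : E3) : ℝ := (Metric.ball (0 : E3) 1).indicator (fun x => ‖x‖⁻¹) x

theorem coulombLoc_nonneg (x : E3) : 0 ≤ coulombLoc x := by
  unfold coulombLoc
  exact Set.indicator_nonneg (fun _ _ => by positivity) x

theorem measurable_coulombLoc : Measurable coulombLoc := by
  unfold coulombLoc
  exact Measurable.indicator (by fun_prop) measurableSet_ball

theorem inv_norm_le (x : E3) : ‖x‖⁻¹ ≤ coulombLoc x + 1 := by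
  unfold coulombLoc
  by_cases h : x ∈ Metric.ball (0 : E3) 1
  · rw [Set.indicator_of_mem h]; linarith
  · rw [Set.indicator_of_notMem h, zero_add]
    rw [mem_ball_zero_iff, not_lt] at h
    exact inv_le_one_of_one_le₀ h

theorem integrableOn_ball_pow_inv {k : ℕ} (hk : k ≤ 2) :
    IntegrableOn (fun x : E3 => (‖x‖⁻¹) ^ k) (Metric.ball 0 1) := by
  refine (integrableOn_fun_norm_addHaar (volume : Measure E3) (f := fun r : ℝ => (r⁻¹) ^ k)).2 ?_
  rw [finrank_euclideanSpace_fin]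
  have : IntegrableOn (fun r : ℝ => r ^ (2 - k)) (Set.Ioo 0 1) :=
    (Continuous.integrableOn_Icc (a := 0) (b := 1) (by fun_prop)).mono_set Set.Ioo_subset_Icc_self
  refine this.congr_fun (fun r hr => ?_) measurableSet_Ioo
  have hr : r ≠ 0 := hr.1.ne'
  simp only [smul_eq_mul]
  rw [pow_sub₀ _ hr hk, inv_pow]

theorem memLp_coulombLoc : MemLp (fun x => (coulombLoc x : ℂ)) 2 (volume : Measure E3) := by
  have hm : Measurable fun x => (coulombLoc x : ℂ) :=
    Complex.measurable_ofReal.comp measurable_coulombLoc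
  rw [memLp_two_iff_integrable_sq_norm hm.aestronglyMeasurable]
  have := (integrable_indicator_iff measurableSet_ball).2 (integrableOn_ball_pow_inv (k := 2) le_rfl)
  refine this.congr (Eventually.of_forall fun x => ?_)
  simp only [Complex.norm_real, Real.norm_eq_abs, sq_abs]
  unfold coulombLoc
  by_cases h : x ∈ Metric.ball (0 : E3) 1
  · rw [Set.indicator_of_mem h, Set.indicator_of_mem h]
  · rw [Set.indicator_of_notMem h, Set.indicator_of_notMem h]; norm_num

theorem memLp_coulombLoc_sub (a : E3) :
    MemLp (fun x => (coulombLoc (a - x) : ℂ)) 2 (volume : Measure E3) :=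
  memLp_coulombLoc.comp_measurePreserving (Measure.measurePreserving_sub_left volume a)

theorem norm_coulombLoc_sub (a : E3) :
    ‖(memLp_coulombLoc_sub a).toLp _‖ = ‖memLp_coulombLoc.toLp _‖ := by
  rw [Lp.norm_toLp, Lp.norm_toLp]
  have := eLpNorm_comp_measurePreserving (p := 2) memLp_coulombLoc.1
    (Measure.measurePreserving_sub_left (volume : Measure E3) a)
  exact congrArg ENNReal.toReal this

theorem lintegral_enorm_sq (f : L2) : ∫⁻ x, ‖f x‖ₑ ^ 2 = ENNReal.ofReal (‖f‖ ^ 2) := by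
  rw [norm_sq_eq_integral, ofReal_integral_eq_lintegral_ofReal (integrable_norm_sq f)
    (Eventually.of_forall fun x => by positivity)]
  refine lintegral_congr fun x => ?_
  rw [ENNReal.ofReal_pow (norm_nonneg _), ofReal_norm]

/-- Uniform form bound for the Coulomb potential. -/
theorem exists_lintegral_newton_le : ∃ M : ℝ, 0 ≤ M ∧ ∀ (f : L2) (a : E3),
    ∫⁻ x, ENNReal.ofReal (newton (a - x)) * ‖gHalf 1 f x‖ₑ ^ 2 ≤ ENNReal.ofReal (M * ‖f‖ ^ 2) := by
  have hpi := Real.pi_pos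
  refine ⟨(4 * Real.pi)⁻¹ * (‖memLp_coulombLoc.toLp _‖ * resNorm 1 + 1), ?_, fun f a => ?_⟩
  · have := resNorm_nonneg 1
    positivity
  have h1 : ∀ x, ENNReal.ofReal (newton (a - x)) * ‖gHalf 1 f x‖ₑ ^ 2 ≤
      ENNReal.ofReal ((4 * Real.pi)⁻¹) * (ENNReal.ofReal (coulombLoc (a - x)) * ‖gHalf 1 f x‖ₑ ^ 2 +
        ‖gHalf 1 f x‖ₑ ^ 2) := by
    intro x
    have h2 : newton (a - x) ≤ (4 * Real.pi)⁻¹ * (coulombLoc (a - x) + 1) := by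
      have := inv_norm_le (a - x)
      unfold newton
      rw [one_div, mul_inv]
      gcongr
    have h3 : ENNReal.ofReal (newton (a - x)) ≤
        ENNReal.ofReal ((4 * Real.pi)⁻¹) * (ENNReal.ofReal (coulombLoc (a - x)) + 1) := by
      refine (ENNReal.ofReal_le_ofReal h2).trans (le_of_eq ?_)
      rw [ENNReal.ofReal_mul (by positivity), ENNReal.ofReal_add (coulombLoc_nonneg _) zero_le_one,
        ENNReal.ofReal_one]
    calc _ ≤ ENNReal.ofReal ((4 * Real.pi)⁻¹) * (ENNReal.ofReal (coulombLoc (a - x)) + 1) *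
          ‖gHalf 1 f x‖ₑ ^ 2 := by gcongr
      _ = _ := by rw [mul_assoc, add_mul, one_mul]
  have hmeas : AEMeasurable (fun x => ENNReal.ofReal (coulombLoc (a - x)) * ‖gHalf 1 f x‖ₑ ^ 2)
      volume :=
    (measurable_coulombLoc.comp (measurable_const.sub measurable_id)).ennreal_ofReal.aemeasurable.mul
      ((Lp.aestronglyMeasurable _).enorm.pow_const 2)
  refine (lintegral_mono h1).trans ?_
  rw [lintegral_const_mul' _ _ ENNReal.ofReal_ne_top, lintegral_add_left' hmeas,
    lintegral_enorm_sq]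
  have h4 := lintegral_mul_gHalf_sq_le one_pos (fun x => coulombLoc_nonneg (a - x))
    (memLp_coulombLoc_sub a) f
  rw [norm_coulombLoc_sub] at h4
  have h5 : ‖gHalf 1 f‖ ^ 2 ≤ ‖f‖ ^ 2 := by
    have := norm_gHalf_sq_le one_pos f
    linarith
  have := resNorm_nonneg 1
  calc _ ≤ ENNReal.ofReal ((4 * Real.pi)⁻¹) *
        (ENNReal.ofReal (‖memLp_coulombLoc.toLp _‖ * resNorm 1 * ‖f‖ ^ 2) +
          ENNReal.ofReal (‖f‖ ^ 2)) := by gcongr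
    _ = _ := by
        rw [← ENNReal.ofReal_add (by positivity) (by positivity),
          ← ENNReal.ofReal_mul (by positivity)]
        congr 1
        ring

/-! ### Coulomb energy and the Pekar potential -/

/-- The density `|u|²`. -/
def dens (u : L2) (x : E3) : ℝ≥0∞ := ‖u x‖ₑ ^ 2

/-- The Newton potential of `|u|²`. -/
def newtonPot (u : L2) (x : E3) : ℝ≥0∞ := ∫⁻ y, ENNReal.ofReal (newton (x - y)) * dens u y

/-- The Riesz potential of `|u|²`. -/
def rieszPot (u : L2) (z : E3) : ℝ≥0∞ := ∫⁻ y, ENNReal.ofReal (riesz (z - y)) * dens u y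

/-- The mutual Coulomb energy of `|u|²` and `|v|²`. -/
def coulomb (u v : L2) : ℝ≥0∞ := ∫⁻ x, dens u x * newtonPot v x

theorem measurable_dens (u : L2) : Measurable (dens u) :=
  (Lp.stronglyMeasurable u).measurable.enorm.pow_const 2

theorem dens_eq_ofReal (u : L2) (x : E3) : dens u x = ENNReal.ofReal (‖u x‖ ^ 2) := by
  unfold dens
  rw [ENNReal.ofReal_pow (norm_nonneg _), ofReal_norm]

theorem lintegral_dens (u : L2) : ∫⁻ x, dens u x = ENNReal.ofReal (‖u‖ ^ 2) :=
  lintegral_enorm_sq u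

theorem measurable_newtonPot_integrand (u : L2) :
    Measurable fun p : E3 × E3 => ENNReal.ofReal (newton (p.1 - p.2)) * dens u p.2 :=
  (measurable_newton.comp (measurable_fst.sub measurable_snd)).ennreal_ofReal.mul
    ((measurable_dens u).comp measurable_snd)

theorem measurable_rieszPot_integrand (u : L2) :
    Measurable fun p : E3 × E3 => ENNReal.ofReal (riesz (p.1 - p.2)) * dens u p.2 :=
  (measurable_riesz.comp (measurable_fst.sub measurable_snd)).ennreal_ofReal.mul
    ((measurable_dens u).comp measurable_snd)

theorem measurable_newtonPot (u : L2) : Measurable (newtonPot u) :=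
  (measurable_newtonPot_integrand u).lintegral_prod_right'

theorem measurable_rieszPot (u : L2) : Measurable (rieszPot u) :=
  (measurable_rieszPot_integrand u).lintegral_prod_right'

theorem lintegral_riesz_mul_rieszPot (u : L2) (x : E3) :
    ∫⁻ z, ENNReal.ofReal (riesz (x - z)) * rieszPot u z = newtonPot u x := by
  have hm : Measurable fun p : E3 × E3 => ENNReal.ofReal (riesz (x - p.1)) *
      (ENNReal.ofReal (riesz (p.1 - p.2)) * dens u p.2) :=
    ((measurable_riesz.comp (measurable_const.sub measurable_fst)).ennreal_ofReal).mul
      (measurable_rieszPot_integrand u)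
  have h1 : ∀ z, ENNReal.ofReal (riesz (x - z)) * rieszPot u z =
      ∫⁻ y, ENNReal.ofReal (riesz (x - z)) * (ENNReal.ofReal (riesz (z - y)) * dens u y) := by
    intro z
    rw [lintegral_const_mul' _ _ ENNReal.ofReal_ne_top]
    rfl
  simp_rw [h1]
  rw [lintegral_lintegral_swap hm.aemeasurable]
  unfold newtonPot
  have hx : ∀ᵐ y : E3, y ≠ x := by simp [ae_iff]
  refine lintegral_congr_ae ?_
  filter_upwards [hx] with y hy
  rw [← lintegral_riesz_mul_riesz hy.symm, ← lintegral_mul_const _ ?_]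
  · exact lintegral_congr fun z => by rw [mul_assoc]
  · exact ((measurable_riesz.comp (measurable_const.sub measurable_id)).ennreal_ofReal).mul
      ((measurable_riesz.comp (measurable_id.sub measurable_const)).ennreal_ofReal)

theorem measurable_riesz_sub (x : E3) : Measurable fun z => ENNReal.ofReal (riesz (x - z)) := by
  have h : Measurable fun z : E3 => x - z := by fun_prop
  exact (measurable_riesz.comp h).ennreal_ofReal

theorem measurable_riesz_sub_prod :
    Measurable fun p : E3 × E3 => ENNReal.ofReal (riesz (p.1 - p.2)) := by
  have h : Measurable fun p : E3 × E3 => p.1 - p.2 := by fun_prop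
  exact (measurable_riesz.comp h).ennreal_ofReal

/-- The composition formula splits the Newton kernel into two Riesz kernels, which exhibits the
Coulomb energy as an inner product. -/
theorem coulomb_eq (u v : L2) : coulomb u v = ∫⁻ z, rieszPot u z * rieszPot v z := by
  unfold coulomb
  have hm : Measurable fun p : E3 × E3 => dens u p.1 * (ENNReal.ofReal (riesz (p.1 - p.2)) *
      rieszPot v p.2) :=
    ((measurable_dens u).comp measurable_fst).mul
      (measurable_riesz_sub_prod.mul ((measurable_rieszPot v).comp measurable_snd))
  have h1 : ∀ x, dens u x * newtonPot v x =
      ∫⁻ z, dens u x * (ENNReal.ofReal (riesz (x - z)) * rieszPot v z) := by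
    intro x
    rw [← lintegral_riesz_mul_rieszPot]
    exact (lintegral_const_mul _ ((measurable_riesz_sub x).mul (measurable_rieszPot v))).symm
  simp_rw [h1]
  rw [lintegral_lintegral_swap hm.aemeasurable]
  refine lintegral_congr fun z => ?_
  have e : ∀ x, dens u x * (ENNReal.ofReal (riesz (x - z)) * rieszPot v z) =
      (ENNReal.ofReal (riesz (z - x)) * dens u x) * rieszPot v z := fun x => by
    rw [riesz_sub_comm z x]; ring
  simp_rw [e]
  exact lintegral_mul_const _ ((measurable_riesz_sub z).mul (measurable_dens u))

/-- Positivity of the Coulomb form, coming from `2ab ≤ a² + b²` for the Riesz potentials at each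
point. -/
theorem two_mul_coulomb_le (u v : L2) : 2 * coulomb u v ≤ coulomb u u + coulomb v v := by
  have h1 : Measurable fun z => rieszPot u z * rieszPot u z :=
    (measurable_rieszPot u).mul (measurable_rieszPot u)
  have h2 : Measurable fun z => rieszPot u z * rieszPot v z :=
    (measurable_rieszPot u).mul (measurable_rieszPot v)
  rw [coulomb_eq, coulomb_eq, coulomb_eq, ← lintegral_add_left h1, ← lintegral_const_mul _ h2]
  refine lintegral_mono fun z => ?_
  have : ∀ a b : ℝ≥0∞, 2 * (a * b) ≤ a * a + b * b := by
    intro a b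
    have key : ∀ a d : ℝ≥0∞, 2 * (a * (a + d)) ≤ a * a + (a + d) * (a + d) := by
      intro a d
      have : a * a + (a + d) * (a + d) = 2 * (a * (a + d)) + d * d := by ring
      rw [this]
      exact le_self_add
    rcases le_total a b with hab | hab
    · obtain ⟨d, rfl⟩ := exists_add_of_le hab
      exact key a d
    · obtain ⟨d, rfl⟩ := exists_add_of_le hab
      rw [mul_comm (b + d) b, add_comm ((b + d) * _)]
      exact key b d
  exact this _ _

/-- The constant in the form bound of the Coulomb potential. -/
theorem exists_newtonPot_le {u : L2} (hu : MemH1 u) : ∃ M : ℝ, 0 ≤ M ∧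
    ∀ x, newtonPot u x ≤ ENNReal.ofReal M := by
  obtain ⟨w, rfl⟩ := (memH1_iff one_pos u).1 hu
  obtain ⟨M, hM, h⟩ := exists_lintegral_newton_le
  exact ⟨M * ‖w‖ ^ 2, by positivity, fun x => h w x⟩

theorem newtonPot_ne_top {u : L2} (hu : MemH1 u) (x : E3) : newtonPot u x ≠ ∞ := by
  obtain ⟨M, -, h⟩ := exists_newtonPot_le hu
  exact ((h x).trans_lt ENNReal.ofReal_lt_top).ne

theorem coulomb_ne_top {v : L2} (hv : MemH1 v) (u : L2) : coulomb u v ≠ ∞ := by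
  obtain ⟨M, -, h⟩ := exists_newtonPot_le hv
  refine ((lintegral_mono fun x => mul_le_mul_right (h x) (dens u x)).trans_lt ?_).ne
  rw [lintegral_mul_const' _ _ ENNReal.ofReal_ne_top, lintegral_dens]
  exact ENNReal.mul_lt_top ENNReal.ofReal_lt_top ENNReal.ofReal_lt_top

theorem integral_newton_mul (u : L2) (x : E3) :
    ∫ y, newton (x - y) * ‖u y‖ ^ 2 = (newtonPot u x).toReal := by
  rw [integral_eq_lintegral_of_nonneg_ae
    (Eventually.of_forall fun y => mul_nonneg (newton_nonneg _) (by positivity))]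
  · unfold newtonPot
    congr 1
    refine lintegral_congr fun y => ?_
    rw [ENNReal.ofReal_mul (newton_nonneg _), dens_eq_ofReal]
  · exact (measurable_newton.comp (measurable_const.sub measurable_id)).aestronglyMeasurable.mul
      ((Lp.aestronglyMeasurable u).norm.pow 2)

theorem integral_newtonPot_mul {v : L2} (hv : MemH1 v) (u : L2) :
    ∫ x, (newtonPot v x).toReal * ‖u x‖ ^ 2 = (coulomb u v).toReal := by
  rw [integral_eq_lintegral_of_nonneg_ae
    (Eventually.of_forall fun y => mul_nonneg ENNReal.toReal_nonneg (by positivity))]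
  · unfold coulomb
    congr 1
    refine lintegral_congr fun y => ?_
    rw [ENNReal.ofReal_mul ENNReal.toReal_nonneg, ENNReal.ofReal_toReal (newtonPot_ne_top hv y),
      dens_eq_ofReal, mul_comm]
  · exact (measurable_newtonPot v).ennreal_toReal.aestronglyMeasurable.mul
      ((Lp.aestronglyMeasurable u).norm.pow 2)

theorem pekarFunctional_eq {u : L2} (hu : MemH1 u) :
    pekarFunctional u = (gradNormSq u).toReal - (coulomb u u).toReal := by
  unfold pekarFunctional
  congr 1
  rw [← integral_const_mul, ← integral_newtonPot_mul hu]
  refine integral_congr_ae (Eventually.of_forall fun x => ?_)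
  simp only
  rw [← integral_newton_mul, ← integral_const_mul, ← integral_mul_const]
  refine integral_congr_ae (Eventually.of_forall fun y => ?_)
  simp only [newton]
  rw [one_div, mul_inv]
  ring

theorem classicalField_eq (ψ : L2) (z : E3) : classicalField ψ z = (rieszPot ψ z).toReal := by
  unfold classicalField
  rw [← integral_neg, integral_eq_lintegral_of_nonneg_ae]
  · unfold rieszPot
    congr 1
    refine lintegral_congr fun y => ?_
    rw [formFactor_eq, dens_eq_ofReal, ← ENNReal.ofReal_mul (riesz_nonneg _), riesz_sub_comm]
    congr 1
    ring
  · refine Eventually.of_forall fun y => ?_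
    simp only [formFactor_eq, Pi.zero_apply]
    have := mul_nonneg (riesz_nonneg (y - z)) (sq_nonneg ‖ψ y‖)
    linarith
  · simp only [formFactor_eq]
    exact ((measurable_riesz.comp (measurable_id.sub measurable_const)).neg.aestronglyMeasurable.mul
      ((Lp.aestronglyMeasurable ψ).norm.pow 2)).neg

/-- The absolute value of the Pekar potential. -/
def pekarW (ψ : L2) (x : E3) : ℝ := 2 * (newtonPot ψ x).toReal

/-- The field is the Riesz potential of `|ψ|²`, and a second application of the Riesz kernel makes
it the Newton potential, so `V^φ` is attractive and bounded. -/
theorem pekarPotential_eq {ψ : L2} (hψ : MemH1 ψ) (x : E3) : pekarPotential ψ x = -pekarW ψ x := by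
  unfold pekarPotential polarizationPotential pekarW
  rw [← mul_neg, ← neg_neg (∫ y, _), ← integral_neg, integral_eq_lintegral_of_nonneg_ae]
  · congr 3
    rw [← lintegral_riesz_mul_rieszPot]
    have hfin : ∀ᵐ z, ENNReal.ofReal (riesz (x - z)) * rieszPot ψ z < ∞ := by
      refine ae_lt_top ((measurable_riesz.comp (measurable_const.sub
        measurable_id)).ennreal_ofReal.mul (measurable_rieszPot ψ)) ?_
      rw [lintegral_riesz_mul_rieszPot]
      exact newtonPot_ne_top hψ x
    have hx : ∀ᵐ z : E3, z ≠ x := by simp [ae_iff]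
    refine lintegral_congr_ae ?_
    filter_upwards [hfin, hx] with z h1 h2
    have h3 : ENNReal.ofReal (riesz (x - z)) ≠ 0 := by
      have : 0 < ‖x - z‖ := norm_pos_iff.2 (sub_ne_zero.2 h2.symm)
      rw [ne_eq, ENNReal.ofReal_eq_zero, not_le]
      unfold riesz
      positivity
    have h4 : rieszPot ψ z ≠ ∞ := by
      rintro h
      rw [h, ENNReal.mul_top h3] at h1
      exact lt_irrefl _ h1
    rw [classicalField_eq, formFactor_eq, mul_neg, neg_neg, mul_comm,
      ENNReal.ofReal_mul (riesz_nonneg _), ENNReal.ofReal_toReal h4]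
  · refine Eventually.of_forall fun y => ?_
    simp only [formFactor_eq, Pi.zero_apply, classicalField_eq]
    have := mul_nonneg (ENNReal.toReal_nonneg (a := rieszPot ψ y)) (riesz_nonneg (x - y))
    linarith
  · simp only [formFactor_eq, classicalField_eq]
    exact ((measurable_rieszPot ψ).ennreal_toReal.mul (measurable_riesz.comp
      (measurable_const.sub measurable_id)).neg).neg.aestronglyMeasurable

theorem measurable_pekarW (ψ : L2) : Measurable (pekarW ψ) :=
  (measurable_newtonPot ψ).ennreal_toReal.const_mul 2

theorem exists_pekarW_le {ψ : L2} (hψ : MemH1 ψ) : ∃ M : ℝ, 0 ≤ M ∧ ∀ x, pekarW ψ x ≤ M := by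
  obtain ⟨M, hM, h⟩ := exists_newtonPot_le hψ
  refine ⟨2 * M, by positivity, fun x => ?_⟩
  have := ENNReal.toReal_mono ENNReal.ofReal_ne_top (h x)
  rw [ENNReal.toReal_ofReal hM] at this
  unfold pekarW
  linarith

theorem pekarW_nonneg (ψ : L2) (x : E3) : 0 ≤ pekarW ψ x :=
  mul_nonneg two_pos.le ENNReal.toReal_nonneg

theorem memLp_pekarW {ψ : L2} (hψ : MemH1 ψ) :
    MemLp (fun x => (pekarW ψ x : ℂ)) ∞ (volume : Measure E3) := by
  obtain ⟨M, hM, h⟩ := exists_pekarW_le hψ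
  have hm : Measurable fun x => (pekarW ψ x : ℂ) :=
    Complex.measurable_ofReal.comp (measurable_pekarW ψ)
  refine memLp_top_of_bound hm.aestronglyMeasurable M (Eventually.of_forall fun x => ?_)
  rw [Complex.norm_real, Real.norm_eq_abs, abs_of_nonneg (pekarW_nonneg ψ x)]
  exact h x

theorem pekarW_pos {ψ : L2} (hψ : IsPekarMinimizer ψ) (x : E3) : 0 < pekarW ψ x := by
  unfold pekarW
  refine mul_pos two_pos (ENNReal.toReal_pos ?_ (newtonPot_ne_top hψ.memH1 x))
  intro h
  have hsub : Measurable fun z : E3 => x - z := by fun_prop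
  have hm : Measurable fun y => ENNReal.ofReal (newton (x - y)) * dens ψ y :=
    (measurable_newton.comp hsub).ennreal_ofReal.mul (measurable_dens ψ)
  have h1 := (lintegral_eq_zero_iff hm).1 h
  have hx : ∀ᵐ z : E3, z ≠ x := by simp [ae_iff]
  obtain ⟨y, h2, h3, h4⟩ := (h1.and (hψ.pos.and hx)).exists
  simp only [Pi.zero_apply, mul_eq_zero] at h2
  rcases h2 with h2 | h2
  · have : 0 < ‖x - y‖ := norm_pos_iff.2 (sub_ne_zero.2 h4.symm)
    have hpi := Real.pi_pos
    rw [ENNReal.ofReal_eq_zero] at h2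
    unfold newton at h2
    have : 0 < 1 / (4 * Real.pi * ‖x - y‖) := by positivity
    linarith
  · unfold dens at h2
    have h5 : ψ y = 0 := by simpa using h2
    rw [h5] at h3
    simp at h3

/-! ### Linearization of the minimization problem -/

/-- The lowest eigenvalue of the Pekar Hamiltonian. -/
def pekarMu (ψ : L2) : ℝ := (gradNormSq ψ).toReal - ∫ x, pekarW ψ x * ‖ψ x‖ ^ 2

theorem integral_pekarW_mul {ψ : L2} (hψ : MemH1 ψ) (u : L2) :
    ∫ x, pekarW ψ x * ‖u x‖ ^ 2 = 2 * (coulomb u ψ).toReal := by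
  rw [← integral_newtonPot_mul hψ, ← integral_const_mul]
  refine integral_congr_ae (Eventually.of_forall fun x => ?_)
  simp only [pekarW]
  ring

/-- With kinetic energy `T` and Coulomb energy `D`, minimality and positivity of `D` give `T(ψ) -
D(ψ,ψ) ≤ T(u) - D(u,u) ≤ T(u) - 2 D(u,ψ) + D(ψ,ψ)`. So the nonlinear minimizer is a ground state of
its own linear Hamiltonian, without any differentiation. -/
theorem pekarMu_le_of_norm_eq_one {ψ : L2} (hψ : IsPekarMinimizer ψ) {u : L2} (hu : MemH1 u)
    (h1 : ‖u‖ = 1) : pekarMu ψ ≤ (gradNormSq u).toReal - ∫ x, pekarW ψ x * ‖u x‖ ^ 2 := by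
  have h := hψ.isMin u hu h1
  rw [pekarFunctional_eq hψ.memH1, pekarFunctional_eq hu] at h
  unfold pekarMu
  rw [integral_pekarW_mul hψ.memH1, integral_pekarW_mul hψ.memH1]
  have h2 := ENNReal.toReal_mono (ENNReal.add_ne_top.2 ⟨coulomb_ne_top hu u,
    coulomb_ne_top hψ.memH1 ψ⟩) (two_mul_coulomb_le u ψ)
  rw [ENNReal.toReal_mul, ENNReal.toReal_add (coulomb_ne_top hu u) (coulomb_ne_top hψ.memH1 ψ),
    ENNReal.toReal_ofNat] at h2
  linarith

theorem pekarMu_mul_norm_sq_le {ψ : L2} (hψ : IsPekarMinimizer ψ) {c : ℝ} (hc : 0 < c) (w : L2) :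
    pekarMu ψ * ‖gHalf c w‖ ^ 2 ≤
      ‖w‖ ^ 2 - c * ‖gHalf c w‖ ^ 2 - ∫ x, pekarW ψ x * ‖gHalf c w x‖ ^ 2 := by
  by_cases h0 : gHalf c w = 0
  · have hw : w = 0 := gHalf_injective hc (by rw [h0, map_zero])
    rw [h0, hw]
    have : ∫ x, pekarW ψ x * ‖(0 : L2) x‖ ^ 2 = 0 := by
      refine integral_eq_zero_of_ae ?_
      filter_upwards [Lp.coeFn_zero ℂ 2 (volume : Measure E3)] with x hx
      rw [hx]; simp
    rw [this]
    simp
  · have hn : 0 < ‖gHalf c w‖ := norm_pos_iff.2 h0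
    set t : ℝ := ‖gHalf c w‖⁻¹ with ht
    have htt : 0 < t := by positivity
    have e : gHalf c ((t : ℂ) • w) = (t : ℂ) • gHalf c w := map_smul _ _ _
    have hnorm : ‖(t : ℂ)‖ = t := by
      rw [Complex.norm_real, Real.norm_eq_abs, abs_of_pos htt]
    have h1 : ‖gHalf c ((t : ℂ) • w)‖ = 1 := by
      rw [e, norm_smul, hnorm, ht, inv_mul_cancel₀ hn.ne']
    have h2 := pekarMu_le_of_norm_eq_one hψ ((memH1_iff hc _).2 ⟨(t : ℂ) • w, rfl⟩) h1
    rw [toReal_gradNormSq_gHalf hc, h1, norm_smul, hnorm] at h2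
    have h3 : ∫ x, pekarW ψ x * ‖gHalf c ((t : ℂ) • w) x‖ ^ 2 =
        t ^ 2 * ∫ x, pekarW ψ x * ‖gHalf c w x‖ ^ 2 := by
      rw [← integral_const_mul]
      refine integral_congr_ae ?_
      rw [e]
      filter_upwards [Lp.coeFn_smul (t : ℂ) (gHalf c w)] with x hx
      rw [hx, Pi.smul_apply, norm_smul, hnorm]
      ring
    rw [h3] at h2
    have h4 : t * ‖gHalf c w‖ = 1 := inv_mul_cancel₀ hn.ne'
    have h5 := mul_le_mul_of_nonneg_right h2 (sq_nonneg ‖gHalf c w‖)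
    have h6 : ((t * ‖w‖) ^ 2 - c * 1 ^ 2 - t ^ 2 * ∫ x, pekarW ψ x * ‖gHalf c w x‖ ^ 2) *
        ‖gHalf c w‖ ^ 2 = (t * ‖gHalf c w‖) ^ 2 * (‖w‖ ^ 2 -
          ∫ x, pekarW ψ x * ‖gHalf c w x‖ ^ 2) - c * ‖gHalf c w‖ ^ 2 := by ring
    rw [h6, h4] at h5
    linarith

/-- There are normalized functions with arbitrarily small kinetic energy. -/
theorem exists_small_gradNormSq {ε : ℝ} (hε : 0 < ε) : ∃ u : L2, MemH1 u ∧ ‖u‖ = 1 ∧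
    (gradNormSq u).toReal ≤ ε := by
  -- The trial function lives at momenta in a ball on which the symbol of `-Δ` is at most `ε`.
  set δ : ℝ := Real.sqrt ε / (2 * Real.pi)
  have hδ : 0 < δ := by positivity
  have hδ2 : (2 * Real.pi) ^ 2 * δ ^ 2 = ε := by
    rw [← mul_pow, mul_div_cancel₀ _ (by positivity), Real.sq_sqrt hε.le]
  have hfin : volume (Metric.ball (0 : E3) δ) ≠ ∞ := measure_ball_lt_top.ne
  set N : L2 := indicatorConstLp 2 measurableSet_ball hfin (1 : ℂ)
  have hN : N =ᵐ[volume] (Metric.ball (0 : E3) δ).indicator fun _ => (1 : ℂ) :=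
    indicatorConstLp_coeFn
  have hN0 : N ≠ 0 := by
    intro h
    have h1 : ‖N‖ = 0 := by rw [h, norm_zero]
    rw [norm_indicatorConstLp (by norm_num) (by norm_num), norm_one, one_mul] at h1
    have h2 : 0 < volume.real (Metric.ball (0 : E3) δ) :=
      ENNReal.toReal_pos (Metric.measure_ball_pos _ _ hδ).ne' hfin
    have := Real.rpow_pos_of_pos h2 (1 / (2 : ℝ≥0∞).toReal)
    linarith
  set w : L2 := F2.symm N with hw
  have hw0 : w ≠ 0 := by
    intro h
    apply hN0
    rw [← F2.apply_symm_apply N, ← hw, h, map_zero]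
  have hu0 : gHalf 1 w ≠ 0 := fun h => hw0 (gHalf_injective one_pos (by rw [h, map_zero]))
  have hn : 0 < ‖gHalf 1 w‖ := norm_pos_iff.2 hu0
  have hle : ‖w‖ ≤ Real.sqrt (ε + 1) * ‖gHalf 1 w‖ := by
    rw [← F2.norm_map w, ← F2.norm_map (gHalf 1 w)]
    refine norm_toLp_le_of_bound (Real.sqrt_nonneg _) ?_
    filter_upwards [F2_gHalf one_pos w, hN] with ξ h1 h2
    rw [h1, hw, F2.apply_symm_apply, h2, norm_mul, Complex.norm_real, Real.norm_eq_abs,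
      abs_of_pos (rsym_pos one_pos ξ)]
    by_cases hξ : ξ ∈ Metric.ball (0 : E3) δ
    · rw [Set.indicator_of_mem hξ, norm_one, mul_one]
      have h3 := lsym_nonneg ξ
      have h4 : lsym ξ ≤ ε := by
        rw [← hδ2]
        unfold lsym
        have : ‖ξ‖ ≤ δ := (mem_ball_zero_iff.1 hξ).le
        gcongr
      unfold rsym
      rw [← div_eq_mul_inv, le_div_iff₀ (by positivity), one_mul]
      exact Real.sqrt_le_sqrt (by linarith)
    · rw [Set.indicator_of_notMem hξ]; simp
  set t : ℝ := ‖gHalf 1 w‖⁻¹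
  have ht : 0 < t := by positivity
  have hnorm : ‖(t : ℂ)‖ = t := by
    rw [Complex.norm_real, Real.norm_eq_abs, abs_of_pos ht]
  have h1 : ‖gHalf 1 ((t : ℂ) • w)‖ = 1 := by
    rw [map_smul, norm_smul, hnorm, inv_mul_cancel₀ hn.ne']
  refine ⟨gHalf 1 ((t : ℂ) • w), (memH1_iff one_pos _).2 ⟨_, rfl⟩, h1, ?_⟩
  rw [toReal_gradNormSq_gHalf one_pos, h1, norm_smul, hnorm]
  have h2 : t * ‖w‖ ≤ Real.sqrt (ε + 1) := by
    calc t * ‖w‖ ≤ t * (Real.sqrt (ε + 1) * ‖gHalf 1 w‖) := by gcongr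
      _ = Real.sqrt (ε + 1) * (t * ‖gHalf 1 w‖) := by ring
      _ = Real.sqrt (ε + 1) := by rw [inv_mul_cancel₀ hn.ne', mul_one]
  have h3 : (t * ‖w‖) ^ 2 ≤ ε + 1 := by
    calc (t * ‖w‖) ^ 2 ≤ Real.sqrt (ε + 1) ^ 2 := by gcongr
      _ = ε + 1 := Real.sq_sqrt (by positivity)
  linarith

/-- Trial functions of small kinetic energy show that the minimal Pekar energy is at most zero, and
`pekarMu ψ` lies below that energy by the strictly positive Coulomb energy of `ψ`. -/
theorem pekarMu_neg {ψ : L2} (hψ : IsPekarMinimizer ψ) : pekarMu ψ < 0 := by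
  have h1 : (gradNormSq ψ).toReal - (coulomb ψ ψ).toReal ≤ 0 := by
    refine le_of_forall_pos_le_add fun ε hε => ?_
    obtain ⟨u, hu, hu1, hu2⟩ := exists_small_gradNormSq hε
    have h := hψ.isMin u hu hu1
    rw [pekarFunctional_eq hψ.memH1, pekarFunctional_eq hu] at h
    have : 0 ≤ (coulomb u u).toReal := ENNReal.toReal_nonneg
    linarith
  have h2 : 0 < ∫ x, pekarW ψ x * ‖ψ x‖ ^ 2 := by
    refine (integral_pos_iff_support_of_nonneg_ae (Eventually.of_forall fun x =>
      mul_nonneg (pekarW_nonneg ψ x) (by positivity))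
      (integrable_mul_norm_sq (memLp_pekarW hψ.memH1) ψ)).2 ?_
    have : Function.support (fun x => pekarW ψ x * ‖ψ x‖ ^ 2) =ᵐ[volume] Set.univ := by
      rw [eventuallyEq_univ]
      filter_upwards [hψ.pos] with x hx
      have : ψ x ≠ 0 := by rintro h; rw [h] at hx; simp at hx
      exact mul_ne_zero (pekarW_pos hψ x).ne' (by simpa using this)
    rw [measure_congr this]
    simp
  rw [integral_pekarW_mul hψ.memH1] at h2
  unfold pekarMu
  rw [integral_pekarW_mul hψ.memH1]
  linarith

/-! ### The Birman-Schwinger operator and boundedness of the minimizer -/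

/-- Nonnegativity is tested on `‖A‖ x - A x`. Besides locating null vectors, this inequality later
supplies the power of `1 - λ` in the gradient bound. -/
theorem norm_apply_sq_le_of_nonneg {H : Type*} [NormedAddCommGroup H] [InnerProductSpace ℂ H]
    {A : H →L[ℂ] H} (hs : ∀ x y, inner ℂ (A x) y = inner ℂ x (A y))
    (hp : ∀ x, 0 ≤ (inner ℂ x (A x)).re) (x : H) :
    ‖A x‖ ^ 2 ≤ ‖A‖ * (inner ℂ x (A x)).re := by
  by_cases h0 : ‖A‖ = 0
  · have : A x = 0 := by
      have := A.le_opNorm x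
      rw [h0, zero_mul] at this
      exact norm_le_zero_iff.1 this
    rw [this, h0]; simp
  have hA : 0 < ‖A‖ := lt_of_le_of_ne (norm_nonneg _) (Ne.symm h0)
  have h1 := hp ((‖A‖ : ℂ) • x - A x)
  have e1 : inner ℂ (A x) x = inner ℂ x (A x) := hs x x
  have e2 : inner ℂ x (A (A x)) = inner ℂ (A x) (A x) := (hs x (A x)).symm
  rw [map_sub, map_smul, inner_sub_left, inner_sub_right, inner_sub_right, inner_smul_left,
    inner_smul_left, inner_smul_right, inner_smul_right, e2, Complex.conj_ofReal,
    inner_self_eq_norm_sq_to_K] at h1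
  have h2 : (inner ℂ (A x) (A (A x))).re ≤ ‖A‖ * ‖A x‖ ^ 2 := by
    refine (Complex.re_le_norm _).trans ((norm_inner_le_norm _ _).trans ?_)
    have := A.le_opNorm (A x)
    nlinarith [norm_nonneg (A x)]
  have e3 : ((‖A x‖ : ℂ) ^ 2) = ((‖A x‖ ^ 2 : ℝ) : ℂ) := by push_cast; rfl
  change 0 ≤ ((‖A‖ : ℂ) * ((‖A‖ : ℂ) * inner ℂ x (A x)) - (‖A‖ : ℂ) * (‖A x‖ : ℂ) ^ 2 -
    ((‖A‖ : ℂ) * (‖A x‖ : ℂ) ^ 2 - inner ℂ (A x) (A (A x)))).re at h1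
  rw [e3] at h1
  simp only [Complex.sub_re, Complex.re_ofReal_mul, Complex.ofReal_re] at h1
  have h3 : ‖A‖ * ‖A x‖ ^ 2 ≤ ‖A‖ * (‖A‖ * (inner ℂ x (A x)).re) := by linarith
  exact le_of_mul_le_mul_left h3 hA

theorem apply_eq_zero_of_nonneg {H : Type*} [NormedAddCommGroup H] [InnerProductSpace ℂ H]
    {A : H →L[ℂ] H} (hs : ∀ x y, inner ℂ (A x) y = inner ℂ x (A y))
    (hp : ∀ x, 0 ≤ (inner ℂ x (A x)).re) {x : H} (hx : (inner ℂ x (A x)).re = 0) : A x = 0 := by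
  have := norm_apply_sq_le_of_nonneg hs hp x
  rw [hx, mul_zero] at this
  have h2 : ‖A x‖ ^ 2 = 0 := le_antisymm this (by positivity)
  simpa using h2

/-- Multiplication by the absolute value of the Pekar potential. -/
def wOp (ψ : L2) : L2 →L[ℂ] L2 := mulOp fun x => (pekarW ψ x : ℂ)

/-- The Birman-Schwinger operator. -/
def bOp (ψ : L2) (c : ℝ) : L2 →L[ℂ] L2 := gHalf c ∘L wOp ψ ∘L gHalf c

theorem bOp_symm {ψ : L2} (hψ : MemH1 ψ) {c : ℝ} (hc : 0 < c) (x y : L2) :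
    inner ℂ (bOp ψ c x) y = inner ℂ x (bOp ψ c y) :=
  isSymmetric_gHalf_mulOp hc (memLp_pekarW hψ) x y

theorem inner_bOp {ψ : L2} (hψ : MemH1 ψ) {c : ℝ} (hc : 0 < c) (w : L2) :
    inner ℂ w (bOp ψ c w) = ((∫ x, pekarW ψ x * ‖gHalf c w x‖ ^ 2 : ℝ) : ℂ) := by
  rw [← re_inner_mulOp (memLp_pekarW hψ), inner_gHalf_left hc]
  rfl

theorem re_inner_one_sub_bOp {ψ : L2} (hψ : MemH1 ψ) {c : ℝ} (hc : 0 < c) (w : L2) :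
    (inner ℂ w ((1 - bOp ψ c : L2 →L[ℂ] L2) w)).re =
      ‖w‖ ^ 2 - ∫ x, pekarW ψ x * ‖gHalf c w x‖ ^ 2 := by
  rw [sub_apply, one_apply_eq_self, inner_sub_right,
    inner_bOp hψ hc, inner_self_eq_norm_sq_to_K, Complex.sub_re, Complex.ofReal_re]
  congr 1
  norm_cast

theorem le_re_inner_one_sub_bOp {ψ : L2} (hψ : IsPekarMinimizer ψ) {c : ℝ} (hc : 0 < c) (w : L2) :
    (pekarMu ψ + c) * ‖gHalf c w‖ ^ 2 ≤ (inner ℂ w ((1 - bOp ψ c : L2 →L[ℂ] L2) w)).re := by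
  rw [re_inner_one_sub_bOp hψ.memH1 hc]
  have := pekarMu_mul_norm_sq_le hψ hc w
  linarith

theorem one_sub_bOp_symm {ψ : L2} (hψ : MemH1 ψ) {c : ℝ} (hc : 0 < c) (x y : L2) :
    inner ℂ ((1 - bOp ψ c : L2 →L[ℂ] L2) x) y = inner ℂ x ((1 - bOp ψ c : L2 →L[ℂ] L2) y) := by
  simp only [sub_apply, one_apply_eq_self, inner_sub_left,
    inner_sub_right, bOp_symm hψ hc]

/-- The Euler-Lagrange equation of the Pekar functional. -/
theorem exists_eq_gHalf_and_bOp_eq {ψ : L2} (hψ : IsPekarMinimizer ψ) :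
    ∃ χ : L2, ψ = gHalf (-pekarMu ψ) χ ∧ bOp ψ (-pekarMu ψ) χ = χ := by
  have hc : 0 < -pekarMu ψ := neg_pos.2 (pekarMu_neg hψ)
  obtain ⟨χ, hχ⟩ := (memH1_iff hc ψ).1 hψ.memH1
  refine ⟨χ, hχ, ?_⟩
  -- At `c = -pekarMu ψ` the operator `1 - B` is nonnegative and its form vanishes at `χ`, hence so
  -- does `(1 - B) χ`.
  have h1 : (1 - bOp ψ (-pekarMu ψ) : L2 →L[ℂ] L2) χ = 0 := by
    refine apply_eq_zero_of_nonneg (one_sub_bOp_symm hψ.memH1 hc) (fun w => ?_) ?_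
    · have := le_re_inner_one_sub_bOp hψ hc w
      rwa [add_neg_cancel, zero_mul] at this
    · rw [re_inner_one_sub_bOp hψ.memH1 hc, ← hχ]
      have h2 := toReal_gradNormSq_gHalf hc χ
      rw [← hχ, hψ.norm_eq_one] at h2
      have h3 : pekarMu ψ = (gradNormSq ψ).toReal - ∫ x, pekarW ψ x * ‖ψ x‖ ^ 2 := rfl
      linarith
  rw [sub_apply, one_apply_eq_self, sub_eq_zero] at h1
  exact h1.symm

theorem eq_gRes_wOp {ψ : L2} (hψ : IsPekarMinimizer ψ) :
    ψ = gRes (-pekarMu ψ) (wOp ψ ψ) := by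
  obtain ⟨χ, h1, h2⟩ := exists_eq_gHalf_and_bOp_eq hψ
  set c := -pekarMu ψ
  calc ψ = gHalf c χ := h1
    _ = gHalf c (bOp ψ c χ) := by rw [h2]
    _ = gRes c (wOp ψ (gHalf c χ)) := rfl
    _ = gRes c (wOp ψ ψ) := by rw [← h1]

/-- `ψ` is the resolvent applied to a square integrable function, and in three dimensions the
resolvent maps `L²` into `L^∞`. -/
theorem exists_ae_norm_le {ψ : L2} (hψ : IsPekarMinimizer ψ) :
    ∃ L : ℝ, 0 < L ∧ ∀ᵐ x, ‖ψ x‖ ≤ L := by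
  have hc : 0 < -pekarMu ψ := neg_pos.2 (pekarMu_neg hψ)
  refine ⟨resNorm (-pekarMu ψ) * ‖wOp ψ ψ‖ + 1, ?_, ?_⟩
  · have := resNorm_nonneg (-pekarMu ψ)
    positivity
  have := ae_norm_gRes_le hc (wOp ψ ψ)
  rw [← eq_gRes_wOp hψ] at this
  filter_upwards [this] with x hx
  linarith

/-! ### Decay of the Pekar potential and compactness -/

/-- For `|z| < r` one has `1/|z| ≤ r/|z|²`: the singular part has an integral of order `r`, and the
remainder is bounded and decays. -/
theorem newton_le {r : ℝ} (hr : 0 < r) (hr1 : r ≤ 1) (z : E3) :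
    newton z ≤ r / (4 * Real.pi) * coulombLoc z ^ 2 + (4 * Real.pi * max ‖z‖ r)⁻¹ := by
  have hpi := Real.pi_pos
  unfold newton
  by_cases h : r ≤ ‖z‖
  · rw [max_eq_left h, one_div]
    have : 0 ≤ r / (4 * Real.pi) * coulombLoc z ^ 2 := by positivity
    linarith
  · rw [not_le] at h
    have hz : z ∈ Metric.ball (0 : E3) 1 := mem_ball_zero_iff.2 (h.trans_le hr1)
    unfold coulombLoc
    rw [Set.indicator_of_mem hz]
    have h1 : 0 ≤ (4 * Real.pi * max ‖z‖ r)⁻¹ := by positivity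
    rcases eq_or_lt_of_le (norm_nonneg z) with h0 | h0
    · rw [← h0]; simp; positivity
    · have : 1 / (4 * Real.pi * ‖z‖) ≤ r / (4 * Real.pi) * ‖z‖⁻¹ ^ 2 := by
        rw [div_mul_eq_mul_div, div_le_div_iff₀ (by positivity) (by positivity)]
        have : r * ‖z‖⁻¹ ^ 2 * (4 * Real.pi * ‖z‖) = 4 * Real.pi * (r * ‖z‖⁻¹) := by
          field_simp
        rw [this, one_mul]
        refine le_mul_of_one_le_right (by positivity) ?_
        rw [← div_eq_mul_inv, one_le_div h0]
        exact h.le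
      linarith

theorem integrable_coulombLoc_sq : Integrable fun z => coulombLoc z ^ 2 := by
  have := (memLp_two_iff_integrable_sq_norm memLp_coulombLoc.1).1 memLp_coulombLoc
  simpa only [Complex.norm_real, Real.norm_eq_abs, sq_abs] using this

theorem integral_coulombLoc_sq_sub (x : E3) :
    ∫ y, coulombLoc (x - y) ^ 2 = ∫ z, coulombLoc z ^ 2 :=
  integral_sub_left_eq_self (fun z => coulombLoc z ^ 2) volume x

theorem tendsto_norm_sub_cocompact (y : E3) :
    Tendsto (fun x : E3 => ‖x - y‖) (cocompact E3) atTop := by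
  have h1 : Tendsto (fun x : E3 => ‖x‖ - ‖y‖) (cocompact E3) atTop :=
    tendsto_atTop_add_const_right _ _ tendsto_norm_cocompact_atTop
  exact tendsto_atTop_mono (fun x => norm_sub_norm_le x y) h1

/-- The Pekar potential vanishes at infinity. -/
theorem tendsto_pekarW {ψ : L2} (hψ : IsPekarMinimizer ψ) :
    Tendsto (pekarW ψ) (cocompact E3) (𝓝 0) := by
  obtain ⟨L, hL, hLb⟩ := exists_ae_norm_le hψ
  have hpi := Real.pi_pos
  set C := ∫ z, coulombLoc z ^ 2 with hC
  have hC0 : 0 ≤ C := integral_nonneg fun z => by positivity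
  have hρ := integrable_norm_sq ψ
  set h : ℝ → E3 → E3 → ℝ := fun r x y => (4 * Real.pi * max ‖x - y‖ r)⁻¹ * ‖ψ y‖ ^ 2 with hh
  have hhb : ∀ r, 0 < r → ∀ x y, ‖h r x y‖ ≤ (4 * Real.pi * r)⁻¹ * ‖ψ y‖ ^ 2 := by
    intro r hr x y
    have h0 : 0 ≤ (4 * Real.pi * max ‖x - y‖ r)⁻¹ * ‖ψ y‖ ^ 2 := by positivity
    rw [hh, Real.norm_eq_abs, abs_of_nonneg h0]
    have := le_max_right ‖x - y‖ r
    gcongr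
  have hhm : ∀ r, 0 < r → ∀ x, AEStronglyMeasurable (h r x) volume := by
    intro r hr x
    refine AEStronglyMeasurable.mul ?_ ((Lp.aestronglyMeasurable ψ).norm.pow 2)
    have : Measurable fun y : E3 => (4 * Real.pi * max ‖x - y‖ r)⁻¹ := by fun_prop
    exact this.aestronglyMeasurable
  have hhi : ∀ r, 0 < r → ∀ x, Integrable (h r x) := fun r hr x =>
    (hρ.const_mul _).mono' (hhm r hr x) (Eventually.of_forall (hhb r hr x))
  have hcg : (cocompact E3).IsCountablyGenerated := by
    rw [← Metric.cobounded_eq_cocompact, ← comap_norm_atTop]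
    infer_instance
  have hlim : ∀ r, 0 < r → Tendsto (fun x => ∫ y, h r x y) (cocompact E3) (𝓝 0) := by
    intro r hr
    have := tendsto_integral_filter_of_dominated_convergence (l := cocompact E3) (F := h r)
      (f := fun _ => (0 : ℝ)) (fun y => (4 * Real.pi * r)⁻¹ * ‖ψ y‖ ^ 2)
      (Eventually.of_forall (hhm r hr))
      (Eventually.of_forall fun x => Eventually.of_forall (hhb r hr x)) (hρ.const_mul _)
      (Eventually.of_forall fun y => ?_)
    · simpa using this
    · have h1 : Tendsto (fun x : E3 => 4 * Real.pi * max ‖x - y‖ r) (cocompact E3) atTop := by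
        refine Tendsto.const_mul_atTop (by positivity) ?_
        exact tendsto_atTop_mono (fun x => le_max_left _ _) (tendsto_norm_sub_cocompact y)
      have h2 := (tendsto_inv_atTop_zero.comp h1).mul_const (‖ψ y‖ ^ 2)
      rw [zero_mul] at h2
      exact h2
  -- The bound on `ψ` makes the singular part of order `r` uniformly in `x`; for fixed `r` the
  -- remainder tends to zero by dominated convergence.
  have hle : ∀ r, 0 < r → r ≤ 1 → ∀ x,
      pekarW ψ x ≤ 2 * (L ^ 2 * (r / (4 * Real.pi)) * C) + 2 * ∫ y, h r x y := by
    intro r hr hr1 x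
    unfold pekarW
    rw [← integral_newton_mul, ← mul_add]
    refine mul_le_mul_of_nonneg_left ?_ two_pos.le
    have hci : Integrable fun y => L ^ 2 * (r / (4 * Real.pi)) * coulombLoc (x - y) ^ 2 :=
      (integrable_coulombLoc_sq.comp_sub_left x).const_mul _
    rw [hC, ← integral_coulombLoc_sq_sub x, ← integral_const_mul, ← integral_add hci (hhi r hr x)]
    refine integral_mono_of_nonneg (Eventually.of_forall fun y =>
      mul_nonneg (newton_nonneg _) (by positivity)) (hci.add (hhi r hr x)) ?_
    filter_upwards [hLb] with y hy
    have h1 := newton_le hr hr1 (x - y)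
    have h2 : ‖ψ y‖ ^ 2 ≤ L ^ 2 := by gcongr
    calc newton (x - y) * ‖ψ y‖ ^ 2
        ≤ (r / (4 * Real.pi) * coulombLoc (x - y) ^ 2 + (4 * Real.pi * max ‖x - y‖ r)⁻¹) *
          ‖ψ y‖ ^ 2 := by gcongr
      _ = r / (4 * Real.pi) * coulombLoc (x - y) ^ 2 * ‖ψ y‖ ^ 2 + h r x y := by rw [add_mul]
      _ ≤ r / (4 * Real.pi) * coulombLoc (x - y) ^ 2 * L ^ 2 + h r x y := by gcongr
      _ = _ := by ring
  rw [Metric.tendsto_nhds]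
  intro ε hε
  -- Chosen so that the singular part is at most `ε / 2`; the `+ 1` keeps the denominator positive.
  set r := min 1 (ε / 2 / (2 * (L ^ 2 * (4 * Real.pi)⁻¹ * C) + 1)) with hr
  have hden : 0 < 2 * (L ^ 2 * (4 * Real.pi)⁻¹ * C) + 1 := by positivity
  have hr0 : 0 < r := lt_min one_pos (by positivity)
  have h1 : 2 * (L ^ 2 * (r / (4 * Real.pi)) * C) ≤ ε / 2 := by
    have h2 : r ≤ ε / 2 / (2 * (L ^ 2 * (4 * Real.pi)⁻¹ * C) + 1) := min_le_right _ _
    rw [le_div_iff₀ hden] at h2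
    have : 2 * (L ^ 2 * (r / (4 * Real.pi)) * C) = r * (2 * (L ^ 2 * (4 * Real.pi)⁻¹ * C)) := by
      ring
    rw [this]
    linarith
  have h3 := (hlim r hr0).eventually (gt_mem_nhds (show (0 : ℝ) < ε / 4 by positivity))
  filter_upwards [h3] with x hx
  rw [Real.dist_eq, sub_zero, abs_of_nonneg (pekarW_nonneg ψ x)]
  have := hle r hr0 (min_le_left _ _) x
  linarith

theorem tendsto_mulOp_indicator {a : E3 → ℂ} (ha : MemLp a ∞ (volume : Measure E3))
    (h0 : Tendsto a (cocompact E3) (𝓝 0)) :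
    Tendsto (fun n : ℕ => mulOp ((Metric.ball (0 : E3) n).indicator a)) atTop (𝓝 (mulOp a)) := by
  have hi : ∀ n : ℕ, MemLp ((Metric.ball (0 : E3) n).indicator a) ∞ (volume : Measure E3) :=
    fun n => ha.indicator measurableSet_ball
  rw [Metric.tendsto_atTop]
  intro ε hε
  have h1 := h0.eventually (Metric.ball_mem_nhds (0 : ℂ) (half_pos hε))
  rw [Filter.eventually_iff, mem_cocompact] at h1
  obtain ⟨K, hK, hKs⟩ := h1
  obtain ⟨R, hR⟩ := hK.isBounded.subset_ball (0 : E3)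
  refine ⟨⌈R⌉₊, fun n hn => ?_⟩
  rw [dist_comm, dist_eq_norm]
  refine lt_of_le_of_lt (ContinuousLinearMap.opNorm_le_bound _ (half_pos hε).le fun f => ?_)
    (half_lt_self hε)
  refine norm_toLp_le_of_bound (half_pos hε).le ?_
  rw [sub_apply]
  filter_upwards [Lp.coeFn_sub (mulOp a f) (mulOp ((Metric.ball (0 : E3) n).indicator a) f),
    coeFn_mulOp ha f, coeFn_mulOp (hi n) f] with x h2 h3 h4
  rw [h2, Pi.sub_apply, h3, h4, ← sub_mul, norm_mul]
  refine mul_le_mul_of_nonneg_right ?_ (norm_nonneg _)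
  by_cases hx : x ∈ Metric.ball (0 : E3) n
  · rw [Set.indicator_of_mem hx, sub_self, norm_zero]; positivity
  · rw [Set.indicator_of_notMem hx, sub_zero]
    have hxK : x ∈ Kᶜ := fun hxK => hx
      (Metric.ball_subset_ball ((Nat.le_ceil R).trans (by exact_mod_cast hn)) (hR hxK))
    have := hKs hxK
    simp only [Set.mem_ofPred_eq, dist_zero_right] at this
    exact this.le

theorem memLp_two_indicator_ball {a : E3 → ℂ} (ha : MemLp a ∞ (volume : Measure E3)) (r : ℝ) :
    MemLp ((Metric.ball (0 : E3) r).indicator a) 2 (volume : Measure E3) := by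
  have h1 : MemLp ((Metric.ball (0 : E3) r).indicator fun _ => (1 : ℂ)) 2
      (volume : Measure E3) :=
    memLp_indicator_const 2 measurableSet_ball 1 (Or.inr measure_ball_lt_top.ne)
  have := ha.mul h1 (r := 2)
  refine this.ae_eq (Eventually.of_forall fun x => ?_)
  by_cases hx : x ∈ Metric.ball (0 : E3) r <;> simp [hx]

/-- `a(x) m(-i∇)` is compact if both functions vanish at infinity. -/
theorem isCompactOperator_mulOp_comp_fmul_of_tendsto {a m : E3 → ℂ}
    (ha : MemLp a ∞ (volume : Measure E3)) (ha0 : Tendsto a (cocompact E3) (𝓝 0))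
    (hm : MemLp m ∞ (volume : Measure E3)) (hm0 : Tendsto m (cocompact E3) (𝓝 0)) :
    IsCompactOperator (mulOp a ∘L fmul m) := by
  have h1 := tendsto_mulOp_indicator ha ha0
  have h2 : Tendsto (fun n : ℕ => fmul ((Metric.ball (0 : E3) n).indicator m)) atTop
      (𝓝 (fmul m)) := by
    unfold fmul
    have h3 := tendsto_mulOp_indicator hm hm0
    exact ((continuous_const.clm_comp (continuous_id.clm_comp continuous_const)).tendsto
      (mulOp m)).comp h3
  have h3 := ((continuous_fst.clm_comp continuous_snd).tendsto (mulOp a, fmul m)).comp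
    (h1.prodMk_nhds h2)
  refine isCompactOperator_of_tendsto h3 (Eventually.of_forall fun n => ?_)
  exact isCompactOperator_mulOp_comp_fmul (memLp_two_indicator_ball ha n)
    (ha.indicator measurableSet_ball) (memLp_two_indicator_ball hm n)
    (hm.indicator measurableSet_ball)

theorem tendsto_rsym (c : ℝ) :
    Tendsto (fun ξ => (rsym c ξ : ℂ)) (cocompact E3) (𝓝 0) := by
  have h1 : Tendsto (rsym c) (cocompact E3) (𝓝 0) := by
    unfold rsym
    refine tendsto_inv_atTop_zero.comp (Real.tendsto_sqrt_atTop.comp ?_)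
    refine tendsto_atTop_add_const_right _ _ ?_
    unfold lsym
    exact Tendsto.const_mul_atTop (by positivity)
      ((tendsto_pow_atTop two_ne_zero).comp tendsto_norm_cocompact_atTop)
  have := (Complex.continuous_ofReal.tendsto 0).comp h1
  rwa [Complex.ofReal_zero] at this

theorem isCompactOperator_bOp {ψ : L2} (hψ : IsPekarMinimizer ψ) {c : ℝ} (hc : 0 < c) :
    IsCompactOperator (bOp ψ c) := by
  have h0 : Tendsto (fun x => (pekarW ψ x : ℂ)) (cocompact E3) (𝓝 0) := by
    have := (Complex.continuous_ofReal.tendsto 0).comp (tendsto_pekarW hψ)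
    rwa [Complex.ofReal_zero] at this
  have := isCompactOperator_mulOp_comp_fmul_of_tendsto (memLp_pekarW hψ.memH1) h0 (memLp_rsym hc)
    (tendsto_rsym c)
  exact this.clm_comp (gHalf c)

/-! ### Spectral bottom and reduced resolvent -/

/-- The Fredholm alternative. -/
theorem exists_inverse_of_injective {H : Type*} [NormedAddCommGroup H] [NormedSpace ℂ H]
    [CompleteSpace H] {K : H →L[ℂ] H} (hK : IsCompactOperator K) (hi : ∀ x, K x = x → x = 0) :
    ∃ S : H →L[ℂ] H, (∀ x, S x - K (S x) = x) ∧ ∀ x, S (x - K x) = x := by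
  rcases hK.hasEigenvalue_or_mem_resolventSet one_ne_zero with h | h
  · obtain ⟨x, hx⟩ := h.exists_hasEigenvector
    have h1 := hx.apply_eq_smul
    rw [one_smul] at h1
    exact absurd (hi x h1) hx.2
  · rw [spectrum.mem_resolventSet_iff, map_one] at h
    obtain ⟨U, hU⟩ := h
    refine ⟨(U⁻¹ : (H →L[ℂ] H)ˣ), fun x => ?_, fun x => ?_⟩
    · have := congrArg (fun T : H →L[ℂ] H => T x) U.mul_inv
      rw [hU] at this
      exact this
    · have := congrArg (fun T : H →L[ℂ] H => T x) U.inv_mul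
      rw [hU] at this
      exact this

theorem coeFn_wOp {ψ : L2} (hψ : MemH1 ψ) (u : L2) :
    wOp ψ u =ᵐ[volume] fun x => (pekarW ψ x : ℂ) * u x :=
  coeFn_mulOp (memLp_pekarW hψ) u

theorem isSchrodingerImage_iff {ψ : L2} (hψ : MemH1 ψ) {c : ℝ} (hc : 0 < c) (u f : L2) :
    IsSchrodingerImage (pekarPotential ψ) u f ↔ u = gRes c (f + wOp ψ u + (c : ℂ) • u) := by
  have hw : ∀ᵐ x, (-wOp ψ u : L2) x = (pekarPotential ψ x : ℂ) * u x := by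
    filter_upwards [coeFn_wOp hψ u, Lp.coeFn_neg (wOp ψ u)] with x h1 h2
    rw [h2, Pi.neg_apply, h1, pekarPotential_eq hψ]
    push_cast
    ring
  have e : f + wOp ψ u + (c : ℂ) • u = f - (-wOp ψ u) + (c : ℂ) • u := by rw [sub_neg_eq_add]
  rw [e, ← memH2_and_laplacian_iff hc]
  unfold IsSchrodingerImage
  refine and_congr_right fun _ => ⟨?_, fun h => ⟨_, hw, h⟩⟩
  rintro ⟨w, h1, h2⟩
  have : w = -wOp ψ u := by
    refine Lp.ext ?_
    filter_upwards [h1, hw] with x g1 g2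
    rw [g1, g2]
  rwa [this] at h2

theorem pekarMinimizer_ne_zero {ψ : L2} (hψ : IsPekarMinimizer ψ) : ψ ≠ 0 := by
  rintro h
  have := hψ.norm_eq_one
  rw [h, norm_zero] at this
  exact zero_ne_one this

theorem pekarMu_mem_spectrum {ψ : L2} (hψ : IsPekarMinimizer ψ) :
    ((pekarMu ψ : ℝ) : ℂ) ∈ schrodingerSpectrum (pekarPotential ψ) := by
  have hc : 0 < -pekarMu ψ := neg_pos.2 (pekarMu_neg hψ)
  rintro ⟨S, hS⟩
  apply pekarMinimizer_ne_zero hψ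
  have h1 := (hS ψ 0).1 ?_
  · rw [h1, map_zero]
  · rw [isSchrodingerImage_iff hψ.memH1 hc, zero_add]
    have e : ((pekarMu ψ : ℝ) : ℂ) • ψ + wOp ψ ψ + ((-pekarMu ψ : ℝ) : ℂ) • ψ = wOp ψ ψ := by
      rw [Complex.ofReal_neg, neg_smul]; abel
    rw [e]
    exact eq_gRes_wOp hψ

theorem bOp_apply (ψ : L2) (c : ℝ) (y : L2) :
    bOp ψ c y = gHalf c (wOp ψ (gHalf c y)) := rfl

theorem gRes_apply (c : ℝ) (y : L2) : gRes c y = gHalf c (gHalf c y) := rfl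

/-- The Birman-Schwinger reduction: writing `u = (-Δ + c)^{-1/2} y` and cancelling one injective
factor leaves an equation for `1 - B`, to which the Fredholm alternative applies. -/
theorem eq_gRes_iff_bOp {ψ : L2} {c : ℝ} (hc : 0 < c) (g y : L2) :
    gHalf c y = gRes c (g + wOp ψ (gHalf c y)) ↔ y - bOp ψ c y = gHalf c g := by
  rw [gRes_apply, (gHalf_injective hc).eq_iff, map_add, ← bOp_apply, sub_eq_iff_eq_add]

/-- Below `pekarMu ψ` the form of `1 - B` is strictly positive, so `1 - B` is injective, hence
invertible, and sandwiching its inverse gives the resolvent. -/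
theorem notMem_spectrum_of_lt {ψ : L2} (hψ : IsPekarMinimizer ψ) {t : ℝ} (ht : t < pekarMu ψ) :
    (t : ℂ) ∉ schrodingerSpectrum (pekarPotential ψ) := by
  have hc : 0 < -t := by linarith [pekarMu_neg hψ]
  unfold schrodingerSpectrum
  simp only [Set.mem_ofPred_eq, not_not]
  have hi : ∀ x, bOp ψ (-t) x = x → x = 0 := by
    intro x hx
    have h1 := le_re_inner_one_sub_bOp hψ hc x
    rw [sub_apply, one_apply_eq_self, hx, sub_self, inner_zero_right, Complex.zero_re] at h1
    have h2 : ‖gHalf (-t) x‖ ^ 2 ≤ 0 := by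
      by_contra h
      rw [not_le] at h
      have : 0 < (pekarMu ψ + -t) * ‖gHalf (-t) x‖ ^ 2 := mul_pos (by linarith) h
      linarith
    have h3 : ‖gHalf (-t) x‖ = 0 := by
      have := le_antisymm h2 (sq_nonneg _)
      simpa using this
    exact gHalf_injective hc (by rw [norm_eq_zero.1 h3, map_zero])
  obtain ⟨S, hS1, hS2⟩ := exists_inverse_of_injective (isCompactOperator_bOp hψ hc) hi
  refine ⟨gHalf (-t) ∘L S ∘L gHalf (-t), fun u g => ?_⟩
  rw [isSchrodingerImage_iff hψ.memH1 hc]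
  have e : g + (t : ℂ) • u + wOp ψ u + ((-t : ℝ) : ℂ) • u = g + wOp ψ u := by
    rw [Complex.ofReal_neg, neg_smul]; abel
  rw [e]
  constructor
  · intro h
    obtain ⟨y, rfl⟩ : ∃ y, u = gHalf (-t) y := ⟨_, h⟩
    rw [eq_gRes_iff_bOp hc] at h
    change _ = gHalf (-t) (S (gHalf (-t) g))
    rw [← h, hS2]
  · intro h
    change u = gHalf (-t) (S (gHalf (-t) g)) at h
    rw [h, eq_gRes_iff_bOp hc, hS1]

theorem pekarLambda_eq {ψ : L2} (hψ : IsPekarMinimizer ψ) : pekarLambda ψ = pekarMu ψ := by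
  refine IsLeast.csInf_eq ⟨pekarMu_mem_spectrum hψ, fun t ht => ?_⟩
  by_contra h
  exact notMem_spectrum_of_lt hψ (not_le.1 h) ht

theorem isPekarImage_iff {ψ : L2} (hψ : IsPekarMinimizer ψ) (u f : L2) :
    IsPekarImage ψ u f ↔ u = gRes (-pekarMu ψ) (f + wOp ψ u) := by
  have hc : 0 < -pekarMu ψ := neg_pos.2 (pekarMu_neg hψ)
  unfold IsPekarImage
  rw [isSchrodingerImage_iff hψ.memH1 hc, pekarLambda_eq hψ]
  have e : f + ((pekarMu ψ : ℝ) : ℂ) • u + wOp ψ u + ((-pekarMu ψ : ℝ) : ℂ) • u =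
      f + wOp ψ u := by
    rw [Complex.ofReal_neg, neg_smul]; abel
  rw [e]

theorem eq_zero_of_eq_gRes_wOp {ψ : L2} (hψ : IsPekarMinimizer ψ) {u : L2}
    (hu : u = gRes (-pekarMu ψ) (wOp ψ u)) (ho : inner ℂ ψ u = 0) : u = 0 :=
  eq_zero_of_inner_ground_state_eq_zero (neg_pos.2 (pekarMu_neg hψ)) (memLp_pekarW hψ.memH1)
    (Eventually.of_forall (pekarW_pos hψ)) hψ.pos (eq_gRes_wOp hψ) hu ho

theorem inner_self_pekarMinimizer {ψ : L2} (hψ : IsPekarMinimizer ψ) : inner ℂ ψ ψ = (1 : ℂ) := by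
  rw [inner_self_eq_norm_sq_to_K, hψ.norm_eq_one]; simp

/-- At the spectral bottom `1 - B` has null space spanned by `χ`. Adding the rank one operator `P`
restores injectivity; with `S = (1 - B + P)⁻¹` and `g = (-Δ + c)^{-1/2}`, where `c = -pekarMu ψ`,
the reduced resolvent is `Q g S g Q`. -/
theorem exists_isReducedResolvent {ψ : L2} (hψ : IsPekarMinimizer ψ) :
    ∃ R, IsReducedResolvent ψ R := by
  have hc : 0 < -pekarMu ψ := neg_pos.2 (pekarMu_neg hψ)
  obtain ⟨χ, hχ, hBχ⟩ := exists_eq_gHalf_and_bOp_eq hψ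
  have hU : ∀ u, u = gRes (-pekarMu ψ) (wOp ψ u) → inner ℂ ψ u = 0 → u = 0 := fun u h h' =>
    eq_zero_of_eq_gRes_wOp hψ h h'
  have hE := eq_gRes_wOp hψ
  have hI := fun u f => isPekarImage_iff hψ u f
  set c := -pekarMu ψ
  have hψψ := inner_self_pekarMinimizer hψ
  have hχ0 : χ ≠ 0 := by
    rintro rfl
    exact pekarMinimizer_ne_zero hψ (by rw [hχ, map_zero])
  have hχχ : inner ℂ χ χ ≠ (0 : ℂ) := by simpa using hχ0
  set P : L2 →L[ℂ] L2 := (innerSL ℂ χ).smulRight χ with hP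
  have hPa : ∀ x, P x = inner ℂ χ x • χ := fun x => by
    simp [hP, ContinuousLinearMap.smulRight_apply]
  have hPc : IsCompactOperator P := by
    have h1 : ⇑P = ⇑(ContinuousLinearMap.toSpanSingleton ℂ χ) ∘ ⇑(innerSL ℂ χ) := by
      ext1 f; simp [hPa]
    rw [h1]
    exact (isCompactOperator_of_locallyCompactSpace_dom (innerSL ℂ χ)).clm_comp _
  have hker : ∀ y, inner ℂ χ (y - bOp ψ c y) = 0 := fun y => by
    rw [inner_sub_right, ← bOp_symm hψ.memH1 hc, hBχ, sub_self]
  have hinj : ∀ x, (bOp ψ c - P) x = x → x = 0 := by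
    intro x hx
    rw [sub_apply, hPa] at hx
    have h1 : inner ℂ χ x = 0 := by
      have h2 := hker x
      have h3 : x - bOp ψ c x = -(inner ℂ χ x • χ) := by
        nth_rewrite 1 [← hx]
        abel
      rw [h3, inner_neg_right, inner_smul_right, neg_eq_zero, mul_eq_zero] at h2
      exact h2.resolve_right hχχ
    rw [h1, zero_smul, sub_zero] at hx
    have h2 : ∀ z, bOp ψ c z = z → gHalf c z = gRes c (wOp ψ (gHalf c z)) := by
      intro z hz
      calc gHalf c z = gHalf c (bOp ψ c z) := by rw [hz]
        _ = _ := rfl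
    -- Subtracting this multiple of `χ` makes the image under `gHalf c` orthogonal to `ψ`, so
    -- simplicity of the ground state forces `d = 0`.
    set d := x - (inner ℂ ψ (gHalf c x)) • χ with hd
    have h4 : bOp ψ c d = d := by rw [hd, map_sub, map_smul, hx, hBχ]
    have h5 := hU _ (h2 d h4) (by
      rw [hd, map_sub, map_smul, ← hχ, inner_sub_right, inner_smul_right, hψψ, mul_one, sub_self])
    have h6 : d = 0 := gHalf_injective hc (by rw [h5, map_zero])
    rw [hd, sub_eq_zero] at h6
    rw [h6, inner_smul_right, mul_eq_zero] at h1
    rw [h6, h1.resolve_right hχχ, zero_smul]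
  obtain ⟨S, hS1, -⟩ := exists_inverse_of_injective ((isCompactOperator_bOp hψ hc).sub hPc) hinj
  set Q : L2 →L[ℂ] L2 := ContinuousLinearMap.id ℂ L2 - (innerSL ℂ ψ).smulRight ψ with hQ
  have hQa : ∀ x, Q x = x - inner ℂ ψ x • ψ := fun x => by
    simp [hQ, ContinuousLinearMap.smulRight_apply]
  have hQo : ∀ x, inner ℂ ψ (Q x) = 0 := fun x => by
    rw [hQa, inner_sub_right, inner_smul_right, hψψ, mul_one, sub_self]
  have hsol : ∀ f, Q (gHalf c (S (gHalf c (Q f)))) =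
      gRes c (Q f + wOp ψ (Q (gHalf c (S (gHalf c (Q f)))))) := by
    intro f
    set y := S (gHalf c (Q f)) with hy
    have h1 := hS1 (gHalf c (Q f))
    rw [← hy] at h1
    have h1 : y - bOp ψ c y + inner ℂ χ y • χ = gHalf c (Q f) := by
      rw [← h1]
      change _ = y - (bOp ψ c y - P y)
      rw [hPa]
      abel
    -- Both the range of `1 - B` and the right side are orthogonal to `χ`, so the rank one
    -- correction does not contribute to the solution.
    have h2 : inner ℂ χ y = 0 := by
      have h3 := congrArg (fun z => inner ℂ χ z) h1
      simp only [inner_add_right, hker, inner_smul_right, zero_add] at h3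
      rw [← inner_gHalf_left hc, ← hχ, hQo, mul_eq_zero] at h3
      exact h3.resolve_right hχχ
    rw [h2, zero_smul, add_zero, ← eq_gRes_iff_bOp hc] at h1
    rw [hQa (gHalf c y), map_sub (wOp ψ), map_smul (wOp ψ), add_sub, map_sub (gRes c),
      map_smul (gRes c), ← h1, ← hE]
  refine ⟨Q ∘L gHalf c ∘L S ∘L gHalf c ∘L Q, fun f u => ?_⟩
  change u = Q (gHalf c (S (gHalf c (Q f)))) ↔ _
  rw [hI, ← hQa]
  constructor
  · rintro rfl
    exact ⟨hQo _, hsol f⟩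
  · rintro ⟨h1, h2⟩
    have h3 := hsol f
    set v := Q (gHalf c (S (gHalf c (Q f))))
    rw [← sub_eq_zero]
    refine hU _ ?_ ?_
    · have e : gRes c (wOp ψ (u - v)) = gRes c (Q f + wOp ψ u) - gRes c (Q f + wOp ψ v) := by
        simp only [map_add, map_sub]; abel
      rw [e, ← h2, ← h3]
    · rw [inner_sub_right, h1, hQo, sub_self]

theorem reducedResolvent_spec {ψ : L2} (hψ : IsPekarMinimizer ψ) :
    IsReducedResolvent ψ (reducedResolvent ψ) := by
  have h := exists_isReducedResolvent hψ
  unfold reducedResolvent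
  rw [dif_pos h]
  exact h.choose_spec

theorem reducedResolvent_apply {ψ : L2} (hψ : IsPekarMinimizer ψ) (f : L2) :
    inner ℂ ψ (reducedResolvent ψ f) = 0 ∧ ∃ y, reducedResolvent ψ f = gHalf (-pekarMu ψ) y ∧
      y - bOp ψ (-pekarMu ψ) y = gHalf (-pekarMu ψ) (f - inner ℂ ψ f • ψ) := by
  have hc : 0 < -pekarMu ψ := neg_pos.2 (pekarMu_neg hψ)
  obtain ⟨h1, h2⟩ := (reducedResolvent_spec hψ f _).1 rfl
  rw [isPekarImage_iff hψ] at h2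
  obtain ⟨y, hy⟩ : ∃ y, reducedResolvent ψ f = gHalf (-pekarMu ψ) y := ⟨_, h2⟩
  refine ⟨h1, y, hy, ?_⟩
  rw [← eq_gRes_iff_bOp hc, ← hy]
  exact h2

/-- With `R f = (-Δ + c)^{-1/2} y`, where `c = -pekarMu ψ`, and `z` belonging to `g` likewise, the
form of `R` becomes the form of `1 - B` on `y` and `z`. Symmetry and positivity of `R` are inherited
from there; the last clause provides `y = z` on the diagonal. -/
theorem inner_reducedResolvent {ψ : L2} (hψ : IsPekarMinimizer ψ) (f g : L2) :
    ∃ y z, inner ℂ (reducedResolvent ψ f) g = inner ℂ y ((1 - bOp ψ (-pekarMu ψ) : L2 →L[ℂ] L2) z) ∧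
      inner ℂ f (reducedResolvent ψ g) = inner ℂ ((1 - bOp ψ (-pekarMu ψ) : L2 →L[ℂ] L2) y) z ∧
      (f = g → y = z) := by
  have hc : 0 < -pekarMu ψ := neg_pos.2 (pekarMu_neg hψ)
  obtain ⟨h1, -⟩ := reducedResolvent_apply hψ f
  obtain ⟨k1, -⟩ := reducedResolvent_apply hψ g
  choose y hy1 hy2 using fun f => (reducedResolvent_apply hψ f).2
  have h1' : inner ℂ (reducedResolvent ψ f) ψ = 0 := by rw [← inner_conj_symm, h1, map_zero]
  refine ⟨y f, y g, ?_, ?_, fun h => by rw [h]⟩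
  · rw [sub_apply, one_apply_eq_self, hy2 g, ← inner_gHalf_left hc, ← hy1 f, inner_sub_right,
      inner_smul_right, h1', mul_zero, sub_zero]
  · rw [sub_apply, one_apply_eq_self, hy2 f, inner_gHalf_left hc, ← hy1 g, inner_sub_left,
      inner_smul_left, k1, mul_zero, sub_zero]

theorem reducedResolvent_symm {ψ : L2} (hψ : IsPekarMinimizer ψ) (f g : L2) :
    inner ℂ (reducedResolvent ψ f) g = inner ℂ f (reducedResolvent ψ g) := by
  have hc : 0 < -pekarMu ψ := neg_pos.2 (pekarMu_neg hψ)
  obtain ⟨y, z, h1, h2, -⟩ := inner_reducedResolvent hψ f g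
  rw [h1, h2, one_sub_bOp_symm hψ.memH1 hc]

theorem reducedResolvent_nonneg {ψ : L2} (hψ : IsPekarMinimizer ψ) (f : L2) :
    0 ≤ (inner ℂ f (reducedResolvent ψ f)).re := by
  have hc : 0 < -pekarMu ψ := neg_pos.2 (pekarMu_neg hψ)
  obtain ⟨y, z, h1, -, h3⟩ := inner_reducedResolvent hψ f f
  rw [← reducedResolvent_symm hψ, h1, h3 rfl]
  have := le_re_inner_one_sub_bOp hψ hc z
  rwa [add_neg_cancel, zero_mul] at this

theorem eq_smul_of_reducedResolvent_eq_zero {ψ : L2} (hψ : IsPekarMinimizer ψ) {f : L2}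
    (hf : reducedResolvent ψ f = 0) : f = inner ℂ ψ f • ψ := by
  have hc : 0 < -pekarMu ψ := neg_pos.2 (pekarMu_neg hψ)
  obtain ⟨-, y, h2, h3⟩ := reducedResolvent_apply hψ f
  rw [hf] at h2
  have hy : y = 0 := gHalf_injective hc (by rw [← h2, map_zero])
  rw [hy, map_zero, sub_zero] at h3
  have := gHalf_injective hc (h3.symm.trans (map_zero _).symm)
  exact sub_eq_zero.1 this

/-! ### The operators `f ↦ m_K 𝓕(ψ f)` -/

/-- The operator defined by a square integrable kernel. -/
theorem exists_operator_of_kernel {N : E3 → L2} {b : E3 → ℝ}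
    (hb : MemLp b 2 (volume : Measure E3)) (hN : ∀ x, ‖N x‖ ≤ b x)
    (hm : ∀ f, AEStronglyMeasurable (fun x => inner ℂ (N x) f) (volume : Measure E3)) :
    ∃ A : L2 →L[ℂ] L2, ∀ f, A f =ᵐ[volume] fun x => inner ℂ (N x) f := by
  have hle : ∀ f x, ‖inner ℂ (N x) f‖ ≤ ‖f‖ * ‖b x‖ := fun f x => by
    refine (norm_inner_le_norm _ _).trans ?_
    rw [mul_comm]
    gcongr
    exact (hN x).trans (le_abs_self _)
  have hmem : ∀ f, MemLp (fun x => inner ℂ (N x) f) 2 (volume : Measure E3) := fun f =>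
    hb.of_le_mul (hm f) (Eventually.of_forall (hle f))
  let T : L2 →ₗ[ℂ] L2 :=
    { toFun := fun f => (hmem f).toLp _
      map_add' := fun f g => by
        refine Lp.ext ?_
        filter_upwards [(hmem (f + g)).coeFn_toLp, (hmem f).coeFn_toLp, (hmem g).coeFn_toLp,
          Lp.coeFn_add ((hmem f).toLp _) ((hmem g).toLp _)] with x h1 h2 h3 h4
        rw [h1, h4, Pi.add_apply, h2, h3, inner_add_right]
      map_smul' := fun c f => by
        refine Lp.ext ?_
        filter_upwards [(hmem (c • f)).coeFn_toLp, (hmem f).coeFn_toLp,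
          Lp.coeFn_smul c ((hmem f).toLp _)] with x h1 h2 h4
        rw [h1, RingHom.id_apply, h4, Pi.smul_apply, h2, inner_smul_right, smul_eq_mul] }
  refine ⟨T.mkContinuous ‖hb.toLp b‖ fun f => ?_, fun f => (hmem f).coeFn_toLp⟩
  rw [mul_comm]
  refine Lp.norm_le_mul_norm_of_ae_le_mul ?_
  filter_upwards [(hmem f).coeFn_toLp, hb.coeFn_toLp] with x h1 h2
  rw [h2]
  refine le_trans (le_of_eq ?_) (hle f x)
  exact congrArg _ h1

/-- The Fourier symbol of the form factor with cutoff `K`. -/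
def msym (K : ℝ≥0∞) (ξ : E3) : ℝ :=
  {ξ : E3 | ENNReal.ofReal (2 * Real.pi * ‖ξ‖) ≤ K}.indicator (fun ξ => (2 * Real.pi * ‖ξ‖)⁻¹) ξ

theorem measurableSet_cutoff (K : ℝ≥0∞) :
    MeasurableSet {ξ : E3 | ENNReal.ofReal (2 * Real.pi * ‖ξ‖) ≤ K} := by
  refine measurableSet_le ?_ measurable_const
  fun_prop

theorem measurable_msym (K : ℝ≥0∞) : Measurable (msym K) := by
  unfold msym
  exact Measurable.indicator (by fun_prop) (measurableSet_cutoff K)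

theorem msym_nonneg (K : ℝ≥0∞) (ξ : E3) : 0 ≤ msym K ξ := by
  have := Real.pi_pos
  exact Set.indicator_nonneg (fun _ _ => by positivity) ξ

theorem msym_top (ξ : E3) : msym ∞ ξ = (2 * Real.pi * ‖ξ‖)⁻¹ := by
  unfold msym
  rw [Set.indicator_of_mem (by simp)]

theorem msym_le_top (K : ℝ≥0∞) (ξ : E3) : msym K ξ ≤ msym ∞ ξ := by
  have := Real.pi_pos
  rw [msym_top]
  exact Set.indicator_le_self' (fun _ _ => by positivity) ξ

theorem integrableOn_ball_pow_inv' {k : ℕ} (hk : k ≤ 2) (r : ℝ) :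
    IntegrableOn (fun x : E3 => (‖x‖⁻¹) ^ k) (Metric.ball 0 r) := by
  refine (integrableOn_fun_norm_addHaar (volume : Measure E3) (f := fun r : ℝ => (r⁻¹) ^ k)).2 ?_
  rw [finrank_euclideanSpace_fin]
  have : IntegrableOn (fun r : ℝ => r ^ (2 - k)) (Set.Ioo 0 r) :=
    (Continuous.integrableOn_Icc (a := 0) (b := r) (by fun_prop)).mono_set Set.Ioo_subset_Icc_self
  refine this.congr_fun (fun r hr => ?_) measurableSet_Ioo
  have hr : r ≠ 0 := hr.1.ne'
  simp only [smul_eq_mul]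
  rw [pow_sub₀ _ hr hk, inv_pow]

theorem integrable_msym_pow {K : ℝ≥0∞} (hK : K ≠ ∞) {k : ℕ} (hk : k ≤ 2) (hk0 : k ≠ 0) :
    Integrable fun ξ => msym K ξ ^ k := by
  have hpi := Real.pi_pos
  have h1 := (integrable_indicator_iff (measurableSet_ball (x := (0 : E3))
    (ε := K.toReal + 1))).2 (integrableOn_ball_pow_inv' hk (K.toReal + 1))
  refine h1.mono' ((measurable_msym K).pow_const k).aestronglyMeasurable
    (Eventually.of_forall fun ξ => ?_)
  rw [Real.norm_eq_abs, abs_of_nonneg (pow_nonneg (msym_nonneg K ξ) k)]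
  unfold msym
  by_cases h : ENNReal.ofReal (2 * Real.pi * ‖ξ‖) ≤ K
  · rw [Set.indicator_of_mem (by exact h)]
    have h2 : 2 * Real.pi * ‖ξ‖ ≤ K.toReal := by
      rw [← ENNReal.toReal_ofReal (by positivity : 0 ≤ 2 * Real.pi * ‖ξ‖)]
      exact ENNReal.toReal_mono hK h
    have h3 : ‖ξ‖ ≤ 2 * Real.pi * ‖ξ‖ := by
      have := Real.two_le_pi
      nlinarith [norm_nonneg ξ]
    have h4 : ξ ∈ Metric.ball (0 : E3) (K.toReal + 1) := mem_ball_zero_iff.2 (by linarith)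
    rw [Set.indicator_of_mem h4]
    rcases eq_or_lt_of_le (norm_nonneg ξ) with h0 | h0
    · rw [← h0]; simp
    · gcongr
  · rw [Set.indicator_of_notMem (by exact h), zero_pow hk0]
    exact Set.indicator_nonneg (fun _ _ => by positivity) ξ

theorem measurable_msym_complex (K : ℝ≥0∞) : Measurable fun ξ => (msym K ξ : ℂ) :=
  Complex.measurable_ofReal.comp (measurable_msym K)

theorem memLp_one_msym {K : ℝ≥0∞} (hK : K ≠ ∞) :
    MemLp (fun ξ => (msym K ξ : ℂ)) 1 (volume : Measure E3) := by
  have := integrable_msym_pow hK (k := 1) (by norm_num) one_ne_zero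
  simp only [pow_one] at this
  exact memLp_one_iff_integrable.2 this.ofReal

theorem memLp_two_msym {K : ℝ≥0∞} (hK : K ≠ ∞) :
    MemLp (fun ξ => (msym K ξ : ℂ)) 2 (volume : Measure E3) := by
  rw [memLp_two_iff_integrable_sq_norm (measurable_msym_complex K).aestronglyMeasurable]
  simpa only [Complex.norm_real, Real.norm_eq_abs, sq_abs] using
    integrable_msym_pow hK (k := 2) le_rfl two_ne_zero

theorem memLp_top_of_ae_le {ψ : L2} {L : ℝ} (h : ∀ᵐ x, ‖ψ x‖ ≤ L) :
    MemLp ψ ∞ (volume : Measure E3) :=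
  memLp_top_of_bound (Lp.aestronglyMeasurable ψ) L h

theorem memLp_top_pekarMinimizer {ψ : L2} (hψ : IsPekarMinimizer ψ) :
    MemLp ψ ∞ (volume : Measure E3) := by
  obtain ⟨L, -, h⟩ := exists_ae_norm_le hψ
  exact memLp_top_of_ae_le h

theorem integrable_mulOp {ψ : L2} (hψ : MemLp ψ ∞ (volume : Measure E3)) (f : L2) :
    Integrable (mulOp ψ f) :=
  (integrable_mul_of_memLp_two (Lp.memLp ψ) f).congr (coeFn_mulOp hψ f).symm

/-- The function `x ↦ conj (exp (-2πi x·ξ) ψ(x))`. -/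
def expLp (ψ : L2) (ξ : E3) : L2 := charLp (Lp.memLp ψ) (-ξ)

theorem norm_expLp (ψ : L2) (ξ : E3) : ‖expLp ψ ξ‖ = ‖ψ‖ := by
  unfold expLp
  rw [norm_charLp, Lp.toLp_coeFn]

theorem F2_mulOp_ae_eq {ψ : L2} (hψ : MemLp ψ ∞ (volume : Measure E3)) (f : L2) :
    F2 (mulOp ψ f) =ᵐ[volume] fun ξ => inner ℂ (expLp ψ ξ) f := by
  filter_upwards [F2_ae_eq_fourier (integrable_mulOp hψ f)] with ξ h
  rw [h, expLp, ← fourierInv_mul_eq_inner, Real.fourierInv_eq_fourier_neg, neg_neg]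
  rw [Real.fourier_eq', Real.fourier_eq']
  refine integral_congr_ae ?_
  filter_upwards [coeFn_mulOp hψ f] with x hx
  rw [hx]

/-- Existence of the operator `f ↦ m_K F(ψ f)`. -/
theorem exists_aOp_of_ne_top {ψ : L2} (hψ : MemLp ψ ∞ (volume : Measure E3)) {K : ℝ≥0∞}
    (hK : K ≠ ∞) : ∃ A : L2 →L[ℂ] L2,
    (∀ f, A f =ᵐ[volume] fun ξ => (msym K ξ : ℂ) * F2 (mulOp ψ f) ξ) ∧ IsCompactOperator A := by
  have hb : MemLp (fun ξ => msym K ξ * ‖ψ‖) 2 (volume : Measure E3) := by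
    have := (memLp_two_msym hK).norm.mul_const ‖ψ‖
    refine this.ae_eq (Eventually.of_forall fun ξ => ?_)
    simp only [Complex.norm_real, Real.norm_eq_abs, abs_of_nonneg (msym_nonneg K ξ)]
  have hN : ∀ ξ, ‖(msym K ξ : ℂ) • expLp ψ ξ‖ ≤ msym K ξ * ‖ψ‖ := fun ξ => by
    rw [norm_smul, norm_expLp, Complex.norm_real, Real.norm_eq_abs, abs_of_nonneg (msym_nonneg K ξ)]
  have he : ∀ f : L2, (fun ξ => inner ℂ ((msym K ξ : ℂ) • expLp ψ ξ) f) =ᵐ[volume]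
      fun ξ => (msym K ξ : ℂ) * F2 (mulOp ψ f) ξ := fun f => by
    filter_upwards [F2_mulOp_ae_eq hψ f] with ξ h
    rw [h, inner_smul_left, Complex.conj_ofReal]
  obtain ⟨A, hA⟩ := exists_operator_of_kernel hb hN fun f =>
    (((measurable_msym_complex K).aestronglyMeasurable.mul
      (Lp.aestronglyMeasurable (F2 (mulOp ψ f)))).congr (he f).symm)
  exact ⟨A, fun f => (hA f).trans (he f), isCompactOperator_of_kernel hb hN hA⟩

/-- The high momentum part of the symbol. -/
def msymHigh (K : ℝ≥0∞) (ξ : E3) : ℝ := msym ∞ ξ - msym K ξ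

theorem msymHigh_nonneg (K : ℝ≥0∞) (ξ : E3) : 0 ≤ msymHigh K ξ := sub_nonneg.2 (msym_le_top K ξ)

theorem msymHigh_le {K : ℝ} (hK : 0 < K) (ξ : E3) : msymHigh (ENNReal.ofReal K) ξ ≤ K⁻¹ := by
  unfold msymHigh
  rw [msym_top]
  unfold msym
  by_cases h : ENNReal.ofReal (2 * Real.pi * ‖ξ‖) ≤ ENNReal.ofReal K
  · rw [Set.indicator_of_mem (by exact h), sub_self]
    positivity
  · rw [Set.indicator_of_notMem (by exact h), sub_zero]
    rw [ENNReal.ofReal_le_ofReal_iff hK.le, not_le] at h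
    gcongr

theorem memLp_msymHigh {K : ℝ} (hK : 0 < K) :
    MemLp (fun ξ => (msymHigh (ENNReal.ofReal K) ξ : ℂ)) ∞ (volume : Measure E3) := by
  have hm : Measurable fun ξ => (msymHigh (ENNReal.ofReal K) ξ : ℂ) :=
    Complex.measurable_ofReal.comp ((measurable_msym ∞).sub (measurable_msym _))
  refine memLp_top_of_bound hm.aestronglyMeasurable K⁻¹ (Eventually.of_forall fun ξ => ?_)
  rw [Complex.norm_real, Real.norm_eq_abs, abs_of_nonneg (msymHigh_nonneg _ ξ)]
  exact msymHigh_le hK ξ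

/-- For `K = ∞` the symbol is split at momentum one: the low part is square integrable and gives a
kernel operator, the high part is bounded. -/
theorem exists_aOp {ψ : L2} (hψ : MemLp ψ ∞ (volume : Measure E3)) (K : ℝ≥0∞) :
    ∃ A : L2 →L[ℂ] L2, ∀ f, A f =ᵐ[volume] fun ξ => (msym K ξ : ℂ) * F2 (mulOp ψ f) ξ := by
  by_cases hK : K = ∞
  · obtain ⟨A, hA, -⟩ := exists_aOp_of_ne_top hψ (K := ENNReal.ofReal 1) ENNReal.ofReal_ne_top
    refine ⟨A + mulOp (fun ξ => (msymHigh (ENNReal.ofReal 1) ξ : ℂ)) ∘L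
      (F2.toContinuousLinearEquiv : L2 →L[ℂ] L2) ∘L mulOp ψ, fun f => ?_⟩
    have h1 : (A + mulOp (fun ξ => (msymHigh (ENNReal.ofReal 1) ξ : ℂ)) ∘L
      (F2.toContinuousLinearEquiv : L2 →L[ℂ] L2) ∘L mulOp ψ) f =
      A f + mulOp (fun ξ => (msymHigh (ENNReal.ofReal 1) ξ : ℂ)) (F2 (mulOp ψ f)) := rfl
    rw [h1]
    filter_upwards [hA f, coeFn_mulOp (memLp_msymHigh one_pos) (F2 (mulOp ψ f)),
      Lp.coeFn_add (A f) (mulOp (fun ξ => (msymHigh (ENNReal.ofReal 1) ξ : ℂ)) (F2 (mulOp ψ f)))]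
      with ξ h2 h3 h4
    rw [h4, Pi.add_apply, h2, h3, hK, msymHigh]
    push_cast
    ring
  · obtain ⟨A, hA, -⟩ := exists_aOp_of_ne_top hψ hK
    exact ⟨A, hA⟩

/-- The operator `f ↦ m_K F(ψ f)`. -/
def aOp (ψ : L2) (K : ℝ≥0∞) : L2 →L[ℂ] L2 :=
  open Classical in if h : MemLp ψ ∞ (volume : Measure E3) then (exists_aOp h K).choose else 0

theorem coeFn_aOp {ψ : L2} (hψ : MemLp ψ ∞ (volume : Measure E3)) (K : ℝ≥0∞) (f : L2) :
    aOp ψ K f =ᵐ[volume] fun ξ => (msym K ξ : ℂ) * F2 (mulOp ψ f) ξ := by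
  unfold aOp
  rw [dif_pos hψ]
  exact (exists_aOp hψ K).choose_spec f

/-- The cutoff removes only momenta above `K`, where the symbol is at most `1/K`. This is the source
of the convergence rate. -/
theorem norm_aOp_sub_le {ψ : L2} {L : ℝ} (hL : 0 ≤ L) (hψ : ∀ᵐ x, ‖ψ x‖ ≤ L) {K : ℝ}
    (hK : 0 < K) : ‖aOp ψ ∞ - aOp ψ (ENNReal.ofReal K)‖ ≤ K⁻¹ * L := by
  have hψ' := memLp_top_of_ae_le hψ
  refine ContinuousLinearMap.opNorm_le_bound _ (by positivity) fun f => ?_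
  rw [sub_apply]
  have h1 : ‖aOp ψ ∞ f - aOp ψ (ENNReal.ofReal K) f‖ ≤ K⁻¹ * ‖F2 (mulOp ψ f)‖ := by
    refine norm_toLp_le_of_bound (by positivity) ?_
    filter_upwards [Lp.coeFn_sub (aOp ψ ∞ f) (aOp ψ (ENNReal.ofReal K) f), coeFn_aOp hψ' ∞ f,
      coeFn_aOp hψ' (ENNReal.ofReal K) f] with ξ h1 h2 h3
    rw [h1, Pi.sub_apply, h2, h3, ← sub_mul, norm_mul, ← Complex.ofReal_sub, Complex.norm_real,
      Real.norm_eq_abs]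
    have h4 := msymHigh_nonneg (ENNReal.ofReal K) ξ
    have h5 := msymHigh_le hK ξ
    unfold msymHigh at h4 h5
    rw [abs_of_nonneg h4]
    gcongr
  rw [F2.norm_map] at h1
  refine h1.trans ?_
  rw [mul_assoc]
  have := ((mulOp ψ).le_opNorm f).trans (mul_le_mul_of_nonneg_right (norm_mulOp_le hψ' hL hψ)
    (norm_nonneg f))
  gcongr

/-- Hilbert-Schmidt for finite `K`, and a norm limit of such operators for `K = ∞`. -/
theorem isCompactOperator_aOp {ψ : L2} (hψ : IsPekarMinimizer ψ) (K : ℝ≥0∞) :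
    IsCompactOperator (aOp ψ K) := by
  have hψ' := memLp_top_pekarMinimizer hψ
  have hfin : ∀ K : ℝ≥0∞, K ≠ ∞ → IsCompactOperator (aOp ψ K) := by
    intro K hK
    obtain ⟨A, hA, hc⟩ := exists_aOp_of_ne_top hψ' hK
    have : aOp ψ K = A := by
      ext1 f
      exact Lp.ext ((coeFn_aOp hψ' K f).trans (hA f).symm)
    rwa [this]
  by_cases hK : K = ∞
  · rw [hK]
    obtain ⟨L, hL, hLb⟩ := exists_ae_norm_le hψ
    have hlim : Tendsto (fun n : ℕ => aOp ψ (ENNReal.ofReal (n + 1))) atTop (𝓝 (aOp ψ ∞)) := by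
      rw [tendsto_iff_norm_sub_tendsto_zero]
      have h1 : Tendsto (fun n : ℕ => ((n : ℝ) + 1)⁻¹ * L) atTop (𝓝 0) := by
        have := (tendsto_one_div_add_atTop_nhds_zero_nat (𝕜 := ℝ)).mul_const L
        simpa using this
      refine squeeze_zero (fun _ => norm_nonneg _) (fun n => ?_) h1
      rw [norm_sub_rev]
      exact norm_aOp_sub_le hL.le hLb (by positivity)
    exact isCompactOperator_of_tendsto hlim
      (Eventually.of_forall fun n => hfin _ ENNReal.ofReal_ne_top)
  · exact hfin K hK

theorem norm_aOp_le (ψ : L2) (K : ℝ≥0∞) : ‖aOp ψ K‖ ≤ ‖aOp ψ ∞‖ := by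
  by_cases hψ : MemLp ψ ∞ (volume : Measure E3)
  · refine ContinuousLinearMap.opNorm_le_bound _ (norm_nonneg _) fun f => ?_
    refine le_trans ?_ ((aOp ψ ∞).le_opNorm f)
    refine Lp.norm_le_norm_of_ae_le ?_
    filter_upwards [coeFn_aOp hψ K f, coeFn_aOp hψ ∞ f] with ξ h1 h2
    rw [h1, h2, norm_mul, norm_mul, Complex.norm_real, Complex.norm_real, Real.norm_eq_abs,
      Real.norm_eq_abs, abs_of_nonneg (msym_nonneg _ _), abs_of_nonneg (msym_nonneg _ _)]
    gcongr
    exact msym_le_top K ξ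
  · unfold aOp
    rw [dif_neg hψ, dif_neg hψ]

/-! ### Identification of the smearing integrals with bounded operators -/

/-- The operator `v ↦ ψ (h_K * v)`. -/
def smearOp (ψ : L2) (K : ℝ≥0∞) : L2 →L[ℂ] L2 :=
  (ContinuousLinearMap.adjoint (aOp ψ K)) ∘L (F2.toContinuousLinearEquiv : L2 →L[ℂ] L2)

theorem inner_smearOp (ψ : L2) (K : ℝ≥0∞) (f v : L2) :
    inner ℂ f (smearOp ψ K v) = inner ℂ (aOp ψ K f) (F2 v) := by
  have h : smearOp ψ K v = ContinuousLinearMap.adjoint (aOp ψ K) (F2 v) := rfl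
  rw [h, ContinuousLinearMap.adjoint_inner_right]

theorem inner_aOp {ψ : L2} (hψ : MemLp ψ ∞ (volume : Measure E3)) (K : ℝ≥0∞) (f v : L2) :
    Integrable (fun ξ => (msym K ξ : ℂ) * (F2 v ξ * conj (F2 (mulOp ψ f) ξ))) ∧
    inner ℂ (aOp ψ K f) (F2 v) =
      ∫ ξ, (msym K ξ : ℂ) * (F2 v ξ * conj (F2 (mulOp ψ f) ξ)) := by
  have e : (fun ξ => F2 v ξ * conj (aOp ψ K f ξ)) =ᵐ[volume]
      fun ξ => (msym K ξ : ℂ) * (F2 v ξ * conj (F2 (mulOp ψ f) ξ)) := by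
    filter_upwards [coeFn_aOp hψ K f] with ξ h
    rw [h, map_mul, Complex.conj_ofReal]
    ring
  exact ⟨(integrable_inner _ _).congr e, by rw [inner_eq_integral, integral_congr_ae e]⟩

theorem toL2_eq {f : E3 → ℂ} (h : MemLp f 2 (volume : Measure E3)) : toL2 f = h.toLp f := by
  unfold toL2
  rw [dif_pos h]

theorem conj_pekarMinimizer {ψ : L2} (hψ : IsPekarMinimizer ψ) : ∀ᵐ x, conj (ψ x) = ψ x := by
  filter_upwards [hψ.pos] with x hx
  exact Complex.conj_eq_iff_im.2 hx.2

/-- Rescaling `k = 2πξ`: the Jacobian cancels the prefactor `(2π)⁻³`. -/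
theorem cutoffFormFactor_eq {K : ℝ≥0∞} (hK : K ≠ ∞) (x y : E3) :
    cutoffFormFactor K x y = 𝓕⁻ (fun ξ => (msym K ξ : ℂ)) (x - y) := by
  have hpi := Real.pi_pos
  set z := x - y
  unfold cutoffFormFactor
  rw [if_neg hK]
  have hS : MeasurableSet {k : E3 | ‖k‖ ≤ K.toReal} := measurableSet_le (by fun_prop) measurable_const
  rw [← integral_indicator hS]
  set F : E3 → ℂ := {k : E3 | ‖k‖ ≤ K.toReal}.indicator
    fun k => Complex.exp (Complex.I * ((inner ℝ k z : ℝ) : ℂ)) / (‖k‖ : ℂ) with hF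
  have h := Measure.integral_comp_smul (volume : Measure E3) F (2 * Real.pi)
  rw [finrank_euclideanSpace_fin] at h
  rw [Real.fourierInv_eq']
  have e : ∀ ξ : E3, F ((2 * Real.pi) • ξ) =
      Complex.exp (↑(2 * Real.pi * inner ℝ ξ z) * Complex.I) • (msym K ξ : ℂ) := by
    intro ξ
    have hn : ‖(2 * Real.pi) • ξ‖ = 2 * Real.pi * ‖ξ‖ := by
      rw [norm_smul, Real.norm_eq_abs, abs_of_pos (by positivity)]
    have hiff : 2 * Real.pi * ‖ξ‖ ≤ K.toReal ↔ ENNReal.ofReal (2 * Real.pi * ‖ξ‖) ≤ K := by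
      rw [ENNReal.ofReal_le_iff_le_toReal hK]
    rw [hF]
    unfold msym
    by_cases hξ : ENNReal.ofReal (2 * Real.pi * ‖ξ‖) ≤ K
    · rw [Set.indicator_of_mem (by
        change ‖(2 * Real.pi) • ξ‖ ≤ K.toReal
        rw [hn]; exact hiff.2 hξ), Set.indicator_of_mem (by exact hξ), hn, inner_smul_left, smul_eq_mul, div_eq_mul_inv,
        Complex.ofReal_inv, mul_comm Complex.I]
      rfl
    · rw [Set.indicator_of_notMem (by
        change ¬ ‖(2 * Real.pi) • ξ‖ ≤ K.toReal
        rw [hn, hiff]; exact hξ), Set.indicator_of_notMem (by exact hξ), Complex.ofReal_zero, smul_zero]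
  simp_rw [e] at h
  rw [h, abs_of_pos (by positivity), Complex.real_smul]
  push_cast
  rfl

theorem continuous_fourierInv {g : E3 → ℂ} (hg : Integrable g) : Continuous (𝓕⁻ g) :=
  VectorFourier.fourierIntegral_continuous Real.continuous_fourierChar
    (by exact (continuous_inner (𝕜 := ℝ) (E := E3)).neg) hg

theorem integral_fourierInv_mul {g q : E3 → ℂ} (hg : Integrable g) (hq : Integrable q) :
    ∫ x, 𝓕⁻ g x * conj (q x) = ∫ ξ, g ξ * conj (𝓕 q ξ) := by
  have hq' : Integrable fun x => conj (q x) := by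
    rw [← memLp_one_iff_integrable] at hq ⊢
    exact memLp_conj hq
  have h2 := VectorFourier.integral_fourierIntegral_smul_eq_flip (L := -innerₗ E3) (μ := volume)
    (ν := volume) Real.continuous_fourierChar
    (by exact (continuous_inner (𝕜 := ℝ) (E := E3)).neg) hg hq'
  have hfl : (-innerₗ E3).flip = -innerₗ E3 := by
    ext x y; simp [real_inner_comm]
  simp only [hfl, smul_eq_mul] at h2
  refine h2.trans ?_
  refine integral_congr_ae (Eventually.of_forall fun ξ => ?_)
  have : 𝓕⁻ (fun x => conj (q x)) ξ = conj (𝓕 q ξ) := by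
    rw [Real.fourierInv_eq', Real.fourier_eq', ← integral_conj]
    refine integral_congr_ae (Eventually.of_forall fun x => ?_)
    simp only [smul_eq_mul, map_mul]
    rw [← Complex.exp_conj]
    congr 2
    simp
    exact Or.inl (Complex.conj_ofNat 2).symm
  change g ξ * 𝓕⁻ (fun x => conj (q x)) ξ = _
  rw [this]

theorem smear_cutoff_eq_of_ne_top {ψ : L2} (hψ : IsPekarMinimizer ψ) {K : ℝ≥0∞} (hK : K ≠ ∞)
    (v : L2) : smear ψ (cutoffFormFactor K) v = smearOp ψ K v := by
  have hψ' := memLp_top_pekarMinimizer hψ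
  have h1 := memLp_one_msym hK
  have h2 := memLp_two_msym hK
  have hg : Integrable fun ξ => (msym K ξ : ℂ) * F2 v ξ := integrable_mul_of_memLp_two h2 _
  have hI : ∀ x, ∫ y, cutoffFormFactor K x y * v y =
      𝓕⁻ (fun ξ => (msym K ξ : ℂ) * F2 v ξ) x := by
    intro x
    simp_rw [cutoffFormFactor_eq hK]
    exact integral_fourierInv_sub_mul h1 h2 v x
  -- `toL2` returns zero outside `L²`, so square integrability has to be proved before the smeared
  -- function is known to be the intended one.
  have hmem : MemLp (fun x => (∫ y, cutoffFormFactor K x y * v y) * ψ x) 2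
      (volume : Measure E3) := by
    simp_rw [hI]
    have hb : MemLp (𝓕⁻ fun ξ => (msym K ξ : ℂ) * F2 v ξ) ∞ (volume : Measure E3) := by
      refine memLp_top_of_continuous (continuous_fourierInv hg)
        (C := ‖h2.toLp _‖ * ‖v‖) fun x => ?_
      rw [fourierInv_mul_eq_inner h2]
      refine (norm_inner_le_norm _ _).trans ?_
      rw [norm_charLp, F2.norm_map]
    exact (Lp.memLp ψ).mul hb
  have hs : smear ψ (cutoffFormFactor K) v = hmem.toLp _ := toL2_eq hmem
  refine ext_inner_left ℂ fun f => ?_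
  rw [inner_smearOp, (inner_aOp hψ' K f v).2, hs, inner_eq_integral]
  have e1 : ∫ x, hmem.toLp _ x * conj (f x) =
      ∫ x, 𝓕⁻ (fun ξ => (msym K ξ : ℂ) * F2 v ξ) x * conj (mulOp ψ f x) := by
    refine integral_congr_ae ?_
    filter_upwards [hmem.coeFn_toLp, coeFn_mulOp hψ' f, conj_pekarMinimizer hψ] with x k1 k2 k3
    rw [k1, k2, hI, map_mul, k3]
    ring
  rw [e1, integral_fourierInv_mul hg (integrable_mulOp hψ' f)]
  refine integral_congr_ae ?_
  filter_upwards [F2_ae_eq_fourier (integrable_mulOp hψ' f)] with ξ h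
  rw [h]
  ring

/-- The absolute Riesz potential of `v`. -/
def absRiesz (v : L2) (x : E3) : ℝ≥0∞ := ∫⁻ y, ENNReal.ofReal (riesz (x - y)) * ‖v y‖ₑ

theorem measurable_enorm_coe (v : L2) : Measurable fun x => ‖v x‖ₑ :=
  (Lp.stronglyMeasurable v).measurable.enorm

theorem measurable_absRiesz (v : L2) : Measurable (absRiesz v) := by
  have : Measurable fun p : E3 × E3 => ENNReal.ofReal (riesz (p.1 - p.2)) * ‖v p.2‖ₑ :=
    measurable_riesz_sub_prod.mul ((measurable_enorm_coe v).comp measurable_snd)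
  exact this.lintegral_prod_right'

/-- The local part of the Riesz kernel. -/
def rieszLoc (x : E3) : ℝ≥0∞ := (Metric.ball (0 : E3) 1).indicator (fun x => ENNReal.ofReal (riesz x)) x

/-- The decaying part of the Riesz kernel. -/
def rieszFar (x : E3) : ℝ≥0∞ :=
  (Metric.ball (0 : E3) 1)ᶜ.indicator (fun x => ENNReal.ofReal (riesz x)) x

theorem rieszLoc_add_rieszFar (x : E3) : rieszLoc x + rieszFar x = ENNReal.ofReal (riesz x) :=
  Set.indicator_self_add_compl_apply _ _ x

theorem measurable_rieszLoc : Measurable rieszLoc :=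
  Measurable.indicator measurable_riesz.ennreal_ofReal measurableSet_ball

theorem measurable_rieszFar : Measurable rieszFar :=
  Measurable.indicator measurable_riesz.ennreal_ofReal measurableSet_ball.compl

theorem lintegral_rieszLoc_lt_top : ∫⁻ x, rieszLoc x < ∞ := by
  have h := (integrableOn_ball_pow_inv (k := 2) le_rfl).const_mul (1 / (2 * Real.pi ^ 2))
  have h2 := h.lintegral_lt_top
  unfold rieszLoc
  rw [lintegral_indicator measurableSet_ball]
  refine lt_of_le_of_lt (lintegral_mono fun x => ?_) h2
  refine ENNReal.ofReal_le_ofReal (le_of_eq ?_)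
  unfold riesz
  rw [inv_pow]
  field_simp

theorem lintegral_rieszFar_sq_lt_top : ∫⁻ x, rieszFar x ^ 2 < ∞ := by
  have hpi := Real.pi_pos
  have h1 := integrable_rpow_neg_one_add_norm_sq (E := E3) (μ := volume) (r := 4)
    (by rw [finrank_euclideanSpace_fin]; norm_num)
  refine lt_of_le_of_lt (lintegral_mono fun x => ?_) (h1.lintegral_lt_top)
  unfold rieszFar
  by_cases hx : x ∈ Metric.ball (0 : E3) 1
  · rw [Set.indicator_of_notMem (Set.notMem_compl_iff.2 hx)]
    simp
  · rw [Set.indicator_of_mem (by exact hx), ← ENNReal.ofReal_pow (riesz_nonneg x)]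
    refine ENNReal.ofReal_le_ofReal ?_
    rw [mem_ball_zero_iff, not_lt] at hx
    rw [show (-(4 : ℝ) / 2) = -((2 : ℕ) : ℝ) by norm_num, Real.rpow_neg (by positivity),
      Real.rpow_natCast, ← inv_pow]
    refine pow_le_pow_left₀ (riesz_nonneg x) ?_ 2
    unfold riesz
    rw [one_div]
    refine inv_anti₀ (by positivity) ?_
    have : 1 ≤ ‖x‖ ^ 2 := one_le_pow₀ hx
    have h2 : (4 : ℝ) ≤ Real.pi ^ 2 := by nlinarith [Real.two_le_pi]
    nlinarith

theorem lintegral_sub_left_eq (g : E3 → ℝ≥0∞) (x : E3) : ∫⁻ y, g (x - y) = ∫⁻ y, g y :=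
  lintegral_sub_left_eq_self g x

theorem lintegral_mul_sq_le {k g : E3 → ℝ≥0∞} (hk : Measurable k) (hg : Measurable g) :
    (∫⁻ y, k y * g y) ^ 2 ≤ (∫⁻ y, k y) * ∫⁻ y, k y * g y ^ 2 := by
  have hpq : (2 : ℝ).HolderConjugate 2 := Real.HolderConjugate.two_two
  have h := ENNReal.lintegral_mul_le_Lp_mul_Lq (volume : Measure E3) hpq
    (f := fun y => k y ^ (1 / 2 : ℝ)) (g := fun y => k y ^ (1 / 2 : ℝ) * g y)
    (hk.pow_const _).aemeasurable ((hk.pow_const _).mul hg).aemeasurable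
  have e0 : ∀ a : ℝ≥0∞, a ^ (1 / 2 : ℝ) * a ^ (1 / 2 : ℝ) = a := fun a => by
    rw [← ENNReal.rpow_add_of_nonneg _ _ (by norm_num) (by norm_num)]
    norm_num
  have e0' : ∀ a : ℝ≥0∞, (a ^ (1 / 2 : ℝ)) ^ 2 = a := fun a => by rw [sq, e0]
  have e1 : ∫⁻ y, ((fun y => k y ^ (1 / 2 : ℝ)) * fun y => k y ^ (1 / 2 : ℝ) * g y) y =
      ∫⁻ y, k y * g y := by
    refine lintegral_congr fun y => ?_
    simp only [Pi.mul_apply]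
    rw [← mul_assoc, e0]
  rw [e1] at h
  calc (∫⁻ y, k y * g y) ^ 2 ≤ _ := pow_le_pow_left₀ (zero_le) h 2
    _ = _ := by
      rw [mul_pow, e0', e0']
      simp only [ENNReal.rpow_two, mul_pow, e0']

/-- `ψ` times a Riesz potential is square integrable. -/
theorem lintegral_absRiesz_mul_sq_lt_top {ψ : L2} {L : ℝ} (hL : ∀ᵐ x, ‖ψ x‖ ≤ L) (v : L2) :
    ∫⁻ x, (absRiesz v x * ‖ψ x‖ₑ) ^ 2 < ∞ := by
  set N : E3 → ℝ≥0∞ := fun x => ∫⁻ y, rieszLoc (x - y) * ‖v y‖ₑ with hN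
  set C : ℝ≥0∞ := (∫⁻ x, rieszFar x ^ 2) + ∫⁻ y, ‖v y‖ₑ ^ 2 with hC
  have hCt : C < ∞ := ENNReal.add_lt_top.2 ⟨lintegral_rieszFar_sq_lt_top, by
    rw [lintegral_enorm_sq]; exact ENNReal.ofReal_lt_top⟩
  have hsub : ∀ x : E3, Measurable fun y : E3 => x - y := fun x => by fun_prop
  -- The far part of the kernel is square integrable and contributes a bounded function, to be
  -- multiplied by `ψ ∈ L²`; the local part is integrable, keeps `v` in `L²`, and is multiplied by
  -- the bounded `ψ`.
  have hle : ∀ x, absRiesz v x ≤ N x + C := by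
    intro x
    unfold absRiesz
    simp_rw [← rieszLoc_add_rieszFar, add_mul]
    have hm1 : Measurable fun y => rieszLoc (x - y) * ‖v y‖ₑ :=
      (measurable_rieszLoc.comp (hsub x)).mul (measurable_enorm_coe v)
    have hm2 : Measurable fun y => rieszFar (x - y) ^ 2 :=
      (measurable_rieszFar.comp (hsub x)).pow_const 2
    rw [lintegral_add_left hm1]
    refine add_le_add_right ?_ _
    rw [hC, ← lintegral_sub_left_eq (fun z => rieszFar z ^ 2) x,
      ← lintegral_add_left hm2]
    refine lintegral_mono fun y => ?_
    generalize rieszFar (x - y) = a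
    generalize ‖v y‖ₑ = b
    rcases le_total a b with h | h
    · calc a * b ≤ b * b := by gcongr
        _ ≤ a ^ 2 + b ^ 2 := by rw [sq b]; exact le_add_self
    · calc a * b ≤ a * a := by gcongr
        _ ≤ a ^ 2 + b ^ 2 := by rw [sq a]; exact le_self_add
  have hNm : Measurable N := by
    have hs : Measurable fun p : E3 × E3 => p.1 - p.2 := by fun_prop
    have : Measurable fun p : E3 × E3 => rieszLoc (p.1 - p.2) * ‖v p.2‖ₑ :=
      (measurable_rieszLoc.comp hs).mul ((measurable_enorm_coe v).comp measurable_snd)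
    exact this.lintegral_prod_right'
  have hN2 : ∫⁻ x, N x ^ 2 < ∞ := by
    have h1 : ∀ x, N x ^ 2 ≤ (∫⁻ z, rieszLoc z) * ∫⁻ y, rieszLoc (x - y) * ‖v y‖ₑ ^ 2 := by
      intro x
      rw [← lintegral_sub_left_eq rieszLoc x]
      exact lintegral_mul_sq_le (measurable_rieszLoc.comp (hsub x)) (measurable_enorm_coe v)
    refine lt_of_le_of_lt (lintegral_mono h1) ?_
    rw [lintegral_const_mul' _ _ lintegral_rieszLoc_lt_top.ne]
    refine ENNReal.mul_lt_top lintegral_rieszLoc_lt_top ?_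
    have hm : Measurable fun p : E3 × E3 => rieszLoc (p.1 - p.2) * ‖v p.2‖ₑ ^ 2 := by
      have hs : Measurable fun p : E3 × E3 => p.1 - p.2 := by fun_prop
      exact (measurable_rieszLoc.comp hs).mul
        (((measurable_enorm_coe v).comp measurable_snd).pow_const 2)
    rw [lintegral_lintegral_swap hm.aemeasurable]
    have h2 : ∀ y, ∫⁻ x, rieszLoc (x - y) * ‖v y‖ₑ ^ 2 = (∫⁻ z, rieszLoc z) * ‖v y‖ₑ ^ 2 := by
      intro y
      have hs : Measurable fun x : E3 => x - y := by fun_prop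
      have hm1 : Measurable fun x : E3 => rieszLoc (x - y) := measurable_rieszLoc.comp hs
      rw [lintegral_mul_const _ hm1]
      congr 1
      exact lintegral_sub_right_eq_self rieszLoc y
    simp_rw [h2]
    rw [lintegral_const_mul' _ _ lintegral_rieszLoc_lt_top.ne, lintegral_enorm_sq]
    exact ENNReal.mul_lt_top lintegral_rieszLoc_lt_top ENNReal.ofReal_lt_top
  have hfin : ∀ᵐ x, (absRiesz v x * ‖ψ x‖ₑ) ^ 2 ≤
      2 * (ENNReal.ofReal (L ^ 2) * N x ^ 2) + 2 * (C ^ 2 * ‖ψ x‖ₑ ^ 2) := by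
    filter_upwards [hL] with x hx
    have h2 : ‖ψ x‖ₑ ^ 2 ≤ ENNReal.ofReal (L ^ 2) := by
      rw [← ofReal_norm, ← ENNReal.ofReal_pow (norm_nonneg _)]
      exact ENNReal.ofReal_le_ofReal (pow_le_pow_left₀ (norm_nonneg _) hx 2)
    have h3 : ∀ a b : ℝ≥0∞, (a + b) ^ 2 ≤ 2 * a ^ 2 + 2 * b ^ 2 := by
      intro a b
      have := ENNReal.rpow_add_le_mul_rpow_add_rpow a b (p := 2) (by norm_num)
      norm_num at this
      calc (a + b) ^ 2 ≤ _ := this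
        _ = _ := by ring
    calc (absRiesz v x * ‖ψ x‖ₑ) ^ 2 ≤ ((N x + C) * ‖ψ x‖ₑ) ^ 2 := by
          gcongr; exact hle x
      _ = (N x + C) ^ 2 * ‖ψ x‖ₑ ^ 2 := mul_pow _ _ _
      _ ≤ (2 * N x ^ 2 + 2 * C ^ 2) * ‖ψ x‖ₑ ^ 2 := by gcongr; exact h3 _ _
      _ = 2 * (‖ψ x‖ₑ ^ 2 * N x ^ 2) + 2 * (C ^ 2 * ‖ψ x‖ₑ ^ 2) := by ring
      _ ≤ _ := by gcongr
  refine lt_of_le_of_lt (lintegral_mono_ae hfin) ?_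
  rw [lintegral_add_left (((hNm.pow_const 2).const_mul _).const_mul _),
    lintegral_const_mul' _ _ (by norm_num), lintegral_const_mul' _ _ ENNReal.ofReal_ne_top,
    lintegral_const_mul' _ _ (by norm_num), lintegral_const_mul' _ _ (ENNReal.pow_ne_top hCt.ne),
    lintegral_enorm_sq]
  refine ENNReal.add_lt_top.2 ⟨?_, ?_⟩
  · exact ENNReal.mul_lt_top (by norm_num) (ENNReal.mul_lt_top ENNReal.ofReal_lt_top hN2)
  · exact ENNReal.mul_lt_top (by norm_num) (ENNReal.mul_lt_top (ENNReal.pow_lt_top hCt)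
      ENNReal.ofReal_lt_top)

theorem integral_heat_eq_riesz {x : E3} (hx : x ≠ 0) :
    ∫ a in Set.Ioi (0 : ℝ), 2 / Real.sqrt Real.pi * heat a x = riesz x := by
  have hs : 0 < Real.sqrt Real.pi := Real.sqrt_pos.2 Real.pi_pos
  have hm : Measurable fun a : ℝ => heat a x :=
    measurable_heat.comp (measurable_id.prodMk measurable_const)
  rw [integral_const_mul, integral_eq_lintegral_of_nonneg_ae
    ((ae_restrict_iff' measurableSet_Ioi).2
      (Eventually.of_forall fun a ha => (heat_pos ha x).le)) hm.aestronglyMeasurable,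
    lintegral_heat hx, ENNReal.toReal_ofReal (mul_nonneg (by positivity) (riesz_nonneg x))]
  field_simp

/-- Fubini after writing the Riesz kernel as a superposition of heat kernels. Absolute integrability
is exactly the finiteness of the pairing with absolute values. -/
theorem integral_riesz_eq_heat (v g : L2) (hfin : ∫⁻ x, absRiesz v x * ‖g x‖ₑ < ∞) :
    ∫ x, (∫ y, (riesz (x - y) : ℂ) * v y) * conj (g x) =
      ∫ a in Set.Ioi (0 : ℝ), ((2 / Real.sqrt Real.pi : ℝ) : ℂ) * inner ℂ g (heatOp a v) := by
  have hs : 0 < Real.sqrt Real.pi := Real.sqrt_pos.2 Real.pi_pos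
  set c : ℝ := 2 / Real.sqrt Real.pi with hc
  have hc0 : 0 < c := by positivity
  have hvm := (Lp.stronglyMeasurable v).measurable
  have hgm := (Lp.stronglyMeasurable g).measurable
  set Θ : (E3 × E3) × ℝ → ℂ := fun q =>
    ((c * heat q.2 (q.1.1 - q.1.2) : ℝ) : ℂ) * (v q.1.2 * conj (g q.1.1)) with hΘ
  have hh : Measurable fun q : (E3 × E3) × ℝ => heat q.2 (q.1.1 - q.1.2) := by
    have : Measurable fun q : (E3 × E3) × ℝ => (q.2, q.1.1 - q.1.2) := by fun_prop
    exact measurable_heat.comp this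
  have hΘm : Measurable Θ := by
    have h1 : Measurable fun q : (E3 × E3) × ℝ => v q.1.2 :=
      hvm.comp (measurable_snd.comp measurable_fst)
    have h2 : Measurable fun q : (E3 × E3) × ℝ => g q.1.1 :=
      hgm.comp (measurable_fst.comp measurable_fst)
    have h3 : Measurable fun q : (E3 × E3) × ℝ => conj (g q.1.1) :=
      Complex.continuous_conj.measurable.comp h2
    have h4 : Measurable fun q : (E3 × E3) × ℝ => ((c * heat q.2 (q.1.1 - q.1.2) : ℝ) : ℂ) :=
      Complex.measurable_ofReal.comp (hh.const_mul c)
    exact h4.mul (h1.mul h3)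
  have hinner : ∀ x y : E3, x - y ≠ 0 →
      ∫⁻ a in Set.Ioi (0 : ℝ), ‖Θ ((x, y), a)‖ₑ =
        ENNReal.ofReal (riesz (x - y)) * ‖v y‖ₑ * ‖g x‖ₑ := by
    intro x y hxy
    have e : ∀ a ∈ Set.Ioi (0 : ℝ), ‖Θ ((x, y), a)‖ₑ =
        ENNReal.ofReal (heat a (x - y)) * (ENNReal.ofReal c * (‖v y‖ₑ * ‖g x‖ₑ)) := by
      intro a ha
      rw [hΘ]
      simp only [enorm_mul]
      rw [RCLike.enorm_conj, ← ofReal_norm, Complex.norm_real, Real.norm_eq_abs, abs_of_pos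
        (mul_pos hc0 (heat_pos ha _)), ENNReal.ofReal_mul hc0.le]
      ring
    have hm : Measurable fun a : ℝ => ENNReal.ofReal (heat a (x - y)) :=
      (measurable_heat.comp (measurable_id.prodMk measurable_const)).ennreal_ofReal
    rw [setLIntegral_congr_fun measurableSet_Ioi e, lintegral_mul_const _ hm, lintegral_heat hxy,
      ← mul_assoc, ← ENNReal.ofReal_mul (mul_nonneg (by positivity) (riesz_nonneg _)), ← mul_assoc]
    congr 3
    rw [hc]
    field_simp
  have hne : ∀ x : E3, ∀ᵐ y : E3, x - y ≠ 0 := by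
    intro x
    have : ∀ᵐ y : E3, y ≠ x := by simp [ae_iff]
    filter_upwards [this] with y hy
    exact sub_ne_zero.2 hy.symm
  have hΘI : Integrable Θ ((volume.prod volume).prod (volume.restrict (Set.Ioi (0 : ℝ)))) := by
    refine ⟨hΘm.aestronglyMeasurable, ?_⟩
    unfold HasFiniteIntegral
    rw [lintegral_prod _ hΘm.enorm.aemeasurable,
      lintegral_prod _ hΘm.enorm.lintegral_prod_right'.aemeasurable]
    refine lt_of_le_of_lt (lintegral_mono fun x => ?_) hfin
    rw [lintegral_congr_ae ((hne x).mono fun y hy => hinner x y hy)]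
    have hm : Measurable fun y => ENNReal.ofReal (riesz (x - y)) * ‖v y‖ₑ :=
      (measurable_riesz_sub x).mul (measurable_enorm_coe v)
    rw [lintegral_mul_const _ hm]
    exact le_rfl
  have hswap := integral_integral_swap (f := fun (p : E3 × E3) (a : ℝ) => Θ (p, a)) hΘI
  have hL : ∫ p : E3 × E3, (∫ a in Set.Ioi (0 : ℝ), Θ (p, a)) ∂(volume.prod volume) =
      ∫ x, (∫ y, (riesz (x - y) : ℂ) * v y) * conj (g x) := by
    rw [integral_prod _ hΘI.integral_prod_left]
    refine integral_congr_ae (Eventually.of_forall fun x => ?_)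
    change ∫ y, ∫ a in Set.Ioi (0 : ℝ), Θ ((x, y), a) = _
    beta_reduce
    rw [← integral_mul_const]
    refine integral_congr_ae ?_
    filter_upwards [hne x] with y hy
    rw [hΘ]
    simp only
    rw [integral_mul_const, integral_complex_ofReal, integral_heat_eq_riesz hy]
    ring
  have hR : ∫ a in Set.Ioi (0 : ℝ), ∫ p : E3 × E3, Θ (p, a) ∂(volume.prod volume) =
      ∫ a in Set.Ioi (0 : ℝ), (c : ℂ) * inner ℂ g (heatOp a v) := by
    refine integral_congr_ae ?_
    filter_upwards [hΘI.prod_left_ae, ae_restrict_mem measurableSet_Ioi] with a ha ha0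
    have ha0 : 0 < a := ha0
    rw [integral_prod _ ha, inner_heatOp ha0, ← integral_const_mul]
    refine integral_congr_ae (Eventually.of_forall fun x => ?_)
    change ∫ y, Θ ((x, y), a) = _
    beta_reduce
    rw [← integral_mul_const, ← integral_const_mul]
    refine integral_congr_ae (Eventually.of_forall fun y => ?_)
    rw [hΘ]
    push_cast
    ring
  rw [← hL, ← hR]
  exact hswap

/-- Without cutoff the symbol `1/(2π|ξ|)` is neither integrable nor square integrable, so the
convolution formula used for finite `K` does not apply. Instead the kernel and the symbol are
recognized as the same superposition of the heat semigroup. -/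
theorem smear_riesz_eq {ψ : L2} (hψ : IsPekarMinimizer ψ) (v : L2) :
    smear ψ (fun x y => (riesz (x - y) : ℂ)) v = smearOp ψ ∞ v := by
  have hψ' := memLp_top_pekarMinimizer hψ
  obtain ⟨L, hL0, hL⟩ := exists_ae_norm_le hψ
  have hsq := lintegral_absRiesz_mul_sq_lt_top hL v
  have hle : ∀ x, ‖∫ y, (riesz (x - y) : ℂ) * v y‖ₑ ≤ absRiesz v x := by
    intro x
    refine (enorm_integral_le_lintegral_enorm _).trans (lintegral_mono fun y => ?_)
    rw [enorm_mul, ← ofReal_norm, Complex.norm_real, Real.norm_eq_abs, abs_of_nonneg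
      (riesz_nonneg _)]
  have hIm : StronglyMeasurable fun x => ∫ y, (riesz (x - y) : ℂ) * v y := by
    have hs : Measurable fun p : E3 × E3 => p.1 - p.2 := by fun_prop
    have h1 : Measurable fun p : E3 × E3 => (riesz (p.1 - p.2) : ℂ) :=
      Complex.measurable_ofReal.comp (measurable_riesz.comp hs)
    have h2 : Measurable fun p : E3 × E3 => v p.2 :=
      (Lp.stronglyMeasurable v).measurable.comp measurable_snd
    exact (h1.mul h2).stronglyMeasurable.integral_prod_right'
  have hmem : MemLp (fun x => (∫ y, (riesz (x - y) : ℂ) * v y) * ψ x) 2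
      (volume : Measure E3) := by
    refine ⟨hIm.aestronglyMeasurable.mul (Lp.aestronglyMeasurable ψ), ?_⟩
    rw [eLpNorm_lt_top_iff_lintegral_rpow_enorm_lt_top (by norm_num) (by norm_num)]
    refine lt_of_le_of_lt (lintegral_mono fun x => ?_) hsq
    rw [ENNReal.toReal_ofNat, ENNReal.rpow_two, enorm_mul]
    gcongr
    exact hle x
  have hsm : smear ψ (fun x y => (riesz (x - y) : ℂ)) v = hmem.toLp _ := toL2_eq hmem
  refine ext_inner_left ℂ fun f => ?_
  set g := mulOp ψ f with hg
  have hgx : ∀ᵐ x, g x = ψ x * f x := coeFn_mulOp hψ' f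
  have hfin : ∫⁻ x, absRiesz v x * ‖g x‖ₑ < ∞ := by
    have h1 : ∀ᵐ x, absRiesz v x * ‖g x‖ₑ ≤ (absRiesz v x * ‖ψ x‖ₑ) ^ 2 + ‖f x‖ₑ ^ 2 := by
      filter_upwards [hgx] with x hx
      rw [hx, enorm_mul, ← mul_assoc]
      generalize absRiesz v x * ‖ψ x‖ₑ = a
      generalize ‖f x‖ₑ = b
      rcases le_total a b with h | h
      · calc a * b ≤ b * b := by gcongr
          _ ≤ a ^ 2 + b ^ 2 := by rw [sq b]; exact le_add_self
      · calc a * b ≤ a * a := by gcongr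
          _ ≤ a ^ 2 + b ^ 2 := by rw [sq a]; exact le_self_add
    refine lt_of_le_of_lt (lintegral_mono_ae h1) ?_
    have hm : Measurable fun x => (absRiesz v x * ‖ψ x‖ₑ) ^ 2 :=
      ((measurable_absRiesz v).mul (measurable_enorm_coe ψ)).pow_const 2
    rw [lintegral_add_left hm]
    exact ENNReal.add_lt_top.2 ⟨hsq, by rw [lintegral_enorm_sq]; exact ENNReal.ofReal_lt_top⟩
  have hF := inner_aOp hψ' ∞ f v
  simp_rw [msym_top] at hF
  have h2 := integral_inner_heatOp (ω := fun _ => 2 / Real.sqrt Real.pi) measurable_const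
    (fun a _ => by positivity) (fun ξ hξ => integral_heatSym_riesz hξ) g v hF.1
  rw [inner_smearOp, hF.2, ← h2.2, ← integral_riesz_eq_heat v g hfin, hsm, inner_eq_integral]
  refine integral_congr_ae ?_
  filter_upwards [hmem.coeFn_toLp, hgx, conj_pekarMinimizer hψ] with x k1 k2 k3
  rw [k1, k2, map_mul, k3]
  ring

theorem smear_cutoff_eq {ψ : L2} (hψ : IsPekarMinimizer ψ) (K : ℝ≥0∞) (v : L2) :
    smear ψ (cutoffFormFactor K) v = smearOp ψ K v := by
  by_cases hK : K = ∞
  · have e : cutoffFormFactor K = fun x y => (riesz (x - y) : ℂ) := by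
      funext x y
      unfold cutoffFormFactor
      rw [if_pos hK]
      rfl
    rw [e, hK, smear_riesz_eq hψ]
  · exact smear_cutoff_eq_of_ne_top hψ hK v

theorem toL2_neg (f : E3 → ℂ) : toL2 (fun x => -f x) = -toL2 f := by
  unfold toL2
  by_cases h : MemLp f 2 (volume : Measure E3)
  · have h' : MemLp (fun x => -f x) 2 (volume : Measure E3) := h.neg
    rw [dif_pos h, dif_pos h']
    exact MemLp.toLp_neg h
  · rw [dif_neg h, dif_neg, neg_zero]
    intro h'
    apply h
    refine h'.neg.ae_eq (Eventually.of_forall fun x => ?_)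
    simp

theorem smear_formFactor_eq {ψ : L2} (hψ : IsPekarMinimizer ψ) (v : L2) :
    smear ψ (fun x y => (formFactor x y : ℂ)) v = -smearOp ψ ∞ v := by
  rw [← smear_riesz_eq hψ]
  unfold smear
  rw [← toL2_neg]
  congr 1
  funext x
  simp_rw [formFactor_eq, Complex.ofReal_neg, neg_mul]
  rw [integral_neg, neg_mul]

/-! ### The Hessians as bounded operators -/

/-- The inverse Fourier transform as a bounded operator. -/
def F2inv : L2 →L[ℂ] L2 := (F2.symm.toContinuousLinearEquiv : L2 →L[ℂ] L2)

/-- The adjoint of `smearOp ψ K`. -/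
def smearAdj (ψ : L2) (K : ℝ≥0∞) : L2 →L[ℂ] L2 := F2inv ∘L aOp ψ K

theorem F2_smearAdj (ψ : L2) (K : ℝ≥0∞) (f : L2) : F2 (smearAdj ψ K f) = aOp ψ K f :=
  F2.apply_symm_apply _

theorem norm_smearAdj (ψ : L2) (K : ℝ≥0∞) (f : L2) : ‖smearAdj ψ K f‖ = ‖aOp ψ K f‖ := by
  rw [← F2_smearAdj, F2.norm_map]

theorem inner_smearAdj_left (ψ : L2) (K : ℝ≥0∞) (f v : L2) :
    inner ℂ (smearAdj ψ K f) v = inner ℂ f (smearOp ψ K v) := by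
  rw [inner_smearOp, ← F2_smearAdj, inner_F2]

theorem inner_smearAdj_right (ψ : L2) (K : ℝ≥0∞) (v f : L2) :
    inner ℂ v (smearAdj ψ K f) = inner ℂ (smearOp ψ K v) f := by
  rw [← inner_conj_symm, inner_smearAdj_left, inner_conj_symm]

theorem norm_smearOp_le_of {ψ : L2} {K : ℝ≥0∞} {M : ℝ} (hM : 0 ≤ M)
    (h : ∀ f, ‖smearAdj ψ K f‖ ≤ M * ‖f‖) (v : L2) : ‖smearOp ψ K v‖ ≤ M * ‖v‖ := by
  have h1 : ‖smearOp ψ K v‖ * ‖smearOp ψ K v‖ ≤ M * ‖v‖ * ‖smearOp ψ K v‖ := by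
    rw [← inner_self_eq_norm_mul_norm (𝕜 := ℂ), ← inner_smearAdj_left]
    calc RCLike.re (inner ℂ (smearAdj ψ K (smearOp ψ K v)) v)
        ≤ ‖smearAdj ψ K (smearOp ψ K v)‖ * ‖v‖ := re_inner_le_norm _ _
      _ ≤ M * ‖smearOp ψ K v‖ * ‖v‖ := by gcongr; exact h _
      _ = _ := by ring
  rcases eq_or_lt_of_le (norm_nonneg (smearOp ψ K v)) with h0 | h0
  · rw [← h0]; positivity
  · exact le_of_mul_le_mul_right h1 h0

theorem norm_smearAdj_le (ψ : L2) (K : ℝ≥0∞) (f : L2) :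
    ‖smearAdj ψ K f‖ ≤ ‖aOp ψ ∞‖ * ‖f‖ := by
  rw [norm_smearAdj]
  exact (aOp ψ K).le_of_opNorm_le (norm_aOp_le ψ K) f

theorem norm_smearOp_le (ψ : L2) (K : ℝ≥0∞) (v : L2) :
    ‖smearOp ψ K v‖ ≤ ‖aOp ψ ∞‖ * ‖v‖ :=
  norm_smearOp_le_of (norm_nonneg _) (norm_smearAdj_le ψ K) v

/-- The operator `v ↦ (∫ h_·(y) ⟨ψ, · R (∫ h_·(z) v(z) dz) ψ⟩)` with cutoff `K`. -/
def hessOp (ψ : L2) (K : ℝ≥0∞) : L2 →L[ℂ] L2 :=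
  smearAdj ψ K ∘L reducedResolvent ψ ∘L smearOp ψ K

theorem hessOp_apply (ψ : L2) (K : ℝ≥0∞) (v : L2) :
    hessOp ψ K v = smearAdj ψ K (reducedResolvent ψ (smearOp ψ K v)) := rfl

theorem inner_hessOp (ψ : L2) (K : ℝ≥0∞) (v w : L2) : inner ℂ v (hessOp ψ K w) =
    inner ℂ (smearOp ψ K v) (reducedResolvent ψ (smearOp ψ K w)) :=
  inner_smearAdj_right _ _ _ _

variable {ψ : L2}

theorem hessOp_symm (hψ : IsPekarMinimizer ψ) (K : ℝ≥0∞) (v w : L2) :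
    inner ℂ (hessOp ψ K v) w = inner ℂ v (hessOp ψ K w) := by
  rw [inner_hessOp, ← inner_conj_symm, inner_hessOp, inner_conj_symm, reducedResolvent_symm hψ]

theorem isCompactOperator_hessOp (hψ : IsPekarMinimizer ψ) (K : ℝ≥0∞) :
    IsCompactOperator (hessOp ψ K) := by
  have h := ((isCompactOperator_aOp hψ K).clm_comp F2inv).comp_clm
    (reducedResolvent ψ ∘L smearOp ψ K)
  exact h

/-- The form factor of `H^Pek` has the opposite sign to that of `H_K` at `K = ∞`; the two minus
signs cancel in the quadratic expression. -/
theorem pekarHessian_apply (hψ : IsPekarMinimizer ψ) (v : L2) :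
    pekarHessian ψ v = v - (4 : ℂ) • hessOp ψ ∞ v := by
  have h : (opOfForm fun v w => inner ℂ (smear ψ (fun x y => (formFactor x y : ℂ)) v)
      (reducedResolvent ψ (smear ψ (fun x y => (formFactor x y : ℂ)) w))) = hessOp ψ ∞ := by
    refine opOfForm_eq fun v w => ?_
    rw [inner_hessOp, smear_formFactor_eq hψ, smear_formFactor_eq hψ, map_neg, inner_neg_neg]
  unfold pekarHessian
  rw [h]
  rfl

theorem mem_ker_pekarHessian (hψ : IsPekarMinimizer ψ) (v : L2) :
    v ∈ LinearMap.ker (pekarHessian ψ).toLinearMap ↔ (4 : ℂ) • hessOp ψ ∞ v = v := by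
  rw [LinearMap.mem_ker, ContinuousLinearMap.coe_coe, pekarHessian_apply hψ, sub_eq_zero, eq_comm]

theorem piOne_symm (ψ v w : L2) : inner ℂ (piOne ψ v) w = inner ℂ v (piOne ψ w) :=
  Submodule.inner_starProjection_left_eq_right _ _ _

theorem mem_ranPiOne_iff {v : L2} : v ∈ ranPiOne ψ ↔ piOne ψ v = v :=
  Submodule.starProjection_eq_self_iff.symm

theorem piOne_mem (ψ v : L2) : piOne ψ v ∈ ranPiOne ψ := Submodule.starProjection_apply_mem _ _

theorem piOne_piOne (ψ v : L2) : piOne ψ (piOne ψ v) = piOne ψ v :=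
  mem_ranPiOne_iff.1 (piOne_mem ψ v)

theorem sub_piOne_mem_ker (ψ v : L2) :
    v - piOne ψ v ∈ LinearMap.ker (pekarHessian ψ).toLinearMap := by
  have h : v - piOne ψ v ∈ (ranPiOne ψ)ᗮ := Submodule.sub_starProjection_mem_orthogonal v
  unfold ranPiOne at h
  rw [Submodule.orthogonal_orthogonal_eq_closure] at h
  have hcl : IsClosed (LinearMap.ker (pekarHessian ψ).toLinearMap : Set L2) :=
    (pekarHessian ψ).isClosed_ker
  rwa [hcl.submodule_topologicalClosure_eq] at h

theorem four_smul_hessOp_sub_piOne (hψ : IsPekarMinimizer ψ) (v : L2) :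
    (4 : ℂ) • hessOp ψ ∞ (v - piOne ψ v) = v - piOne ψ v :=
  (mem_ker_pekarHessian hψ _).1 (sub_piOne_mem_ker ψ v)

theorem norm_sub_piOne_le (ψ v : L2) : ‖v - piOne ψ v‖ ≤ ‖v‖ := by
  have h := Submodule.norm_starProjection_apply_le (ranPiOne ψ)ᗮ v
  rw [Submodule.starProjection_orthogonal_val] at h
  exact h

theorem norm_piOne_le (ψ v : L2) : ‖piOne ψ v‖ ≤ ‖v‖ :=
  Submodule.norm_starProjection_apply_le _ _

/-- `hessOp ψ ∞` is symmetric and acts as `1/4` on `Ker H^Pek`, so it preserves the orthogonal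
complement. -/
theorem hessOp_mem_ranPiOne (hψ : IsPekarMinimizer ψ) {v : L2} (hv : v ∈ ranPiOne ψ) :
    hessOp ψ ∞ v ∈ ranPiOne ψ := by
  unfold ranPiOne at hv ⊢
  rw [Submodule.mem_orthogonal] at hv ⊢
  intro w hw
  have h1 := hv w hw
  rw [mem_ker_pekarHessian hψ] at hw
  rw [← hessOp_symm hψ]
  rw [← hw, inner_smul_left] at h1
  exact (mul_eq_zero.1 h1).resolve_left (by simp)

theorem cutoffT_eq (hψ : IsPekarMinimizer ψ) (K : ℝ≥0∞) :
    cutoffT ψ K = piOne ψ ∘L hessOp ψ K ∘L piOne ψ := by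
  refine opOfForm_eq fun v w => ?_
  rw [smear_cutoff_eq hψ, smear_cutoff_eq hψ, ← inner_hessOp, piOne_symm]
  rfl

theorem cutoffHessian_apply (hψ : IsPekarMinimizer ψ) (K : ℝ≥0∞) (v : L2) :
    cutoffHessian ψ K v = piOne ψ v - (4 : ℂ) • piOne ψ (hessOp ψ K (piOne ψ v)) := by
  unfold cutoffHessian
  rw [cutoffT_eq hψ]
  change piOne ψ (piOne ψ v) - (4 : ℂ) • piOne ψ (hessOp ψ K (piOne ψ (piOne ψ v))) = _
  rw [piOne_piOne]

theorem piOne_cutoffHessian (hψ : IsPekarMinimizer ψ) (K : ℝ≥0∞) (v : L2) :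
    piOne ψ (cutoffHessian ψ K v) = cutoffHessian ψ K v := by
  rw [cutoffHessian_apply hψ, map_sub, map_smul, piOne_piOne, piOne_piOne]

theorem one_sub_cutoffHessian_apply (hψ : IsPekarMinimizer ψ) (K : ℝ≥0∞) (v : L2) :
    (1 - cutoffHessian ψ K : L2 →L[ℂ] L2) v =
      (v - piOne ψ v) + (4 : ℂ) • piOne ψ (hessOp ψ K (piOne ψ v)) := by
  rw [sub_apply, cutoffHessian_apply hψ]
  change v - _ = _
  abel

theorem isSymmetric_one_sub_cutoffHessian (hψ : IsPekarMinimizer ψ) (K : ℝ≥0∞) :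
    ((1 - cutoffHessian ψ K : L2 →L[ℂ] L2) : L2 →ₗ[ℂ] L2).IsSymmetric := by
  intro v w
  simp only [ContinuousLinearMap.coe_coe]
  rw [one_sub_cutoffHessian_apply hψ, one_sub_cutoffHessian_apply hψ, inner_add_left,
    inner_add_right, inner_sub_left, inner_sub_right, inner_smul_left, inner_smul_right,
    piOne_symm, piOne_symm, hessOp_symm hψ, piOne_symm, Complex.conj_ofNat]

/-- `1 - Π₁ = 4 hessOp (1 - Π₁)` without cutoff, because the range of `1 - Π₁` is `Ker H^Pek`. Thus
the projection onto the kernel is compact together with `hessOp ψ ∞`. -/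
theorem isCompactOperator_one_sub_cutoffHessian (hψ : IsPekarMinimizer ψ) (K : ℝ≥0∞) :
    IsCompactOperator (1 - cutoffHessian ψ K : L2 →L[ℂ] L2) := by
  have e : (1 - cutoffHessian ψ K : L2 →L[ℂ] L2) =
      (4 : ℂ) • hessOp ψ ∞ ∘L (1 - piOne ψ) + (4 : ℂ) • piOne ψ ∘L hessOp ψ K ∘L piOne ψ := by
    ext1 v
    rw [one_sub_cutoffHessian_apply hψ, ← four_smul_hessOp_sub_piOne hψ]
    rfl
  rw [e]
  have h1 : IsCompactOperator (hessOp ψ ∞ ∘L (1 - piOne ψ)) :=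
    (isCompactOperator_hessOp hψ ∞).comp_clm _
  have h2 : IsCompactOperator (piOne ψ ∘L hessOp ψ K ∘L piOne ψ) :=
    ((isCompactOperator_hessOp hψ K).comp_clm (piOne ψ)).clm_comp (piOne ψ)
  exact (h1.smul (4 : ℂ)).add (h2.smul (4 : ℂ))

theorem re_inner_one_sub_cutoffHessian (hψ : IsPekarMinimizer ψ) (K : ℝ≥0∞) (v : L2) :
    0 ≤ (inner ℂ v ((1 - cutoffHessian ψ K : L2 →L[ℂ] L2) v)).re := by
  have h1 : 0 ≤ (inner ℂ v (v - piOne ψ v)).re := by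
    have h := (Submodule.re_inner_starProjection_nonneg (ranPiOne ψ)ᗮ v)
    rw [Submodule.starProjection_orthogonal_val] at h
    rw [← inner_conj_symm, Complex.conj_re]
    exact h
  have h2 := reducedResolvent_nonneg hψ (smearOp ψ K (piOne ψ v))
  rw [one_sub_cutoffHessian_apply hψ, inner_add_right, Complex.add_re, inner_smul_right,
    ← piOne_symm, inner_hessOp]
  have : ((4 : ℂ) * inner ℂ (smearOp ψ K (piOne ψ v))
      (reducedResolvent ψ (smearOp ψ K (piOne ψ v)))).re =
      4 * (inner ℂ (smearOp ψ K (piOne ψ v))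
      (reducedResolvent ψ (smearOp ψ K (piOne ψ v)))).re := by
    have := Complex.re_ofReal_mul 4 (inner ℂ (smearOp ψ K (piOne ψ v))
      (reducedResolvent ψ (smearOp ψ K (piOne ψ v))))
    simpa using this
  rw [this]
  linarith

/-! ### The spectral gap and the number of eigenvalues `≥ 1` -/

section
variable {H : Type*} [NormedAddCommGroup H] [InnerProductSpace ℂ H] [CompleteSpace H]

/-- Eigenvalues near, but different from, one are excluded by a spectral gap. -/
theorem gap_le_abs_of_eigenvalue {C C' P : H →L[ℂ] H} (hP : ∀ x, C x - P (C x) = x - P x)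
    {c δ : ℝ} (hgap : ∀ x, P x = x → c * ‖x‖ ≤ ‖x - C' x‖)
    (hδ : ‖C - C'‖ ≤ δ) {τ : ℝ} (hτ : τ ≠ 1)
    (he : Module.End.eigenspace C.toLinearMap (τ : ℂ) ≠ ⊥) : c - δ ≤ |1 - τ| := by
  obtain ⟨x, hx, hx0⟩ := Submodule.exists_mem_ne_zero_of_ne_bot he
  rw [Module.End.mem_eigenspace_iff, ContinuousLinearMap.coe_coe] at hx
  have h1 := hP x
  rw [hx, map_smul, ← smul_sub, ← sub_eq_zero] at h1
  -- The component of an eigenvector outside the range of `P` is reproduced by `C`, so an eigenvalue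
  -- different from one forces `P x = x`, where the gap applies.
  have h2 : ((τ : ℂ) - 1) • (x - P x) = 0 := by rw [sub_smul, one_smul]; exact h1
  have h3 : P x = x := by
    rcases smul_eq_zero.1 h2 with h | h
    · exact absurd (by exact_mod_cast sub_eq_zero.1 h) hτ
    · exact (sub_eq_zero.1 h).symm
  have h4 := hgap x h3
  have h5 : x - C' x = ((1 - τ : ℝ) : ℂ) • x + (C - C') x := by
    rw [sub_apply, hx]
    push_cast
    rw [sub_smul, one_smul]
    abel
  have h6 : ‖x - C' x‖ ≤ |1 - τ| * ‖x‖ + δ * ‖x‖ := by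
    rw [h5]
    refine (norm_add_le _ _).trans (add_le_add ?_ ((C - C').le_of_opNorm_le hδ x))
    rw [norm_smul, Complex.norm_real, Real.norm_eq_abs]
  have hpos := norm_pos_iff.2 hx0
  have : c * ‖x‖ ≤ (|1 - τ| + δ) * ‖x‖ := by linarith
  linarith [le_of_mul_le_mul_right this hpos]

/-- Weyl's comparison is taken from level `1` to level `1 - c/2`. Since `c - δ ≥ 3c/4 > c/2`, `C'`
has no eigenvalue in `[1 - c/2, 1)`, and lowering the level adds nothing. -/
theorem finrank_spectralSum_one_le {C C' : H →L[ℂ] H} (hc : IsCompactOperator C)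
    (hs : (C : H →ₗ[ℂ] H).IsSymmetric) (hc' : IsCompactOperator C')
    (hs' : (C' : H →ₗ[ℂ] H).IsSymmetric) {c δ : ℝ} (hc1 : c ≤ 1) (hc0 : 0 < c)
    (hδc : δ ≤ c / 4) (hδ : ‖C - C'‖ ≤ δ)
    (hgap : ∀ τ : ℝ, τ ≠ 1 → Module.End.eigenspace C'.toLinearMap (τ : ℂ) ≠ ⊥ →
      c - δ ≤ |1 - τ|) :
    Module.finrank ℂ (spectralSum C (Set.Ici 1)) ≤
      Module.finrank ℂ (spectralSum C' (Set.Ici 1)) := by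
  have h := finrank_spectralSum_le hc hs hc' hs' hδ (τ := 1) (τ' := 1 - c / 2) (by linarith)
    (by linarith)
  have e : spectralSum C' (Set.Ici (1 - c / 2)) = spectralSum C' (Set.Ici 1) := by
    refine spectralSum_congr fun τ hτ => ?_
    rw [Set.mem_Ici, Set.mem_Ici]
    constructor
    · intro h1
      by_contra! h2
      have h3 := hgap τ h2.ne hτ
      rw [abs_of_pos (by linarith)] at h3
      linarith
    · intro h1
      linarith
  rwa [e] at h

end

variable {ψ : L2}

theorem one_sub_cutoffHessian_sub_piOne (hψ : IsPekarMinimizer ψ) (K : ℝ≥0∞) (v : L2) :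
    (1 - cutoffHessian ψ K : L2 →L[ℂ] L2) v - piOne ψ ((1 - cutoffHessian ψ K : L2 →L[ℂ] L2) v) =
      v - piOne ψ v := by
  have h : (1 - cutoffHessian ψ K : L2 →L[ℂ] L2) v = v - cutoffHessian ψ K v := rfl
  rw [h, map_sub, piOne_cutoffHessian hψ]
  abel

/-- An eigenvector of `4 Π₁ T_∞ Π₁` for eigenvalue one would lie both in `Ran Π₁` and in `Ker
H^Pek`. As the operator is compact, its difference from the identity is bounded below. -/
theorem exists_gap (hψ : IsPekarMinimizer ψ) : ∃ c : ℝ, 0 < c ∧ c ≤ 1 ∧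
    ∀ x, piOne ψ x = x → c * ‖x‖ ≤ ‖x - (1 - cutoffHessian ψ ∞ : L2 →L[ℂ] L2) x‖ := by
  set S : L2 →L[ℂ] L2 := (4 : ℂ) • piOne ψ ∘L hessOp ψ ∞ ∘L piOne ψ with hS
  have hSa : ∀ x, S x = (4 : ℂ) • piOne ψ (hessOp ψ ∞ (piOne ψ x)) := fun x => rfl
  have hSc : IsCompactOperator S :=
    (((isCompactOperator_hessOp hψ ∞).comp_clm (piOne ψ)).clm_comp (piOne ψ)).smul (4 : ℂ)
  have hno : ¬ Module.End.HasEigenvalue (S : Module.End ℂ L2) (1 : ℂ) := by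
    intro h
    obtain ⟨x, hx, hx0⟩ := Submodule.exists_mem_ne_zero_of_ne_bot h
    rw [Module.End.mem_eigenspace_iff, ContinuousLinearMap.coe_coe, one_smul] at hx
    have h1 : piOne ψ x = x := by
      rw [← hx, hSa, map_smul, piOne_piOne]
    have h1' := mem_ranPiOne_iff.2 h1
    have h2 : (4 : ℂ) • hessOp ψ ∞ x = x := by
      rw [hSa, h1, mem_ranPiOne_iff.1 (hessOp_mem_ranPiOne hψ h1')] at hx
      exact hx
    have h3 := (mem_ker_pekarHessian hψ x).2 h2
    unfold ranPiOne at h1'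
    exact hx0 (inner_self_eq_zero.1 ((Submodule.mem_orthogonal _ _).1 h1' x h3))
  obtain ⟨k, hk⟩ := IsCompactOperator.antilipschitz_of_not_hasEigenvalue hSc one_ne_zero hno
  have hk1 : ∀ x, ‖x‖ ≤ (k : ℝ) * ‖S x - x‖ := fun x => by
    have := hk.le_mul_dist x 0
    simpa [dist_eq_norm] using this
  have hk0 : (0 : ℝ) ≤ k := k.2
  -- The `+ 1` keeps the constant defined when `k = 0` and makes it at most one.
  refine ⟨((k : ℝ) + 1)⁻¹, by positivity, inv_le_one_of_one_le₀ (by linarith), fun x hx => ?_⟩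
  have e : (1 - cutoffHessian ψ ∞ : L2 →L[ℂ] L2) x = S x := by
    rw [one_sub_cutoffHessian_apply hψ, hSa, hx, sub_self, zero_add]
  rw [e, norm_sub_rev, inv_mul_le_iff₀ (by positivity)]
  exact (hk1 x).trans (by gcongr; linarith)

/-! ### Infinite rank of the smearing operator -/

/-- `f ↦ ψ · 𝓕⁻¹ f`. -/
def mulF2inv (ψ : L2) : L2 →L[ℂ] L2 := mulOp ψ ∘L F2inv

theorem mulF2inv_injective (hψ : IsPekarMinimizer ψ) : Function.Injective (mulF2inv ψ) := by
  refine (injective_iff_map_eq_zero _).2 fun f hf => ?_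
  have hψ' := memLp_top_pekarMinimizer hψ
  have h0 : F2inv f = 0 := by
    refine Lp.ext ?_
    have h1 : mulOp ψ (F2inv f) = 0 := hf
    have h2 := coeFn_mulOp hψ' (F2inv f)
    rw [h1] at h2
    filter_upwards [h2, Lp.coeFn_zero ℂ 2 (volume : Measure E3), hψ.pos] with x k1 k2 k3
    rw [k2] at k1 ⊢
    refine (mul_eq_zero.1 k1.symm).resolve_left fun h => ?_
    rw [h] at k3
    exact lt_irrefl _ k3.1
  have : F2 (F2inv f) = f := F2.apply_symm_apply f
  rw [← this, h0, map_zero]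

/-- An infinite dimensional piece of the range of `smearOp ψ K`. -/
theorem exists_linearIndependent_smearOp (hψ : IsPekarMinimizer ψ) {K : ℝ≥0∞} (hK : 1 ≤ K) :
    ∃ e : ℕ → L2, LinearIndependent ℂ fun n => smearOp ψ K (e n) := by
  have hpi := Real.pi_pos
  have hψ' := memLp_top_pekarMinimizer hψ
  set q : E3 → ℝ := fun ξ => 2 * Real.pi * ‖ξ‖ with hq
  have hqc : Continuous q := by fun_prop
  -- Disjoint momentum shells inside `2π|ξ| ≤ 1`, where no cutoff `K ≥ 1` is felt.
  set S : ℕ → Set E3 := fun n => q ⁻¹' Set.Ioo (((n : ℝ) + 2)⁻¹) (((n : ℝ) + 1)⁻¹) with hS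
  have hSo : ∀ n, IsOpen (S n) := fun n => isOpen_Ioo.preimage hqc
  have hSm : ∀ n, MeasurableSet (S n) := fun n => (hSo n).measurableSet
  have hSle : ∀ n, ∀ ξ ∈ S n, 0 < q ξ ∧ q ξ ≤ 1 := by
    intro n ξ hξ
    have h1 : ((n : ℝ) + 2)⁻¹ < q ξ := hξ.1
    have h2 : q ξ < ((n : ℝ) + 1)⁻¹ := hξ.2
    exact ⟨lt_trans (by positivity) h1, h2.le.trans (inv_le_one_of_one_le₀ (by linarith [n.cast_nonneg (α := ℝ)]))⟩
  have hSfin : ∀ n, volume (S n) ≠ ∞ := by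
    intro n
    refine ((measure_mono fun ξ hξ => ?_).trans_lt
      (measure_ball_lt_top (μ := volume) (x := (0 : E3)) (r := 1))).ne
    rw [mem_ball_zero_iff]
    have h1 := (hSle n ξ hξ).2
    have h2 : 2 * Real.pi * ‖ξ‖ ≤ 1 := h1
    have h3 := Real.pi_gt_three
    nlinarith [norm_nonneg ξ]
  have hSne : ∀ n, (S n).Nonempty := by
    intro n
    obtain ⟨t, ht⟩ := exists_between (show ((n : ℝ) + 2)⁻¹ < ((n : ℝ) + 1)⁻¹ from
      inv_strictAnti₀ (by positivity) (by linarith))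
    have ht0 : 0 < t := lt_trans (by positivity) ht.1
    refine ⟨EuclideanSpace.single 0 (t / (2 * Real.pi)), ?_⟩
    have : q (EuclideanSpace.single 0 (t / (2 * Real.pi))) = t := by
      rw [hq]
      simp only [PiLp.norm_single, Real.norm_eq_abs]
      rw [abs_of_pos (by positivity)]
      field_simp
    change q _ ∈ Set.Ioo _ _
    rw [this]
    exact ht
  have hSd : ∀ m n, m < n → S m ∩ S n = ∅ := by
    intro m n hmn
    rw [Set.eq_empty_iff_forall_notMem]
    rintro ξ ⟨h1, h2⟩
    have h1' : ((m : ℝ) + 2)⁻¹ < q ξ := h1.1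
    have h2' : q ξ < ((n : ℝ) + 1)⁻¹ := h2.2
    have h3 : ((n : ℝ) + 1)⁻¹ ≤ ((m : ℝ) + 2)⁻¹ := by
      refine inv_anti₀ (by positivity) ?_
      have : (m : ℝ) + 1 ≤ n := by exact_mod_cast hmn
      linarith
    linarith
  set g : ℕ → L2 := fun n => indicatorConstLp 2 (hSm n) (hSfin n) (1 : ℂ) with hg
  have hgne : ∀ n, g n ≠ 0 := by
    intro n h
    have h1 : ‖g n‖ = 0 := by rw [h, norm_zero]
    rw [hg] at h1
    simp only at h1
    rw [norm_indicatorConstLp (by norm_num) (by norm_num), norm_one, one_mul] at h1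
    have h2 : 0 < volume.real (S n) :=
      ENNReal.toReal_pos ((hSo n).measure_pos _ (hSne n)).ne' (hSfin n)
    exact (Real.rpow_pos_of_pos h2 _).ne' h1
  have hgo : ∀ m n, m ≠ n → inner ℂ (g m) (g n) = 0 := by
    intro m n hmn
    rw [hg]
    simp only
    rw [L2.inner_indicatorConstLp_one_indicatorConstLp_one (hSm m) (hSm n) (hSfin m) (hSfin n)]
    have : S m ∩ S n = ∅ := by
      rcases lt_or_gt_of_ne hmn with h | h
      · exact hSd m n h
      · rw [Set.inter_comm]; exact hSd n m h
    rw [this]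
    simp
  have hind : LinearIndependent ℂ g := linearIndependent_of_ne_zero_of_inner_eq_zero hgne hgo
  have hd : ∀ n, MemLp ((S n).indicator fun ξ => (q ξ : ℂ)) 2 (volume : Measure E3) := by
    intro n
    have : MemLp ((S n).indicator fun _ => (1 : ℂ)) 2 (volume : Measure E3) :=
      memLp_indicator_const 2 (hSm n) 1 (Or.inr (hSfin n))
    refine this.of_le ?_ (Eventually.of_forall fun ξ => ?_)
    · exact (Complex.measurable_ofReal.comp hqc.measurable).aestronglyMeasurable.indicator (hSm n)
    · by_cases h : ξ ∈ S n
      · rw [Set.indicator_of_mem h, Set.indicator_of_mem h, Complex.norm_real, Real.norm_eq_abs,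
          abs_of_pos (hSle n ξ h).1, norm_one]
        exact (hSle n ξ h).2
      · rw [Set.indicator_of_notMem h, Set.indicator_of_notMem h]
  refine ⟨fun n => F2inv ((hd n).toLp _), ?_⟩
  -- The test functions carry the factor `2π|ξ|` that cancels the symbol, so `smearOp` maps them to
  -- `ψ` times the inverse transforms of shell indicators. These stay independent because `ψ`
  -- vanishes almost nowhere.
  have e : (fun n => smearOp ψ K (F2inv ((hd n).toLp _))) = fun n => mulF2inv ψ (g n) := by
    funext n
    refine ext_inner_left ℂ fun f => ?_
    have hF : F2 (F2inv ((hd n).toLp _)) = (hd n).toLp _ := F2.apply_symm_apply _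
    have hG : F2 (F2inv (g n)) = g n := F2.apply_symm_apply _
    have h1 : inner ℂ f (mulF2inv ψ (g n)) = inner ℂ (F2 (mulOp ψ f)) (g n) := by
      conv_rhs => rw [← hG]
      rw [inner_F2, inner_mulOp_left hψ', inner_eq_integral, inner_eq_integral]
      refine integral_congr_ae ?_
      filter_upwards [coeFn_mulOp hψ' (F2inv (g n)), coeFn_mulOp (memLp_conj hψ') (F2inv (g n)),
        conj_pekarMinimizer hψ] with x k1 k2 k3
      rw [k2, k3, ← k1]
      rfl
    rw [h1, inner_smearOp, (inner_aOp hψ' K f _).2, hF, inner_eq_integral]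
    refine integral_congr_ae ?_
    filter_upwards [(hd n).coeFn_toLp, indicatorConstLp_coeFn (p := 2) (hs := hSm n)
      (hμs := hSfin n) (c := (1 : ℂ))] with ξ k1 k2
    have k2 : g n ξ = (S n).indicator (fun _ => (1 : ℂ)) ξ := k2
    rw [k1, k2, ← mul_assoc]
    congr 1
    by_cases h : ξ ∈ S n
    · obtain ⟨h1, h2⟩ := hSle n ξ h
      rw [Set.indicator_of_mem h, Set.indicator_of_mem h]
      unfold msym
      rw [Set.indicator_of_mem]
      · rw [← Complex.ofReal_mul, inv_mul_cancel₀ h1.ne', Complex.ofReal_one]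
      · change ENNReal.ofReal (q ξ) ≤ K
        refine le_trans ?_ hK
        rw [← ENNReal.ofReal_one]
        exact ENNReal.ofReal_le_ofReal h2
    · rw [Set.indicator_of_notMem h, Set.indicator_of_notMem h, mul_zero]
  rw [e]
  exact hind.map' (mulF2inv ψ).toLinearMap (LinearMap.ker_eq_bot.2 (mulF2inv_injective hψ))

/-- Otherwise the whole range of `smearOp ψ K` would lie in the image of `F` plus the line of `ψ`,
which is finite dimensional. -/
theorem exists_mem_orthogonal_smearOp_notMem (hψ : IsPekarMinimizer ψ) {K : ℝ≥0∞} (hK : 1 ≤ K)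
    (F : Submodule ℂ L2) [FiniteDimensional ℂ F] :
    ∃ x ∈ Fᗮ, smearOp ψ K x ∉ Submodule.span ℂ {ψ} := by
  by_contra! h
  obtain ⟨e, he⟩ := exists_linearIndependent_smearOp hψ hK
  set N : Submodule ℂ L2 := F.map (smearOp ψ K).toLinearMap ⊔ Submodule.span ℂ {ψ} with hN
  have hmem : ∀ v, smearOp ψ K v ∈ N := by
    intro v
    have : smearOp ψ K v = smearOp ψ K (F.starProjection v) +
        smearOp ψ K (v - F.starProjection v) := by
      rw [← map_add]
      congr 1
      abel
    rw [this]
    exact add_mem (Submodule.mem_sup_left ⟨_, Submodule.starProjection_apply_mem _ _, rfl⟩)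
      (Submodule.mem_sup_right (h _ (Submodule.sub_starProjection_mem_orthogonal v)))
  have hf : FiniteDimensional ℂ N := by rw [hN]; infer_instance
  have h2 : LinearIndependent ℂ fun n => (⟨smearOp ψ K (e n), hmem _⟩ : N) :=
    LinearIndependent.of_comp N.subtype he
  have := h2.finite
  exact not_finite ℕ

/-- A null vector `x` of `1 - H_K` lies in `Ran Π₁` and satisfies `⟨S_K x, R S_K x⟩ = 0`. By
positivity `R S_K x = 0`, so `S_K x` is a multiple of `ψ`, which is avoided by the choice of `x`. -/
theorem exists_mem_orthogonal_apply_ne_zero (hψ : IsPekarMinimizer ψ) {K : ℝ≥0∞} (hK : 1 ≤ K)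
    (F : Submodule ℂ L2) (hF : FiniteDimensional ℂ F) :
    ∃ x ∈ Fᗮ, (1 - cutoffHessian ψ K : L2 →L[ℂ] L2) x ≠ 0 := by
  obtain ⟨x, hx, hn⟩ := exists_mem_orthogonal_smearOp_notMem hψ hK F
  refine ⟨x, hx, fun h0 => hn ?_⟩
  have h1 := one_sub_cutoffHessian_sub_piOne hψ K x
  rw [h0, map_zero, sub_zero] at h1
  have h2 : piOne ψ x = x := (sub_eq_zero.1 h1.symm).symm
  rw [one_sub_cutoffHessian_apply hψ, h2, sub_self, zero_add] at h0
  have h3 := (smul_eq_zero.1 h0).resolve_left (by norm_num)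
  have h4 : inner ℂ (smearOp ψ K x) (reducedResolvent ψ (smearOp ψ K x)) = 0 := by
    rw [← inner_hessOp]
    conv_lhs => rw [← h2]
    rw [piOne_symm, h2, h3, inner_zero_right]
  have h5 := apply_eq_zero_of_nonneg (reducedResolvent_symm hψ) (reducedResolvent_nonneg hψ)
    (x := smearOp ψ K x) (by rw [h4]; rfl)
  rw [eq_smul_of_reducedResolvent_eq_zero hψ h5]
  exact Submodule.smul_mem _ _ (Submodule.mem_span_singleton_self ψ)

/-! ### Convergence rate in the cutoff -/

variable {ψ : L2}

theorem norm_hessOp_sub_le {L : ℝ} (hL : 0 ≤ L) (hψL : ∀ᵐ x, ‖ψ x‖ ≤ L) {K : ℝ} (hK : 0 < K)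
    (v : L2) : ‖hessOp ψ (ENNReal.ofReal K) v - hessOp ψ ∞ v‖ ≤
      2 * ‖aOp ψ ∞‖ * ‖reducedResolvent ψ‖ * (K⁻¹ * L) * ‖v‖ := by
  set k := ENNReal.ofReal K
  set A := ‖aOp ψ ∞‖
  set R := ‖reducedResolvent ψ‖
  have h0 : 0 ≤ K⁻¹ * L := by positivity
  have hd : ∀ f, ‖smearAdj ψ k f - smearAdj ψ ∞ f‖ ≤ K⁻¹ * L * ‖f‖ := by
    intro f
    rw [← F2.norm_map, map_sub, F2_smearAdj, F2_smearAdj, norm_sub_rev, ← sub_apply]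
    exact (aOp ψ ∞ - aOp ψ k).le_of_opNorm_le (norm_aOp_sub_le hL hψL hK) f
  have hd' : ∀ v, ‖smearOp ψ k v - smearOp ψ ∞ v‖ ≤ K⁻¹ * L * ‖v‖ := by
    intro v
    set x := smearOp ψ k v - smearOp ψ ∞ v with hx
    have h1 : ‖x‖ * ‖x‖ ≤ K⁻¹ * L * ‖v‖ * ‖x‖ := by
      rw [← inner_self_eq_norm_mul_norm (𝕜 := ℂ)]
      conv_lhs => rw [hx, inner_sub_right, ← inner_smearAdj_left, ← inner_smearAdj_left,
        ← inner_sub_left]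
      calc _ ≤ ‖smearAdj ψ k x - smearAdj ψ ∞ x‖ * ‖v‖ := re_inner_le_norm _ _
        _ ≤ K⁻¹ * L * ‖x‖ * ‖v‖ := by gcongr; exact hd x
        _ = _ := by ring
    rcases eq_or_lt_of_le (norm_nonneg x) with h | h
    · rw [← h]; positivity
    · exact le_of_mul_le_mul_right h1 h
  have hR : ∀ f, ‖reducedResolvent ψ f‖ ≤ R * ‖f‖ := (reducedResolvent ψ).le_opNorm
  -- Telescoping: one smearing factor is changed at a time, each change costing `L / K`.
  have e : hessOp ψ k v - hessOp ψ ∞ v =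
      smearAdj ψ k (reducedResolvent ψ (smearOp ψ k v - smearOp ψ ∞ v)) +
      (smearAdj ψ k (reducedResolvent ψ (smearOp ψ ∞ v)) -
        smearAdj ψ ∞ (reducedResolvent ψ (smearOp ψ ∞ v))) := by
    rw [hessOp_apply, hessOp_apply, map_sub, map_sub]
    abel
  rw [e]
  have hA : 0 ≤ A := norm_nonneg _
  have hR0 : 0 ≤ R := norm_nonneg _
  have h1 : ‖smearAdj ψ k (reducedResolvent ψ (smearOp ψ k v - smearOp ψ ∞ v))‖ ≤
      A * (R * (K⁻¹ * L * ‖v‖)) :=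
    (norm_smearAdj_le ψ k _).trans (mul_le_mul_of_nonneg_left ((hR _).trans
      (mul_le_mul_of_nonneg_left (hd' v) hR0)) hA)
  have h2 : ‖smearAdj ψ k (reducedResolvent ψ (smearOp ψ ∞ v)) -
        smearAdj ψ ∞ (reducedResolvent ψ (smearOp ψ ∞ v))‖ ≤ K⁻¹ * L * (R * (A * ‖v‖)) :=
    (hd _).trans (mul_le_mul_of_nonneg_left ((hR _).trans
      (mul_le_mul_of_nonneg_left (norm_smearOp_le ψ ∞ v) hR0)) h0)
  refine (norm_add_le _ _).trans ((add_le_add h1 h2).trans (le_of_eq ?_))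
  ring

theorem norm_cutoffHessian_sub_le (hψ : IsPekarMinimizer ψ) {L : ℝ} (hL : 0 ≤ L)
    (hψL : ∀ᵐ x, ‖ψ x‖ ≤ L) {K : ℝ} (hK : 0 < K) :
    ‖cutoffHessian ψ (ENNReal.ofReal K) - cutoffHessian ψ ∞‖ ≤
      8 * ‖aOp ψ ∞‖ * ‖reducedResolvent ψ‖ * L * K⁻¹ := by
  refine ContinuousLinearMap.opNorm_le_bound _ (by positivity) fun v => ?_
  have e : (cutoffHessian ψ (ENNReal.ofReal K) - cutoffHessian ψ ∞) v =
      -((4 : ℂ) • piOne ψ (hessOp ψ (ENNReal.ofReal K) (piOne ψ v) -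
        hessOp ψ ∞ (piOne ψ v))) := by
    rw [sub_apply, cutoffHessian_apply hψ, cutoffHessian_apply hψ, map_sub, smul_sub]
    abel
  rw [e, norm_neg, norm_smul, Complex.norm_ofNat]
  have h1 := norm_piOne_le ψ (hessOp ψ (ENNReal.ofReal K) (piOne ψ v) - hessOp ψ ∞ (piOne ψ v))
  have h2 := norm_hessOp_sub_le hL hψL hK (piOne ψ v)
  have h3 : 2 * ‖aOp ψ ∞‖ * ‖reducedResolvent ψ‖ * (K⁻¹ * L) * ‖piOne ψ v‖ ≤
      2 * ‖aOp ψ ∞‖ * ‖reducedResolvent ψ‖ * (K⁻¹ * L) * ‖v‖ := by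
    gcongr; exact norm_piOne_le ψ v
  calc _ ≤ 4 * (2 * ‖aOp ψ ∞‖ * ‖reducedResolvent ψ‖ * (K⁻¹ * L) * ‖v‖) := by linarith
    _ = _ := by ring

/-! ### Gradient bound for eigenfunctions -/

theorem gradNorm_eq_of_ae_eq {u h : L2}
    (hh : h =ᵐ[volume] fun ξ => (Real.sqrt (lsym ξ) : ℂ) * F2 u ξ) :
    gradNorm u = ENNReal.ofReal ‖h‖ := by
  have hm := (memLp_congr_ae hh).1 (Lp.memLp h)
  unfold gradNorm
  rw [gradNormSq_eq_of_memLp hm]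
  have : ∫ ξ, lsym ξ * ‖F2 u ξ‖ ^ 2 = ‖h‖ ^ 2 := by
    rw [norm_sq_eq_integral]
    refine integral_congr_ae ?_
    filter_upwards [hh] with ξ k
    rw [k, norm_mul, mul_pow, Complex.norm_real, Real.norm_eq_abs, sq_abs,
      Real.sq_sqrt (lsym_nonneg ξ)]
  rw [this, ENNReal.ofReal_rpow_of_nonneg (by positivity) (by norm_num), ← Real.sqrt_eq_rpow,
    Real.sqrt_sq (norm_nonneg _)]

/-- `2π|ξ| m_K(ξ) ≤ 1`: the gradient is absorbed by the symbol of the form factor, uniformly in `K`,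
and only `‖ψ f‖` is left. -/
theorem exists_grad_smearAdj {L : ℝ} (hL : 0 ≤ L) (hψL : ∀ᵐ x, ‖ψ x‖ ≤ L) (K : ℝ≥0∞)
    (f : L2) : ∃ h : L2, (h =ᵐ[volume] fun ξ =>
      (Real.sqrt (lsym ξ) : ℂ) * F2 (smearAdj ψ K f) ξ) ∧ ‖h‖ ≤ L * ‖f‖ := by
  have hpi := Real.pi_pos
  have hψ' := memLp_top_of_ae_le hψL
  have hs : ∀ ξ, Real.sqrt (lsym ξ) = 2 * Real.pi * ‖ξ‖ := by
    intro ξ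
    unfold lsym
    rw [← mul_pow, Real.sqrt_sq (by positivity)]
  have hle : ∀ᵐ ξ, ‖(Real.sqrt (lsym ξ) : ℂ) * F2 (smearAdj ψ K f) ξ‖ ≤
      ‖F2 (mulOp ψ f) ξ‖ := by
    rw [F2_smearAdj]
    filter_upwards [coeFn_aOp hψ' K f] with ξ h1
    rw [h1, ← mul_assoc, norm_mul]
    refine mul_le_of_le_one_left (norm_nonneg _) ?_
    rw [← Complex.ofReal_mul, Complex.norm_real, Real.norm_eq_abs,
      abs_of_nonneg (mul_nonneg (Real.sqrt_nonneg _) (msym_nonneg K ξ)), hs]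
    calc 2 * Real.pi * ‖ξ‖ * msym K ξ ≤ 2 * Real.pi * ‖ξ‖ * (2 * Real.pi * ‖ξ‖)⁻¹ := by
          gcongr
          rw [← msym_top]
          exact msym_le_top K ξ
      _ ≤ 1 := mul_inv_le_one
  have hm : MemLp (fun ξ => (Real.sqrt (lsym ξ) : ℂ) * F2 (smearAdj ψ K f) ξ) 2
      (volume : Measure E3) := by
    refine (Lp.memLp (F2 (mulOp ψ f))).of_le ?_ hle
    exact (Complex.measurable_ofReal.comp
      (continuous_lsym.measurable.sqrt)).aestronglyMeasurable.mul (Lp.aestronglyMeasurable _)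
  refine ⟨hm.toLp _, hm.coeFn_toLp, ?_⟩
  calc ‖hm.toLp _‖ ≤ ‖F2 (mulOp ψ f)‖ := by
        refine Lp.norm_le_norm_of_ae_le ?_
        filter_upwards [hm.coeFn_toLp, hle] with ξ h1 h2
        rw [h1]; exact h2
    _ = ‖mulOp ψ f‖ := F2.norm_map _
    _ ≤ L * ‖f‖ := (mulOp ψ).le_of_opNorm_le (norm_mulOp_le hψ' hL hψL) f

/-- The eigenvalue equation reads `(1 - l) u = 4 Π₁ A_K f` with `f = R S_K u`. The prefactor `4/(1 -
l)` is partly compensated by `‖f‖ = O((1 - l)^{1/2})`, which leaves the power `-1/2`. -/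
theorem eigenvector_bound (hψ : IsPekarMinimizer ψ) {L : ℝ} (hL : 0 ≤ L)
    (hψL : ∀ᵐ x, ‖ψ x‖ ≤ L) (K : ℝ≥0∞) {l : ℝ} (hl : l ∈ Set.Ioo (0 : ℝ) 1) {u : L2}
    (hu : ‖u‖ = 1) (he : cutoffHessian ψ K u = (l : ℂ) • u) :
    u ∈ ranPiOne ψ ∧ gradNorm u ≤ ENNReal.ofReal
      (2 * L * (1 + 4 * ‖reducedResolvent ψ‖ * ‖aOp ψ ∞‖ ^ 2) * Real.sqrt ‖reducedResolvent ψ‖ *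
        (1 - l) ^ (-(1 / 2) : ℝ)) := by
  obtain ⟨hl0, hl1⟩ := hl
  have hlc : (l : ℂ) ≠ 0 := by exact_mod_cast hl0.ne'
  have hl1' : 0 < 1 - l := by linarith
  have hlc' : ((1 - l : ℝ) : ℂ) ≠ 0 := by exact_mod_cast hl1'.ne'
  have hP : piOne ψ u = u := by
    have h := piOne_cutoffHessian hψ K u
    rw [he, map_smul] at h
    exact smul_right_injective _ hlc h
  refine ⟨mem_ranPiOne_iff.2 hP, ?_⟩
  rw [cutoffHessian_apply hψ, hP] at he
  set f := reducedResolvent ψ (smearOp ψ K u) with hf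
  set w := smearAdj ψ K f with hw
  have hG : hessOp ψ K u = w := rfl
  rw [hG] at he
  have hu1 : ((1 - l : ℝ) : ℂ) • u = (4 : ℂ) • piOne ψ w := by
    push_cast
    rw [sub_smul, one_smul, ← he]
    abel
  -- the size of `f`
  have hq : (inner ℂ (smearOp ψ K u) f).re = (1 - l) / 4 := by
    have h1 : inner ℂ (smearOp ψ K u) f = inner ℂ u w := by
      rw [hw, inner_smearAdj_right]
    have h2 : inner ℂ u (((1 - l : ℝ) : ℂ) • u) = (4 : ℂ) * inner ℂ u w := by
      rw [hu1, inner_smul_right, ← piOne_symm, hP]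
    rw [inner_smul_right, inner_self_eq_norm_sq_to_K, hu] at h2
    rw [h1]
    have h3 : inner ℂ u w = (((1 - l) / 4 : ℝ) : ℂ) := by
      have : (4 : ℂ) * inner ℂ u w = ((1 - l : ℝ) : ℂ) := by rw [← h2]; simp
      push_cast at this ⊢
      linear_combination this / 4
    rw [h3, Complex.ofReal_re]
  set R := ‖reducedResolvent ψ‖ with hR
  set A := ‖aOp ψ ∞‖ with hA
  have hR0 : 0 ≤ R := norm_nonneg _
  have hA0 : 0 ≤ A := norm_nonneg _
  -- Positivity of `R` bounds `‖f‖²` by `‖R‖ ⟨S_K u, f⟩`, and the eigenvalue equation evaluates this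
  -- form as `(1 - l)/4`.
  have hf2 : ‖f‖ ^ 2 ≤ R * ((1 - l) / 4) := by
    have := norm_apply_sq_le_of_nonneg (reducedResolvent_symm hψ) (reducedResolvent_nonneg hψ)
      (smearOp ψ K u)
    rw [hq] at this
    exact this
  have hfle : ‖f‖ ≤ Real.sqrt R * (Real.sqrt (1 - l) / 2) := by
    refine abs_le_of_sq_le_sq' ?_ (by positivity) |>.2
    rw [mul_pow, div_pow, Real.sq_sqrt hR0, Real.sq_sqrt hl1'.le]
    linarith
  -- the component in the kernel
  set f' := (4 : ℂ) • reducedResolvent ψ (smearOp ψ ∞ (w - piOne ψ w)) with hf'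
  -- Elements of `Ker H^Pek` are fixed by `4 hessOp ψ ∞`, so this component too lies in the range of
  -- an adjoint smearing operator, and its gradient is controlled.
  have hw' : w - piOne ψ w = smearAdj ψ ∞ f' := by
    rw [hf', map_smul, ← hessOp_apply, four_smul_hessOp_sub_piOne hψ]
  have hf'le : ‖f'‖ ≤ 4 * R * A ^ 2 * ‖f‖ := by
    rw [hf', norm_smul, Complex.norm_ofNat]
    calc 4 * ‖reducedResolvent ψ (smearOp ψ ∞ (w - piOne ψ w))‖
        ≤ 4 * (R * (A * (A * ‖f‖))) := by
          gcongr
          refine ((reducedResolvent ψ).le_opNorm _).trans ?_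
          gcongr
          refine (norm_smearOp_le ψ ∞ _).trans ?_
          gcongr
          exact (norm_sub_piOne_le ψ w).trans (norm_smearAdj_le ψ K f)
      _ = _ := by ring
  obtain ⟨h, hh, hhle⟩ := exists_grad_smearAdj hL hψL K f
  obtain ⟨h', hh', hhle'⟩ := exists_grad_smearAdj hL hψL ∞ f'
  have hu2 : u = ((4 / (1 - l) : ℝ) : ℂ) • (w - smearAdj ψ ∞ f') := by
    rw [← hw', sub_sub_cancel]
    have : u = ((1 - l : ℝ) : ℂ)⁻¹ • ((1 - l : ℝ) : ℂ) • u := (inv_smul_smul₀ hlc' u).symm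
    rw [this, hu1, smul_smul]
    congr 1
    push_cast
    ring
  have hgrad : gradNorm u = ENNReal.ofReal ‖((4 / (1 - l) : ℝ) : ℂ) • (h - h')‖ := by
    refine gradNorm_eq_of_ae_eq ?_
    have e : F2 u = ((4 / (1 - l) : ℝ) : ℂ) • (F2 w - F2 (smearAdj ψ ∞ f')) := by
      conv_lhs => rw [hu2]
      rw [map_smul, map_sub]
    rw [e]
    filter_upwards [hh, hh', Lp.coeFn_smul (((4 / (1 - l) : ℝ) : ℂ)) (h - h'), Lp.coeFn_sub h h',
      Lp.coeFn_smul (((4 / (1 - l) : ℝ) : ℂ)) (F2 w - F2 (smearAdj ψ ∞ f')),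
      Lp.coeFn_sub (F2 w) (F2 (smearAdj ψ ∞ f'))] with ξ k1 k2 k3 k4 k5 k6
    rw [k3, k5, Pi.smul_apply, Pi.smul_apply, k4, k6, Pi.sub_apply, Pi.sub_apply, k1, k2,
      smul_eq_mul, smul_eq_mul]
    ring
  rw [hgrad]
  refine ENNReal.ofReal_le_ofReal ?_
  rw [norm_smul, Complex.norm_real, Real.norm_eq_abs, abs_of_pos (by positivity)]
  set s := Real.sqrt (1 - l) with hs
  have hs0 : 0 < s := Real.sqrt_pos.2 hl1'
  have hs2 : 1 - l = s * s := (Real.mul_self_sqrt hl1'.le).symm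
  have hpow : (1 - l) ^ (-(1 / 2) : ℝ) = s⁻¹ := by
    rw [Real.rpow_neg hl1'.le, ← Real.sqrt_eq_rpow]
  rw [hpow]
  calc 4 / (1 - l) * ‖h - h'‖ ≤ 4 / (1 - l) * (L * ‖f‖ + L * (4 * R * A ^ 2 * ‖f‖)) := by
        gcongr
        refine (norm_sub_le _ _).trans (add_le_add hhle (hhle'.trans ?_))
        gcongr
    _ = 4 / (1 - l) * (L * (1 + 4 * R * A ^ 2)) * ‖f‖ := by ring
    _ ≤ 4 / (1 - l) * (L * (1 + 4 * R * A ^ 2)) * (Real.sqrt R * (s / 2)) := by gcongr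
    _ = _ := by
      rw [hs2]
      field_simp
      ring

end Polaron

end

/-! ### Choice of constants and conclusion -/

theorem mainTheorem6 (ψ : Polaron.L2) (hψ : Polaron.IsPekarMinimizer ψ) :
    ∃ K₀ : ℝ, 0 < K₀ ∧ ∃ C : ℝ, 0 < C ∧
      ∀ K : ℝ≥0∞, ENNReal.ofReal K₀ ≤ K →
        -- (v) infinitely many discrete eigenvalues in `[0, 1)`, accumulating exactly at one
        (Polaron.discreteSpectrum (Polaron.cutoffHessian ψ K) ∩ Set.Ico 0 1).Infinite ∧
        (∀ t : ℝ, AccPt t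
          (𝓟 (Polaron.discreteSpectrum (Polaron.cutoffHessian ψ K) ∩ Set.Ico 0 1)) ↔ t = 1) ∧
        -- the eigenvalues in `(0, 1)` form an infinite increasing sequence, with limit one
        (∃ lam : ℕ → ℝ,
          Polaron.IsEigenvalueEnumeration (Polaron.cutoffHessian ψ K) lam ∧
          Tendsto lam atTop (𝓝 1)) ∧
        -- (vi)
        (∀ lamK lamInf : ℕ → ℝ,
          Polaron.IsEigenvalueEnumeration (Polaron.cutoffHessian ψ K) lamK →
          Polaron.IsEigenvalueEnumeration (Polaron.cutoffHessian ψ ∞) lamInf →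
          ∀ n : ℕ, ENNReal.ofReal |lamK n - lamInf n| ≤
            ENNReal.ofReal C * K ^ (-(1 / 2) : ℝ)) ∧
        -- (vii)
        (∀ lamK : ℕ → ℝ,
          Polaron.IsEigenvalueEnumeration (Polaron.cutoffHessian ψ K) lamK →
          ∀ (n : ℕ) (u : Polaron.L2), ‖u‖ = 1 →
            Polaron.cutoffHessian ψ K u = (lamK n : ℂ) • u →
            u ∈ Polaron.ranPiOne ψ ∧
            Polaron.gradNorm u ≤ ENNReal.ofReal C * K ^ (1 / 2 : ℝ) *
              ENNReal.ofReal ((1 - lamK n) ^ (-(1 / 2) : ℝ))) := by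
  obtain ⟨L, hL0, hL⟩ := Polaron.exists_ae_norm_le hψ
  obtain ⟨c, hc0, hc1, hgap⟩ := Polaron.exists_gap hψ
  set D : ℝ := 8 * ‖Polaron.aOp ψ ∞‖ * ‖Polaron.reducedResolvent ψ‖ * L with hD
  set C₁ : ℝ := 2 * L * (1 + 4 * ‖Polaron.reducedResolvent ψ‖ * ‖Polaron.aOp ψ ∞‖ ^ 2) *
    Real.sqrt ‖Polaron.reducedResolvent ψ‖ with hC₁
  have hD0 : 0 ≤ D := by positivity
  have hC₁0 : 0 ≤ C₁ := by positivity
  -- This `K₀` ensures `K ≥ 1`, as needed to compare powers of `K` and to fit the momentum shells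
  -- under the cutoff, and `D / K ≤ c / 4`, so that the perturbation stays within the gap.
  refine ⟨1 + 4 * D / c, by positivity, D + C₁ + 1, by positivity, fun K hK => ?_⟩
  have hK1 : 1 ≤ K := by
    refine le_trans ?_ hK
    rw [← ENNReal.ofReal_one]
    exact ENNReal.ofReal_le_ofReal (le_add_of_nonneg_right (by positivity))
  have hcomp := Polaron.isCompactOperator_one_sub_cutoffHessian hψ K
  have hsymm := Polaron.isSymmetric_one_sub_cutoffHessian hψ K
  have hcomp' := Polaron.isCompactOperator_one_sub_cutoffHessian hψ ∞
  have hsymm' := Polaron.isSymmetric_one_sub_cutoffHessian hψ ∞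
  have hinf := Polaron.infinite_eigenvalueSet (Polaron.infinite_eigenvalues hcomp hsymm
    (Polaron.re_inner_one_sub_cutoffHessian hψ K)
    (Polaron.exists_mem_orthogonal_apply_ne_zero hψ hK1))
  have hinf' : (Polaron.discreteSpectrum (Polaron.cutoffHessian ψ K) ∩ Set.Ico 0 1).Infinite := by
    rw [Polaron.discreteSpectrum_inter_Ico hcomp hsymm]
    exact hinf.mono fun μ hμ => ⟨⟨hμ.1.1.le, hμ.1.2⟩, hμ.2⟩
  -- For finite `K` the choice is `δ = D / K`, below a multiple of `K^{-1/2}` as `K ≥ 1`. For `K =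
  -- ∞` the right side is zero, so `δ` must be zero.
  obtain ⟨δ, hδ, hδc, hδK⟩ : ∃ δ : ℝ,
      ‖Polaron.cutoffHessian ψ K - Polaron.cutoffHessian ψ ∞‖ ≤ δ ∧ δ ≤ c / 4 ∧
      ENNReal.ofReal δ ≤ ENNReal.ofReal (D + C₁ + 1) * K ^ (-(1 / 2) : ℝ) := by
    by_cases hKt : K = ∞
    · refine ⟨0, by rw [hKt, sub_self, norm_zero], by positivity, by simp⟩
    · obtain ⟨k, rfl⟩ : ∃ k : ℝ, K = ENNReal.ofReal k := ⟨K.toReal, (ENNReal.ofReal_toReal hKt).symm⟩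
      have hk0 : 0 < k := by
        by_contra! h
        rw [ENNReal.ofReal_of_nonpos h] at hK1
        exact absurd hK1 (by simp)
      have hk : 1 + 4 * D / c ≤ k := (ENNReal.ofReal_le_ofReal_iff hk0.le).1 hK
      have hk1 : 1 ≤ k := le_trans (le_add_of_nonneg_right (by positivity)) hk
      refine ⟨D * k⁻¹, Polaron.norm_cutoffHessian_sub_le hψ hL0.le hL hk0, ?_, ?_⟩
      · rw [← div_eq_mul_inv, div_le_iff₀ hk0]
        have h1 : 4 * D / c ≤ k := by linarith
        rw [div_le_iff₀ hc0] at h1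
        linarith
      · rw [ENNReal.ofReal_rpow_of_pos hk0, ← ENNReal.ofReal_mul (by positivity)]
        refine ENNReal.ofReal_le_ofReal (mul_le_mul (by linarith) ?_ (by positivity) (by positivity))
        rw [← Real.rpow_neg_one]
        exact Real.rpow_le_rpow_of_exponent_le hk1 (by norm_num)
  have hδ' : ‖(1 - Polaron.cutoffHessian ψ K) - (1 - Polaron.cutoffHessian ψ ∞)‖ ≤ δ := by
    rw [sub_sub_sub_cancel_left, norm_sub_rev]
    exact hδ
  have hδ0 : 0 ≤ δ := (norm_nonneg _).trans hδ
  -- Weyl's comparison in both directions. The gap is needed for either operator: for `K = ∞` it is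
  -- the original one, for `K` it is diminished by `δ`.
  have hrank : Module.finrank ℂ (Polaron.spectralSum (1 - Polaron.cutoffHessian ψ K) (Set.Ici 1)) =
      Module.finrank ℂ (Polaron.spectralSum (1 - Polaron.cutoffHessian ψ ∞) (Set.Ici 1)) := by
    refine le_antisymm ?_ ?_
    · refine Polaron.finrank_spectralSum_one_le hcomp hsymm hcomp' hsymm' hc1 hc0 hδc hδ'
        fun τ hτ he => ?_
      exact Polaron.gap_le_abs_of_eigenvalue (Polaron.one_sub_cutoffHessian_sub_piOne hψ ∞) hgap
        (by rw [sub_self, norm_zero]; exact hδ0) hτ he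
    · refine Polaron.finrank_spectralSum_one_le hcomp' hsymm' hcomp hsymm hc1 hc0 hδc
        (by rw [norm_sub_rev]; exact hδ') fun τ hτ he => ?_
      exact Polaron.gap_le_abs_of_eigenvalue (Polaron.one_sub_cutoffHessian_sub_piOne hψ K) hgap
        hδ' hτ he
  refine ⟨hinf', Polaron.accPt_discreteSpectrum_iff hcomp hsymm hinf',
    Polaron.exists_eigenvalueEnumeration hcomp hsymm hinf, ?_, ?_⟩
  · intro lamK lamInf h h' n
    exact (ENNReal.ofReal_le_ofReal
      (h.abs_sub_le hcomp hsymm hcomp' hsymm' h' hδ hrank n)).trans hδK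
  · intro lamK h n u hu he
    obtain ⟨h1, h2⟩ := Polaron.eigenvector_bound hψ hL0.le hL K (h.mem n) hu he
    refine ⟨h1, h2.trans ?_⟩
    rw [ENNReal.ofReal_mul hC₁0]
    gcongr
    -- The bound obtained is independent of `K`; the factor `K^{1/2} ≥ 1` only enlarges it.
    calc ENNReal.ofReal C₁ ≤ ENNReal.ofReal (D + C₁ + 1) :=
          ENNReal.ofReal_le_ofReal (by linarith)
      _ ≤ ENNReal.ofReal (D + C₁ + 1) * K ^ (1 / 2 : ℝ) :=
          le_mul_of_one_le_right zero_le (ENNReal.one_le_rpow hK1 (by norm_num))
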